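/- Let $(Z,d)$ be a metric space and $\mu$ a Borel measure on $Z$ such that all balls have positive finite measure and, for constants $C\ge 1$, $Q>0$, $\mu(B(\xi,\lambda r))\le C\lambda^Q\mu(B(\xi,r))$ for all $\xi\in Z$, $r>0$, $\lambda\ge 1$. For every $n\in\mathbb Z$ let $(\xi_x)_{x\in X_n}$ be a maximal set of points of $Z$ with pairwise distances at least $2^{-n-1}$; let $X=\bigsqcup_n X_n$, and for $x\in X_n$ put $|x|=n$ and $B(x)=B(\xi_x,2^{-n})$. Write $x\sim x'$ for distinct $x,x'\in X$ with $B(x)\cap B(x')\neq\emptyset$ and $||x|-|x'||\le 1$. For $u\colon X\to\mathbb C$ put $|du|(x)=\big(\sum_{x'\sim x}|u(x')-u(x)|^2\big)^{1/2}$, and let $$\|u\|_{\mathcal I^s_{p,q}(X)}=\Big(\sum_{k\in\mathbb Z}2^{ksq}\Big\|\sum_{x\in X_k}|u(x)|\chi_{B(x)}\Big\|_{L^p(Z)}^q\Big)^{1/q}$$ (usual modification for $q=\infty$); $\mathcal I^s_{p,q}(X)$ is the space of $u$ for which this is finite. Let $L^1_{\rm loc}(Z)$ be the space of measurable $f\colon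 Z\to\mathbb C$ integrable on bounded sets, and let $Pf(x)=\mu(B(x))^{-1}\int_{B(x)}f\,d\mu$. The vector space $\mathcal B$ consists of the $f\in L^1_{\rm loc}(Z)$ with $\|f\|_{\mathcal B}:=\||d(Pf)|\|_{\mathcal I^s_{p,q}(X)}<\infty$; the Besov space $\dot{\mathcal B}^s_{p,q}(Z)$ is $\mathcal B$ modulo functions that are constant $\mu$-a.e., with quasi-norm $\|\cdot\|_{\mathcal B}$. Fix non-negative Lipschitz functions $(\psi_x)_{x\in X}$ with $\psi_x=0$ off $B(x)$, with Lipschitz constants at most $L2^{|x|}$ ($L$ independent of $x$), and with $\sum_{x\in X_n}\psi_x=1$ on $Z$ for every $n$. The trace of $u$ is $\operatorname{Tr}u=\lim_{n\to\infty}\sum_{x\in X_n}u(x)\psi_x$, the limit being in $L^1_{\rm loc}(Z)$ and pointwise $\mu$-a.e. Fix $x_0\in X$ and put $$\mathring{\mathcal D}=\{u:|du|\in\mathcal I^s_{p,q}(X),\,u(x_0)=0\},\quad \mathring{\mathcal I}=\{u\in\mathcal I^s_{p,q}(X):u(x_0)=0\},\quad \mathring{\mathcal K}=\{v-v(x_0):v\in\mathcal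 I^s_{p,q}(X)\}.$$ $\mathring{\mathcal D}$ carries the quasi-norm $\||du|\|_{\mathcal I^s_{p,q}(X)}$, and its quotients the quotient quasi-norm. **Theorem.** Let $0<s<\infty$, $Q/(Q+s)<p\le\infty$ and $0<q\le\infty$. Then $\mathring{\mathcal I}$ and $\mathring{\mathcal K}$ are subspaces of $\mathring{\mathcal D}$, every $u\in\mathring{\mathcal D}$ has a trace, and the trace lies in $\mathcal B$. (i) For $u\in\mathring{\mathcal D}$, $\operatorname{Tr}u=0$ $\mu$-a.e. if and only if $u\in\mathring{\mathcal I}$. (ii) The quotients $\mathring{\mathcal D}/\mathring{\mathcal I}$ and $\mathring{\mathcal D}/\mathring{\mathcal K}$ are quasi-normed spaces. The trace induces a linear isomorphism, with equivalent quasi-norms, of $\mathring{\mathcal D}/\mathring{\mathcal I}$ onto $\mathcal B$ modulo $\mu$-a.e. equality (constants not divided out), equipped with $\|f\|_{\mathcal B}+\|f\|_{L^1(B(x_0))}$. Dividing out constants, the trace induces a linear isomorphism, with equivalent quasi-norms, $$\mathring{\mathcal D}/\mathring{\mathcal K}\;\approx\;\dot{\mathcal B}^s_{p,q}(Z).$$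 Moreover $\dot{\mathcal B}^s_{p,q}(Z)$ is a quasi-Banach space, and when $1<p,q<\infty$ it is a reflexive Banach space. -/

import Mathlib

open MeasureTheory Filter Topology
open scoped ENNReal NNReal

/-! ### Hyperbolic fillings of a metric space -/

/-- For every level `n ∈ ℤ` a maximal set of points of `Z` with pairwise distances at least
`2^(-n-1)`.  Since these distances are positive, the points serve as their own indices. -/
structure HyperbolicFilling (Z : Type*) [MetricSpace Z] where
  net : ℤ → Set Z
  maximal : ∀ n : ℤ,
    Maximal (fun S : Set Z => S.Pairwise fun ξ η => (2 : ℝ) ^ (-n - 1) ≤ dist ξ η) (net n)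

namespace HyperbolicFilling

/-- The vertex set `X = ⨆ₙ Xₙ` (disjoint union over the levels `n ∈ ℤ`). -/
abbrev Vertex {Z : Type*} [MetricSpace Z] (A : HyperbolicFilling Z) : Type _ :=
  Σ n : ℤ, A.net n

/-- The ball `B(x) = B(ξ_x, 2^(-|x|))` of a vertex. -/
def vball {Z : Type*} [MetricSpace Z] (A : HyperbolicFilling Z) (x : A.Vertex) : Set Z :=
  Metric.ball (x.2 : Z) ((2 : ℝ) ^ (-x.1))

/-- Distinct vertices are joined by an edge iff their balls meet and their levels differ by at
most one. -/
def graph {Z : Type*} [MetricSpace Z] (A : HyperbolicFilling Z) : SimpleGraph A.Vertex where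
  Adj x y := x ≠ y ∧ (A.vball x ∩ A.vball y).Nonempty ∧ |x.1 - y.1| ≤ 1
  symm := ⟨fun x y h =>
    ⟨h.1.symm, by rw [Set.inter_comm]; exact h.2.1, by rw [abs_sub_comm]; exact h.2.2⟩⟩
  loopless := ⟨fun _ h => h.1 rfl⟩

/-- `|du|(x) = (∑_{y ∼ x} |u(y) - u(x)|²)^(1/2)`. -/
noncomputable def gradNorm {Z : Type*} [MetricSpace Z] (A : HyperbolicFilling Z)
    (u : A.Vertex → ℂ) (x : A.Vertex) : ℝ≥0∞ :=
  (∑' y : A.graph.neighborSet x, ‖u y - u x‖ₑ ^ 2) ^ (1 / 2 : ℝ)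

/-- The function `∑_{x ∈ X_k} w(x) χ_{B(x)}` on `Z`. -/
noncomputable def levelSum {Z : Type*} [MetricSpace Z] (A : HyperbolicFilling Z)
    (w : A.Vertex → ℝ≥0∞) (k : ℤ) (ζ : Z) : ℝ≥0∞ :=
  ∑' x : A.net k, (A.vball ⟨k, x⟩).indicator (fun _ => w ⟨k, x⟩) ζ

/-- The quasi-norm of `I^s_{p,q}(X)` of a sequence with values in `[0, ∞]`: the `ℓ^q(ℤ)` norm of
the numbers `2^(ks) ‖∑_{x ∈ X_k} w(x) χ_{B(x)}‖_{L^p(Z)}` (a supremum for `q = ∞`). -/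
noncomputable def seqNorm {Z : Type*} [MetricSpace Z] [MeasurableSpace Z]
    (A : HyperbolicFilling Z) (μ : Measure Z) (s : ℝ) (p q : ℝ≥0∞)
    (w : A.Vertex → ℝ≥0∞) : ℝ≥0∞ :=
  eLpNorm (fun k : ℤ => (2 : ℝ≥0∞) ^ ((k : ℝ) * s) * eLpNorm (A.levelSum w k) p μ) q
    Measure.count

/-- The Poisson extension `Pf(x) = ⨍_{B(x)} f dμ`. -/
noncomputable def poisson {Z : Type*} [MetricSpace Z] [MeasurableSpace Z]
    (A : HyperbolicFilling Z) (μ : Measure Z) (f : Z → ℂ) (x : A.Vertex) : ℂ :=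
  ⨍ ζ in A.vball x, f ζ ∂μ

end HyperbolicFilling

/-- Integrability on all bounded subsets. -/
def LocIntegrable {Z : Type*} [MetricSpace Z] [MeasurableSpace Z] (μ : Measure Z)
    (f : Z → ℂ) : Prop :=
  ∀ S : Set Z, Bornology.IsBounded S → IntegrableOn f S μ

namespace HyperbolicFilling

/-! ### Facts that make the spaces below vector spaces -/

theorem measurable_levelSum {Z : Type*} [MetricSpace Z] [MeasurableSpace Z] [BorelSpace Z]
    (A : HyperbolicFilling Z) (w : A.Vertex → ℝ≥0∞) (k : ℤ) : Measurable (A.levelSum w k) := by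
  refine LowerSemicontinuous.measurable ?_
  unfold levelSum
  refine lowerSemicontinuous_tsum fun x => ?_
  exact Metric.isOpen_ball.lowerSemicontinuous_indicator zero_le

theorem seqNorm_le_mul {Z : Type*} [MetricSpace Z] [MeasurableSpace Z] [BorelSpace Z]
    (A : HyperbolicFilling Z) (μ : Measure Z) (s : ℝ) (p q : ℝ≥0∞)
    {w w' : A.Vertex → ℝ≥0∞} (c : ℝ≥0) (h : ∀ x, w x ≤ c * w' x) :
    A.seqNorm μ s p q w ≤ c * A.seqNorm μ s p q w' := by
  unfold seqNorm
  refine eLpNorm_le_mul_eLpNorm_of_ae_le_mul' (ae_of_all _ fun k => ?_) q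
  simp only [enorm_eq_self]
  rw [mul_left_comm]
  gcongr
  refine eLpNorm_le_mul_eLpNorm_of_ae_le_mul' (ae_of_all _ fun ζ => ?_) p
  simp only [enorm_eq_self, levelSum]
  rw [← ENNReal.tsum_mul_left]
  refine ENNReal.tsum_le_tsum fun x => ?_
  by_cases hζ : ζ ∈ A.vball ⟨k, x⟩
  · simpa [hζ] using h _
  · simp [hζ]

theorem seqNorm_add_le {Z : Type*} [MetricSpace Z] [MeasurableSpace Z] [BorelSpace Z]
    (A : HyperbolicFilling Z) (μ : Measure Z) (s : ℝ) (p q : ℝ≥0∞) (w w' : A.Vertex → ℝ≥0∞) :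
    A.seqNorm μ s p q (fun x => w x + w' x) ≤
      ENNReal.LpAddConst p * (ENNReal.LpAddConst q * (A.seqNorm μ s p q w + A.seqNorm μ s p q w')) := by
  have hadd : ∀ k, A.levelSum (fun x => w x + w' x) k = A.levelSum w k + A.levelSum w' k := by
    intro k
    funext ζ
    simp only [levelSum, Pi.add_apply]
    rw [← ENNReal.tsum_add]
    refine tsum_congr fun x => ?_
    by_cases hζ : ζ ∈ A.vball ⟨k, x⟩ <;> simp [hζ]
  have hc : ((ENNReal.LpAddConst p).toNNReal : ℝ≥0∞) = ENNReal.LpAddConst p :=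
    ENNReal.coe_toNNReal (ENNReal.LpAddConst_lt_top p).ne
  unfold seqNorm
  calc _ ≤ ((ENNReal.LpAddConst p).toNNReal : ℝ≥0∞) * eLpNorm
        ((fun k : ℤ => (2 : ℝ≥0∞) ^ ((k : ℝ) * s) * eLpNorm (A.levelSum w k) p μ) +
          fun k : ℤ => (2 : ℝ≥0∞) ^ ((k : ℝ) * s) * eLpNorm (A.levelSum w' k) p μ) q
          Measure.count := by
        refine eLpNorm_le_mul_eLpNorm_of_ae_le_mul' (ae_of_all _ fun k => ?_) q
        simp only [enorm_eq_self, hadd, Pi.add_apply, hc]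
        rw [← mul_add, mul_left_comm]
        gcongr
        exact eLpNorm_add_le' (A.measurable_levelSum w k).aestronglyMeasurable
          (A.measurable_levelSum w' k).aestronglyMeasurable p
    _ ≤ _ := by
        rw [hc]
        gcongr
        exact eLpNorm_add_le' (measurable_of_countable _).aestronglyMeasurable
          (measurable_of_countable _).aestronglyMeasurable q

theorem seqNorm_add_lt_top {Z : Type*} [MetricSpace Z] [MeasurableSpace Z] [BorelSpace Z]
    (A : HyperbolicFilling Z) (μ : Measure Z) (s : ℝ) (p q : ℝ≥0∞) {w w' v : A.Vertex → ℝ≥0∞}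
    (c : ℝ≥0) (h : ∀ x, v x ≤ c * (w x + w' x)) (hw : A.seqNorm μ s p q w < ∞)
    (hw' : A.seqNorm μ s p q w' < ∞) : A.seqNorm μ s p q v < ∞ := by
  refine (A.seqNorm_le_mul μ s p q c h).trans_lt (ENNReal.mul_lt_top ENNReal.coe_lt_top ?_)
  refine (A.seqNorm_add_le μ s p q w w').trans_lt ?_
  exact ENNReal.mul_lt_top (ENNReal.LpAddConst_lt_top p)
    (ENNReal.mul_lt_top (ENNReal.LpAddConst_lt_top q) (ENNReal.add_lt_top.2 ⟨hw, hw'⟩))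

theorem seqNorm_zero {Z : Type*} [MetricSpace Z] [MeasurableSpace Z] [BorelSpace Z]
    (A : HyperbolicFilling Z) (μ : Measure Z) (s : ℝ) (p q : ℝ≥0∞) :
    A.seqNorm μ s p q (fun _ => 0) = 0 := by
  have h := A.seqNorm_le_mul μ s p q (w := fun _ => 0) (w' := fun _ => 0) 0 (by simp)
  simpa using h

theorem gradNorm_const {Z : Type*} [MetricSpace Z] (A : HyperbolicFilling Z) (c : ℂ) :
    A.gradNorm (fun _ => c) = fun _ => 0 := by
  funext x
  simp [gradNorm]

theorem gradNorm_add_const {Z : Type*} [MetricSpace Z] (A : HyperbolicFilling Z)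
    (u : A.Vertex → ℂ) (c : ℂ) : A.gradNorm (fun x => u x + c) = A.gradNorm u := by
  funext x
  simp [gradNorm]

theorem gradNorm_smul {Z : Type*} [MetricSpace Z] (A : HyperbolicFilling Z) (c : ℂ)
    (u : A.Vertex → ℂ) (x : A.Vertex) : A.gradNorm (c • u) x = ‖c‖ₑ * A.gradNorm u x := by
  unfold gradNorm
  have : ∀ y : A.graph.neighborSet x,
      ‖(c • u) y - (c • u) x‖ₑ ^ 2 = ‖c‖ₑ ^ 2 * ‖u y - u x‖ₑ ^ 2 := by
    intro y
    rw [Pi.smul_apply, Pi.smul_apply, ← smul_sub, enorm_smul, mul_pow]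
  rw [tsum_congr this, ENNReal.tsum_mul_left,
    ENNReal.mul_rpow_of_nonneg _ _ (by norm_num : (0 : ℝ) ≤ 1 / 2), ← ENNReal.rpow_natCast,
    ← ENNReal.rpow_mul]
  norm_num

theorem gradNorm_add_le {Z : Type*} [MetricSpace Z] (A : HyperbolicFilling Z)
    (u v : A.Vertex → ℂ) (x : A.Vertex) :
    A.gradNorm (u + v) x ≤ (2 : ℝ≥0) * (A.gradNorm u x + A.gradNorm v x) := by
  unfold gradNorm
  have h2 : ∀ y : A.graph.neighborSet x, ‖(u + v) y - (u + v) x‖ₑ ^ 2 ≤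
      2 ^ 2 * (‖u y - u x‖ₑ ^ 2 + ‖v y - v x‖ₑ ^ 2) := by
    intro y
    have hle : ‖(u + v) y - (u + v) x‖ₑ ≤ 2 * max ‖u y - u x‖ₑ ‖v y - v x‖ₑ := by
      rw [Pi.add_apply, Pi.add_apply, add_sub_add_comm, two_mul]
      exact (enorm_add_le _ _).trans (add_le_add (le_max_left _ _) (le_max_right _ _))
    calc _ ≤ (2 * max ‖u y - u x‖ₑ ‖v y - v x‖ₑ) ^ 2 := by gcongr
      _ ≤ _ := by
        rw [mul_pow]
        gcongr
        rcases le_total ‖u y - u x‖ₑ ‖v y - v x‖ₑ with h | h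
        · rw [max_eq_right h]; exact le_add_self
        · rw [max_eq_left h]; exact le_self_add
  calc _ ≤ (2 ^ 2 * ((∑' y : A.graph.neighborSet x, ‖u y - u x‖ₑ ^ 2) +
          ∑' y : A.graph.neighborSet x, ‖v y - v x‖ₑ ^ 2)) ^ (1 / 2 : ℝ) := by
        rw [← ENNReal.tsum_add, ← ENNReal.tsum_mul_left]
        gcongr with y
        exact h2 y
    _ ≤ _ := by
        rw [ENNReal.mul_rpow_of_nonneg _ _ (by norm_num : (0 : ℝ) ≤ 1 / 2),
          ← ENNReal.rpow_natCast, ← ENNReal.rpow_mul]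
        have h1 : ((2 : ℕ) : ℝ) * (1 / 2 : ℝ) = 1 := by norm_num
        rw [h1, ENNReal.rpow_one]
        gcongr
        · simp
        · exact ENNReal.rpow_add_le_add_rpow _ _ (by norm_num) (by norm_num)

theorem poisson_add {Z : Type*} [MetricSpace Z] [MeasurableSpace Z] (A : HyperbolicFilling Z)
    (μ : Measure Z) {f g : Z → ℂ} (hf : LocIntegrable μ f) (hg : LocIntegrable μ g) :
    A.poisson μ (f + g) = A.poisson μ f + A.poisson μ g := by
  funext x
  have hf' : Integrable f (μ.restrict (A.vball x)) := hf _ Metric.isBounded_ball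
  have hg' : Integrable g (μ.restrict (A.vball x)) := hg _ Metric.isBounded_ball
  simp only [poisson, setAverage_eq, Pi.add_apply]
  rw [integral_add hf' hg', smul_add]

theorem poisson_smul {Z : Type*} [MetricSpace Z] [MeasurableSpace Z] (A : HyperbolicFilling Z)
    (μ : Measure Z) (c : ℂ) (f : Z → ℂ) :
    A.poisson μ (c • f) = c • A.poisson μ f := by
  funext x
  simp only [poisson, setAverage_eq, Pi.smul_apply]
  rw [integral_smul, smul_comm]

theorem poisson_congr {Z : Type*} [MetricSpace Z] [MeasurableSpace Z] (A : HyperbolicFilling Z)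
    (μ : Measure Z) {f g : Z → ℂ} (h : f =ᵐ[μ] g) : A.poisson μ f = A.poisson μ g := by
  funext x
  exact average_congr (ae_restrict_of_ae h)

/-! ### The sequence spaces -/

/-- The space `I̊^s_{p,q}(X)` of sequences `u ∈ I^s_{p,q}(X)` with `u(x₀) = 0`. -/
def I₀ {Z : Type*} [MetricSpace Z] [MeasurableSpace Z] [BorelSpace Z]
    (A : HyperbolicFilling Z) (μ : Measure Z) (s : ℝ) (p q : ℝ≥0∞) (x₀ : A.Vertex) :
    Submodule ℂ (A.Vertex → ℂ) where
  carrier := {u | A.seqNorm μ s p q (fun x => ‖u x‖ₑ) < ∞ ∧ u x₀ = 0}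
  zero_mem' := by simp [seqNorm_zero]
  add_mem' := by
    rintro u v ⟨hu, hu0⟩ ⟨hv, hv0⟩
    refine ⟨A.seqNorm_add_lt_top μ s p q 1 (fun x => ?_) hu hv, by simp [hu0, hv0]⟩
    simpa using enorm_add_le (u x) (v x)
  smul_mem' := by
    rintro c u ⟨hu, hu0⟩
    refine ⟨(A.seqNorm_le_mul μ s p q ‖c‖₊ (fun x => ?_)).trans_lt
      (ENNReal.mul_lt_top ENNReal.coe_lt_top hu), by simp [hu0]⟩
    rw [Pi.smul_apply, enorm_smul, enorm_eq_nnnorm c]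

/-- The space `D̊` of sequences `u` with `|du| ∈ I^s_{p,q}(X)` and `u(x₀) = 0`. -/
def D₀ {Z : Type*} [MetricSpace Z] [MeasurableSpace Z] [BorelSpace Z]
    (A : HyperbolicFilling Z) (μ : Measure Z) (s : ℝ) (p q : ℝ≥0∞) (x₀ : A.Vertex) :
    Submodule ℂ (A.Vertex → ℂ) where
  carrier := {u | A.seqNorm μ s p q (A.gradNorm u) < ∞ ∧ u x₀ = 0}
  zero_mem' := by
    refine ⟨?_, rfl⟩
    have h : A.gradNorm (0 : A.Vertex → ℂ) = fun _ => 0 := A.gradNorm_const 0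
    rw [h, seqNorm_zero]
    exact ENNReal.zero_lt_top
  add_mem' := by
    rintro u v ⟨hu, hu0⟩ ⟨hv, hv0⟩
    exact ⟨A.seqNorm_add_lt_top μ s p q 2 (A.gradNorm_add_le u v) hu hv, by simp [hu0, hv0]⟩
  smul_mem' := by
    rintro c u ⟨hu, hu0⟩
    refine ⟨(A.seqNorm_le_mul μ s p q ‖c‖₊ (fun x => ?_)).trans_lt
      (ENNReal.mul_lt_top ENNReal.coe_lt_top hu), by simp [hu0]⟩
    rw [gradNorm_smul, enorm_eq_nnnorm c]

/-- The space of `u ∈ D̊` that differ from a sequence in `I^s_{p,q}(X)` by a constant; it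
consists of the sequences `v - v(x₀)` with `v ∈ I^s_{p,q}(X)`. -/
def K₀ {Z : Type*} [MetricSpace Z] [MeasurableSpace Z] [BorelSpace Z]
    (A : HyperbolicFilling Z) (μ : Measure Z) (s : ℝ) (p q : ℝ≥0∞) (x₀ : A.Vertex) :
    Submodule ℂ (A.Vertex → ℂ) where
  carrier := {u | (∃ c : ℂ, A.seqNorm μ s p q (fun x => ‖u x - c‖ₑ) < ∞) ∧ u x₀ = 0}
  zero_mem' := by
    refine ⟨⟨0, ?_⟩, rfl⟩
    simp [seqNorm_zero]
  add_mem' := by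
    rintro u v ⟨⟨a, hu⟩, hu0⟩ ⟨⟨b, hv⟩, hv0⟩
    refine ⟨⟨a + b, A.seqNorm_add_lt_top μ s p q 1 (fun x => ?_) hu hv⟩, by simp [hu0, hv0]⟩
    rw [Pi.add_apply, add_sub_add_comm]
    simpa using enorm_add_le (u x - a) (v x - b)
  smul_mem' := by
    rintro c u ⟨⟨a, hu⟩, hu0⟩
    refine ⟨⟨c * a, (A.seqNorm_le_mul μ s p q ‖c‖₊ (fun x => ?_)).trans_lt
      (ENNReal.mul_lt_top ENNReal.coe_lt_top hu)⟩, by simp [hu0]⟩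
    rw [Pi.smul_apply, smul_eq_mul, ← mul_sub, enorm_mul, enorm_eq_nnnorm c]

/-- The quasi-norm `‖du‖_{I^s_{p,q}(X)}` of `D̊`. -/
noncomputable def normD {Z : Type*} [MetricSpace Z] [MeasurableSpace Z] [BorelSpace Z]
    (A : HyperbolicFilling Z) (μ : Measure Z) (s : ℝ) (p q : ℝ≥0∞) (x₀ : A.Vertex)
    (u : A.D₀ μ s p q x₀) : ℝ :=
  (A.seqNorm μ s p q (A.gradNorm u.1)).toReal

/-! ### The Besov space -/

/-- The vector space `B^s_{p,q}(Z)` of functions `f ∈ L¹_loc(Z)` with `|d(Pf)| ∈ I^s_{p,q}(X)`.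
Nothing is divided out yet. -/
def besov {Z : Type*} [MetricSpace Z] [MeasurableSpace Z] [BorelSpace Z]
    (A : HyperbolicFilling Z) (μ : Measure Z) (s : ℝ) (p q : ℝ≥0∞) :
    Submodule ℂ (Z → ℂ) where
  carrier := {f | LocIntegrable μ f ∧ A.seqNorm μ s p q (A.gradNorm (A.poisson μ f)) < ∞}
  zero_mem' := by
    refine ⟨fun S _ => integrable_zero Z ℂ _, ?_⟩
    have hP : A.poisson μ (0 : Z → ℂ) = fun _ => 0 := by
      funext x
      simp [poisson]
    rw [hP, gradNorm_const, seqNorm_zero]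
    exact ENNReal.zero_lt_top
  add_mem' := by
    rintro f g ⟨hf, hfN⟩ ⟨hg, hgN⟩
    refine ⟨fun S hS => (hf S hS).add (hg S hS), ?_⟩
    rw [A.poisson_add μ hf hg]
    exact A.seqNorm_add_lt_top μ s p q 2 (A.gradNorm_add_le _ _) hfN hgN
  smul_mem' := by
    rintro c f ⟨hf, hfN⟩
    refine ⟨fun S hS => Integrable.smul c (hf S hS), ?_⟩
    rw [A.poisson_smul]
    refine (A.seqNorm_le_mul μ s p q ‖c‖₊ (fun x => ?_)).trans_lt
      (ENNReal.mul_lt_top ENNReal.coe_lt_top hfN)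
    rw [gradNorm_smul, enorm_eq_nnnorm c]

/-- `‖f‖_{B^s_{p,q}(Z)} = ‖d(Pf)‖_{I^s_{p,q}(X)}`. -/
noncomputable def besovNorm {Z : Type*} [MetricSpace Z] [MeasurableSpace Z] [BorelSpace Z]
    (A : HyperbolicFilling Z) (μ : Measure Z) (s : ℝ) (p q : ℝ≥0∞) (f : A.besov μ s p q) : ℝ :=
  (A.seqNorm μ s p q (A.gradNorm (A.poisson μ f.1))).toReal

/-- The functions in `B^s_{p,q}(Z)` that vanish almost everywhere. -/
def besovZero {Z : Type*} [MetricSpace Z] [MeasurableSpace Z] [BorelSpace Z]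
    (A : HyperbolicFilling Z) (μ : Measure Z) (s : ℝ) (p q : ℝ≥0∞) :
    Submodule ℂ (A.besov μ s p q) where
  carrier := {f | f.1 =ᵐ[μ] 0}
  zero_mem' := show (0 : Z → ℂ) =ᵐ[μ] 0 from EventuallyEq.rfl
  add_mem' := by
    intro f g (hf : f.1 =ᵐ[μ] 0) (hg : g.1 =ᵐ[μ] 0)
    change (f.1 + g.1 : Z → ℂ) =ᵐ[μ] 0
    filter_upwards [hf, hg] with ζ h1 h2
    simp [h1, h2]
  smul_mem' := by
    intro c f (hf : f.1 =ᵐ[μ] 0)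
    change (c • f.1 : Z → ℂ) =ᵐ[μ] 0
    filter_upwards [hf] with ζ h1
    simp [h1]

/-- The functions in `B^s_{p,q}(Z)` that are constant almost everywhere. -/
def besovConst {Z : Type*} [MetricSpace Z] [MeasurableSpace Z] [BorelSpace Z]
    (A : HyperbolicFilling Z) (μ : Measure Z) (s : ℝ) (p q : ℝ≥0∞) :
    Submodule ℂ (A.besov μ s p q) where
  carrier := {f | ∃ c : ℂ, f.1 =ᵐ[μ] fun _ => c}
  zero_mem' := ⟨0, EventuallyEq.rfl⟩
  add_mem' := by
    rintro f g ⟨a, hf⟩ ⟨b, hg⟩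
    refine ⟨a + b, ?_⟩
    filter_upwards [hf, hg] with ζ h1 h2
    simp [h1, h2]
  smul_mem' := by
    rintro c f ⟨a, hf⟩
    refine ⟨c * a, ?_⟩
    filter_upwards [hf] with ζ h1
    simp [h1]

/-- Dividing out the constants does not change the quasi-norm. -/
theorem besovNorm_eq_of_sub_mem {Z : Type*} [MetricSpace Z] [MeasurableSpace Z] [BorelSpace Z]
    (A : HyperbolicFilling Z) (μ : Measure Z)
    (hpos : ∀ (ξ : Z) (r : ℝ), 0 < r → 0 < μ (Metric.ball ξ r))
    (hfin : ∀ (ξ : Z) (r : ℝ), μ (Metric.ball ξ r) < ∞)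
    (s : ℝ) (p q : ℝ≥0∞) (f g : A.besov μ s p q) (h : f - g ∈ A.besovConst μ s p q) :
    A.besovNorm μ s p q f = A.besovNorm μ s p q g := by
  obtain ⟨c, hc⟩ := h
  have hae : f.1 =ᵐ[μ] g.1 + fun _ => c := by
    filter_upwards [hc] with ζ h1
    have h2 : f.1 ζ - g.1 ζ = c := h1
    rw [Pi.add_apply, ← h2]
    ring
  have hloc : LocIntegrable μ (fun _ : Z => c) := by
    intro S hS
    rcases S.eq_empty_or_nonempty with rfl | ⟨ξ, -⟩
    · simp
    · obtain ⟨r, hr⟩ := hS.subset_ball ξ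
      exact integrableOn_const ((measure_mono hr).trans_lt (hfin ξ r)).ne
  have hP : A.poisson μ (fun _ : Z => c) = fun _ => c := by
    funext x
    exact setAverage_const (hpos _ _ (by positivity)).ne' (hfin _ _).ne c
  unfold besovNorm
  rw [A.poisson_congr μ hae, A.poisson_add μ g.2.1 hloc, hP]
  congr 2
  exact A.gradNorm_add_const _ c

end HyperbolicFilling

/-! ### The trace -/

/-- A family `(ψ_x)` of non-negative Lipschitz functions with `ψ_x` supported on `B(x)` and
`Lip ψ_x ≲ 2^|x|`, which is a partition of unity on every level. -/
structure HyperbolicFilling.LipPartition {Z : Type*} [MetricSpace Z]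
    (A : HyperbolicFilling Z) where
  ψ : A.Vertex → Z → ℝ
  nonneg : ∀ x ζ, 0 ≤ ψ x ζ
  support_subset : ∀ x, Function.support (ψ x) ⊆ A.vball x
  hasSum_one : ∀ (n : ℤ) (ζ : Z), HasSum (fun x : A.net n => ψ ⟨n, x⟩ ζ) 1
  lipschitz : ∃ L : ℝ≥0, ∀ x, LipschitzWith (L * (2 : ℝ≥0) ^ x.1) (ψ x)

namespace HyperbolicFilling.LipPartition

/-- `T_n u = ∑_{x ∈ X_n} u(x) ψ_x`. -/
noncomputable def T {Z : Type*} [MetricSpace Z] {A : HyperbolicFilling Z}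
    (Ψ : A.LipPartition) (n : ℤ) (u : A.Vertex → ℂ) (ζ : Z) : ℂ :=
  ∑' x : A.net n, u ⟨n, x⟩ * (Ψ.ψ ⟨n, x⟩ ζ : ℂ)

/-- `f` is the trace of `u`: `T_n u → f` as `n → ∞`, both in `L¹_loc(Z)` and pointwise almost
everywhere. -/
def IsTrace {Z : Type*} [MetricSpace Z] [MeasurableSpace Z] {A : HyperbolicFilling Z}
    (Ψ : A.LipPartition) (μ : Measure Z) (u : A.Vertex → ℂ) (f : Z → ℂ) : Prop :=
  LocIntegrable μ f ∧
  (∀ S : Set Z, Bornology.IsBounded S →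
    Tendsto (fun n : ℤ => ∫⁻ ζ in S, ‖Ψ.T n u ζ - f ζ‖ₑ ∂μ) atTop (𝓝 0)) ∧
  ∀ᵐ ζ ∂μ, Tendsto (fun n : ℤ => Ψ.T n u ζ) atTop (𝓝 (f ζ))

end HyperbolicFilling.LipPartition

/-! ### Quasi-normed spaces -/

/-- `N` is a quasi-norm on the complex vector space `V`. -/
structure IsQuasiNorm {V : Type*} [AddCommGroup V] [Module ℂ V] (N : V → ℝ) : Prop where
  nonneg : ∀ v, 0 ≤ N v
  eq_zero_iff : ∀ v, N v = 0 ↔ v = 0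
  smul : ∀ (c : ℂ) (v : V), N (c • v) = ‖c‖ * N v
  add_le : ∃ K : ℝ, ∀ v w, N (v + w) ≤ K * (N v + N w)

/-- `(V, N)` is a quasi-Banach space: `N` is a quasi-norm and every Cauchy sequence converges. -/
def IsQuasiBanach {V : Type*} [AddCommGroup V] [Module ℂ V] (N : V → ℝ) : Prop :=
  IsQuasiNorm N ∧
  ∀ a : ℕ → V, (∀ ε > 0, ∃ M, ∀ m ≥ M, ∀ n ≥ M, N (a m - a n) < ε) →
    ∃ v, ∀ ε > 0, ∃ M, ∀ n ≥ M, N (a n - v) < ε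

/-- `(V, N)` is a reflexive Banach space: up to renaming elements it is a complete normed space
whose canonical map to the bidual is onto. -/
def IsReflexiveBanach.{v} {V : Type v} [AddCommGroup V] [Module ℂ V] (N : V → ℝ) : Prop :=
  ∃ (E : Type v) (_ : NormedAddCommGroup E) (_ : NormedSpace ℂ E) (e : V ≃ₗ[ℂ] E),
    (∀ v, ‖e v‖ = N v) ∧ CompleteSpace E ∧
      Function.Surjective (NormedSpace.inclusionInDoubleDual ℂ E)

/-- The quotient quasi-norm: the infimum of `N` over the representatives of a class. -/
noncomputable def quotNorm {V : Type*} [AddCommGroup V] [Module ℂ V] (N : V → ℝ)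
    (W : Submodule ℂ V) (a : V ⧸ W) : ℝ :=
  ⨅ v : {v : V // W.mkQ v = a}, N v

/-- Two functionals on linearly isomorphic spaces are equivalent: each is bounded by a constant
times the other, along the isomorphism. -/
def EquivNorms {V W : Type*} [AddCommGroup V] [Module ℂ V] [AddCommGroup W] [Module ℂ W]
    (Φ : V ≃ₗ[ℂ] W) (N : V → ℝ) (N' : W → ℝ) : Prop :=
  ∃ C : ℝ, 0 < C ∧ ∀ v, N' (Φ v) ≤ C * N v ∧ N v ≤ C * N' (Φ v)

/-- On `B^s_{p,q}(Z)` modulo constants the quotient quasi-norm of the class of `f` is just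
`‖d(Pf)‖_{I^s_{p,q}(X)}`. -/
theorem quotNorm_besov_mkQ {Z : Type*} [MetricSpace Z] [MeasurableSpace Z] [BorelSpace Z]
    (A : HyperbolicFilling Z) (μ : Measure Z)
    (hpos : ∀ (ξ : Z) (r : ℝ), 0 < r → 0 < μ (Metric.ball ξ r))
    (hfin : ∀ (ξ : Z) (r : ℝ), μ (Metric.ball ξ r) < ∞)
    (s : ℝ) (p q : ℝ≥0∞) (f : A.besov μ s p q) :
    quotNorm (A.besovNorm μ s p q) (A.besovConst μ s p q) ((A.besovConst μ s p q).mkQ f) =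
      A.besovNorm μ s p q f := by
  unfold quotNorm
  have : Nonempty {v : A.besov μ s p q //
      (A.besovConst μ s p q).mkQ v = (A.besovConst μ s p q).mkQ f} := ⟨⟨f, rfl⟩⟩
  rw [← ciInf_const (ι := {v : A.besov μ s p q //
      (A.besovConst μ s p q).mkQ v = (A.besovConst μ s p q).mkQ f})
    (a := A.besovNorm μ s p q f)]
  refine iInf_congr fun v => ?_
  exact A.besovNorm_eq_of_sub_mem μ hpos hfin s p q v.1 f
    ((Submodule.Quotient.eq _).1 v.2)

/-! ### Infinite sums in `L^p` quasi-norms -/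

/-! Trace and Poisson extension invert each other up to `I^s_{p,q}(X)`, and one averaging operator
is behind every estimate. `tailSum w k` adds the functions `levelSum w j` over all `j ≥ k - 1`, and
`tailMean w x` averages `tailSum w |x|` near `B(x)`. Its boundedness on `I^s_{p,q}(X)` is
`exists_seqNorm_tailMean_le`. Averaging at scale `2^(-k)` a function built from balls of size
`2^(-j)` costs only a constant in `L^p` if `p ≥ 1` (Hölder), and a factor `2^((j-k)Q(1/p-1))` if `p
≤ 1` (subadditivity of `t ↦ t^p` and doubling). The condition `p > Q/(Q+s)` says for `p ≤ 1` that
the weights `2^(ks)` beat this loss, and a discrete Hardy inequality sums the geometric factors that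
remain.

Pointwise bounds reduce the rest to this operator. `|du|` is at most a multiple of `tailMean |u|`,
so sequences in `I^s_{p,q}(X)` have gradients there. Consecutive `T_n u` differ by at most `2
levelSum |du| n`, so `T_n u` converges wherever the tail sums of `|du|` are finite, hence almost
everywhere, and `|u(x) - Tr u| ≤ 3 tailSum |du|` on `B(x)`. Averaging over `B(x)` shows that `u -
P(Tr u)` is at most `3 tailMean |du|`, so it lies in `I^s_{p,q}(X)`; in particular `Tr u = 0` forces
`u` into that space. Conversely, for `u` in that space, `T_n u` is dominated by tails of an almost
everywhere convergent series and tends to 0. Lebesgue differentiation gives `Tr(Pf) = f`. Hence `P`,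
normalised at `x₀` by resetting one value (`poissonVanish`) or by subtracting a constant
(`poissonSub`), induces the inverse of the trace on the quotients, with bounds in both directions.

For completeness, the graph is connected, so the quasi-norm of `D̊` controls every value of a
sequence that vanishes at `x₀`: Cauchy sequences converge pointwise, and Fatou makes this
convergence in quasi-norm. Completeness then passes to the Besov space through `P`. For `1 < p, q <
∞` the quasi-norm is a norm, equivalent to the one induced by `f ↦ (Pf(y) - Pf(x))` from an `ℓ^q`
sum of `ℓ^p` sums of `ℓ²` spaces. Such sums are reflexive (`lp.surjective_inclusionInDoubleDual`),
and so is every Banach space embedded in a reflexive one. -/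

theorem ENNReal.rpow_sum_le_sum_rpow {ι : Type*} (S : Finset ι) (a : ι → ℝ≥0∞) {r : ℝ}
    (hr : 0 < r) (hr1 : r ≤ 1) : (∑ i ∈ S, a i) ^ r ≤ ∑ i ∈ S, a i ^ r := by
  classical
  induction S using Finset.induction_on with
  | empty => simp [hr]
  | insert i S hi ih =>
    rw [Finset.sum_insert hi, Finset.sum_insert hi]
    exact (ENNReal.rpow_add_le_add_rpow _ _ hr.le hr1).trans (by gcongr)

theorem ENNReal.rpow_tsum_le_tsum_rpow {ι : Type*} (a : ι → ℝ≥0∞) {r : ℝ}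
    (hr : 0 < r) (hr1 : r ≤ 1) : (∑' i, a i) ^ r ≤ ∑' i, a i ^ r := by
  rw [← ENNReal.le_rpow_inv_iff hr, ENNReal.tsum_eq_iSup_sum]
  refine iSup_le fun S => ?_
  rw [ENNReal.le_rpow_inv_iff hr]
  exact (ENNReal.rpow_sum_le_sum_rpow S a hr hr1).trans (ENNReal.sum_le_tsum S)

theorem ENNReal.liminf_rpow (a : ℕ → ℝ≥0∞) {r : ℝ} (hr : 0 < r) :
    (liminf a atTop) ^ r = liminf (fun n => a n ^ r) atTop := by
  refine ((ENNReal.strictMono_rpow_of_pos hr).orderIsoOfSurjective _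
    (ENNReal.rpow_left_bijective hr.ne').2).liminf_apply ?_ ?_ ?_ ?_
  all_goals isBoundedDefault

theorem ENNReal.tsum_liminf_le {ι : Type*} [Countable ι] (a : ℕ → ι → ℝ≥0∞) :
    ∑' i, liminf (fun n => a n i) atTop ≤ liminf (fun n => ∑' i, a n i) atTop := by
  let _ : MeasurableSpace ι := ⊤
  simp only [← lintegral_count]
  exact lintegral_liminf_le fun n => measurable_from_top

/-- Fatou's lemma for `L^p` quasi-norms. -/
theorem eLpNorm_liminf_le {α : Type*} {m : MeasurableSpace α} {μ : Measure α} (p : ℝ≥0∞)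
    {f : ℕ → α → ℝ≥0∞} (hf : ∀ n, Measurable (f n)) :
    eLpNorm (fun x => liminf (fun n => f n x) atTop) p μ ≤
      liminf (fun n => eLpNorm (f n) p μ) atTop := by
  rcases eq_or_ne p 0 with rfl | hp0
  · simp
  rcases eq_or_ne p ∞ with rfl | hp
  · simp only [eLpNorm_exponent_top, eLpNormEssSup, enorm_eq_self]
    exact ENNReal.essSup_liminf_le _
  have hp' := ENNReal.toReal_pos hp0 hp
  simp only [eLpNorm_eq_lintegral_rpow_enorm_toReal hp0 hp, enorm_eq_self]
  rw [← ENNReal.liminf_rpow _ (by positivity)]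
  gcongr
  simp only [ENNReal.liminf_rpow _ hp']
  exact lintegral_liminf_le fun n => (hf n).pow_const _

/-- Minkowski's inequality for partial sums, passed to the limit by Fatou. -/
theorem eLpNorm_tsum_le {α : Type*} {m : MeasurableSpace α} {μ : Measure α} {p : ℝ≥0∞}
    (hp : 1 ≤ p) {f : ℕ → α → ℝ≥0∞} (hf : ∀ n, Measurable (f n)) :
    eLpNorm (fun x => ∑' n, f n x) p μ ≤ ∑' n, eLpNorm (f n) p μ := by
  have h : (fun x => ∑' n, f n x) =
      fun x => liminf (fun N => (∑ n ∈ Finset.range N, f n) x) atTop := by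
    funext x
    simp only [Finset.sum_apply]
    exact (ENNReal.tendsto_nat_tsum fun n => f n x).liminf_eq.symm
  rw [h]
  have hmeas : ∀ N, Measurable (∑ n ∈ Finset.range N, f n) := by
    intro N
    rw [Finset.sum_fn]
    exact Finset.measurable_sum _ fun n _ => hf n
  refine (eLpNorm_liminf_le p hmeas).trans ?_
  refine (liminf_le_liminf (v := fun _ : ℕ => ∑' n, eLpNorm (f n) p μ)
    (.of_forall fun N => ?_)).trans (by simp)
  refine le_trans ?_ (ENNReal.sum_le_tsum (Finset.range N))
  induction N with
  | zero => simp
  | succ N ih =>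
    rw [Finset.sum_range_succ, Finset.sum_range_succ]
    exact (eLpNorm_add_le (hmeas N).aestronglyMeasurable
      (hf N).aestronglyMeasurable hp).trans (by gcongr)

/-- The `r`-triangle inequality in `L^p` for `r ≤ min 1 p`. -/
theorem eLpNorm_tsum_rpow_le {α : Type*} {m : MeasurableSpace α} {μ : Measure α} {p : ℝ≥0∞}
    {r : ℝ} (hr : 0 < r) (hr1 : r ≤ 1) (hrp : ENNReal.ofReal r ≤ p)
    {f : ℕ → α → ℝ≥0∞} (hf : ∀ n, Measurable (f n)) :
    eLpNorm (fun x => ∑' n, f n x) p μ ^ r ≤ ∑' n, eLpNorm (f n) p μ ^ r := by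
  rcases le_total 1 p with h1 | h1
  · refine le_trans ?_ (ENNReal.rpow_tsum_le_tsum_rpow _ hr hr1)
    gcongr
    exact eLpNorm_tsum_le h1 hf
  have hp : p ≠ ∞ := (h1.trans_lt ENNReal.one_lt_top).ne
  have hp0 : p ≠ 0 := ((ENNReal.ofReal_pos.2 hr).trans_le hrp).ne'
  have hp' := ENNReal.toReal_pos hp0 hp
  have hp1 : p.toReal ≤ 1 := by simpa using ENNReal.toReal_mono ENNReal.one_ne_top h1
  have hrp' : r ≤ p.toReal := (ENNReal.ofReal_le_iff_le_toReal hp).1 hrp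
  simp only [eLpNorm_eq_lintegral_rpow_enorm_toReal hp0 hp, enorm_eq_self, ← ENNReal.rpow_mul]
  -- Below `p = 1` subadditivity is used twice: for `t ↦ t^p` under the integral, and for `t ↦
  -- t^(r/p)` outside it, where `r ≤ p` enters.
  have hle : 1 / p.toReal * r ≤ 1 := by
    rw [one_div, inv_mul_le_iff₀ hp']
    simpa using hrp'
  refine le_trans ?_ (ENNReal.rpow_tsum_le_tsum_rpow _ (by positivity) hle)
  gcongr
  rw [← lintegral_tsum fun n => ((hf n).pow_const _).aemeasurable]
  gcongr with x
  exact ENNReal.rpow_tsum_le_tsum_rpow _ hp' hp1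

theorem eLpNorm_const_mul_ennreal {α : Type*} {m : MeasurableSpace α} {μ : Measure α}
    (p : ℝ≥0∞) {c : ℝ≥0∞} (hc : c ≠ ∞) (f : α → ℝ≥0∞) :
    eLpNorm (fun x => c * f x) p μ ≤ c * eLpNorm f p μ := by
  lift c to ℝ≥0 using hc
  exact eLpNorm_le_mul_eLpNorm_of_ae_le_mul' (ae_of_all _ fun x => by simp) p

theorem eLpNorm_count_shift (q : ℝ≥0∞) (a : ℤ → ℝ≥0∞) (m : ℤ) :
    eLpNorm (fun k => a (k + m)) q Measure.count = eLpNorm a q Measure.count := by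
  exact eLpNorm_comp_measurePreserving (measurable_of_countable a).aestronglyMeasurable
    (measurePreserving_add_right Measure.count m)

/-- The `r`-th power of an `L^q` quasi-norm is the `L^(q/r)` norm of the `r`-th power, and `q/r ≥ 1`
makes Minkowski's inequality available. -/
theorem eLpNorm_le_of_rpow_le {α : Type*} {m : MeasurableSpace α} {μ : Measure α} {q : ℝ≥0∞}
    {r : ℝ} (hr : 0 < r) (hrq : ENNReal.ofReal r ≤ q) {b : α → ℝ≥0∞}
    {f : ℕ → α → ℝ≥0∞} (hf : ∀ n, Measurable (f n))
    (h : ∀ x, b x ^ r ≤ ∑' n, f n x ^ r) :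
    eLpNorm b q μ ^ r ≤ ∑' n, eLpNorm (f n) q μ ^ r := by
  have hq0 : q ≠ 0 := ((ENNReal.ofReal_pos.2 hr).trans_le hrq).ne'
  have key : ∀ g : α → ℝ≥0∞, eLpNorm g q μ ^ r =
      eLpNorm (fun x => g x ^ r) (q / ENNReal.ofReal r) μ := by
    intro g
    have := eLpNorm_enorm_rpow (μ := μ) (p := q / ENNReal.ofReal r) g hr
    simp only [enorm_eq_self] at this
    rw [this, ENNReal.div_mul_cancel (ENNReal.ofReal_pos.2 hr).ne' ENNReal.ofReal_ne_top]
  simp only [key]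
  refine le_trans ?_ (eLpNorm_tsum_le ?_ fun n => (hf n).pow_const r)
  · exact eLpNorm_mono_enorm fun x => by simpa using h x
  · rwa [ENNReal.le_div_iff_mul_le (.inl (ENNReal.ofReal_pos.2 hr).ne')
      (.inl ENNReal.ofReal_ne_top), one_mul]

/-- A discrete Hardy inequality. -/
theorem eLpNorm_count_hardy {q : ℝ≥0∞} {r : ℝ} (hr : 0 < r)
    (hrq : ENNReal.ofReal r ≤ q) {δ : ℝ} (hδ : 0 < δ) (c : ℝ≥0) :
    ∃ K : ℝ≥0, ∀ a b : ℤ → ℝ≥0∞,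
      (∀ k, b k ^ r ≤ ∑' m : ℕ, (c * 2 ^ (-(m : ℝ) * δ) * a (k - 1 + m)) ^ r) →
      eLpNorm b q Measure.count ≤ K * eLpNorm a q Measure.count := by
  -- A geometric series of ratio `2^(-δr) < 1`. The shifts of `a` preserve the counting measure, so
  -- each term costs its coefficient only.
  set S : ℝ≥0∞ := ∑' m : ℕ, (c * 2 ^ (-(m : ℝ) * δ)) ^ r with hS
  have hSfin : S ≠ ∞ := by
    have : ∀ m : ℕ, ((c : ℝ≥0∞) * 2 ^ (-(m : ℝ) * δ)) ^ r = c ^ r *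
        ((2 : ℝ≥0∞) ^ (-(δ * r))) ^ m := by
      intro m
      rw [ENNReal.mul_rpow_of_nonneg _ _ hr.le, ← ENNReal.rpow_mul, ← ENNReal.rpow_natCast,
        ← ENNReal.rpow_mul]
      ring_nf
    rw [hS, tsum_congr this, ENNReal.tsum_mul_left, ENNReal.tsum_geometric]
    refine ENNReal.mul_ne_top (ENNReal.rpow_ne_top_of_nonneg hr.le ENNReal.coe_ne_top) ?_
    rw [Ne, ENNReal.inv_eq_top, tsub_eq_zero_iff_le, not_le]
    exact ENNReal.rpow_lt_one_of_one_lt_of_neg (by norm_num) (by nlinarith)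
  refine ⟨(S ^ r⁻¹).toNNReal, fun a b h => ?_⟩
  rw [ENNReal.coe_toNNReal (ENNReal.rpow_ne_top_of_nonneg (by positivity) hSfin)]
  have h1 := eLpNorm_le_of_rpow_le (μ := Measure.count) hr hrq (b := b)
    (f := fun m k => c * 2 ^ (-(m : ℝ) * δ) * a (k - 1 + m))
    (fun m => measurable_of_countable _) h
  rw [← ENNReal.rpow_le_rpow_iff hr, ENNReal.mul_rpow_of_nonneg _ _ hr.le, ← ENNReal.rpow_mul,
    inv_mul_cancel₀ hr.ne', ENNReal.rpow_one, hS, ← ENNReal.tsum_mul_right]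
  refine h1.trans (ENNReal.tsum_le_tsum fun m => ?_)
  rw [← ENNReal.mul_rpow_of_nonneg _ _ hr.le]
  gcongr
  refine (eLpNorm_const_mul_ennreal q ?_ _).trans ?_
  · exact ENNReal.mul_ne_top ENNReal.coe_ne_top (ENNReal.rpow_ne_top_of_ne_zero (by simp) (by simp))
  · gcongr
    have := eLpNorm_count_shift q a ((m : ℤ) - 1)
    rw [← this]
    refine le_of_eq (congrArg (fun g => eLpNorm g q Measure.count) ?_)
    funext k
    congr 1
    ring

/-! ### Geometry of hyperbolic fillings of doubling spaces -/

/-- Balls have positive finite measure, and `μ(B(ξ, t r)) ≤ C t^Q μ(B(ξ, r))` for `t ≥ 1`. -/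
structure PolyDoubling {Z : Type*} [MetricSpace Z] [MeasurableSpace Z] (μ : Measure Z)
    (C Q : ℝ) : Prop where
  Q_pos : 0 < Q
  pos : ∀ (ξ : Z) (r : ℝ), 0 < r → 0 < μ (Metric.ball ξ r)
  lt_top : ∀ (ξ : Z) (r : ℝ), μ (Metric.ball ξ r) < ∞
  ball_le : ∀ (ξ : Z) (r t : ℝ), 0 < r → 1 ≤ t →
    μ (Metric.ball ξ (t * r)) ≤ ENNReal.ofReal (C * t ^ Q) * μ (Metric.ball ξ r)

namespace HyperbolicFilling

variable {Z : Type*} [MetricSpace Z] (A : HyperbolicFilling Z)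

theorem le_dist_of_ne {k : ℤ} {x y : A.net k} (h : x ≠ y) :
    (2 : ℝ) ^ (-k - 1) ≤ dist (x : Z) y :=
  (A.maximal k).prop x.2 y.2 fun h' => h (Subtype.ext h')

/-- Otherwise `ζ` could be added to the net. The bound is half the radius of the balls `B(x)`; the
spare half is used in `exists_common_vball` and `exists_subset_vball`. -/
theorem exists_dist_lt (k : ℤ) (ζ : Z) : ∃ x : A.net k, dist ζ x < (2 : ℝ) ^ (-k - 1) := by
  by_contra! h
  have hins : (insert ζ (A.net k)).Pairwise fun ξ η => (2 : ℝ) ^ (-k - 1) ≤ dist ξ η := by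
    refine (A.maximal k).prop.insert fun η hη _ => ⟨h ⟨η, hη⟩, ?_⟩
    rw [dist_comm]
    exact h ⟨η, hη⟩
  have hmem := (A.maximal k).le_of_ge hins (Set.subset_insert _ _) (Set.mem_insert ζ _)
  have := h ⟨ζ, hmem⟩
  rw [dist_self] at this
  exact absurd this (not_le.2 (by positivity))

theorem exists_mem_vball (k : ℤ) (ζ : Z) : ∃ x : A.net k, ζ ∈ A.vball ⟨k, x⟩ := by
  obtain ⟨x, hx⟩ := A.exists_dist_lt k ζ
  refine ⟨x, hx.trans_le ?_⟩
  exact zpow_le_zpow_right₀ (by norm_num) (sub_le_self _ zero_le_one)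

theorem isOpen_vball (x : A.Vertex) : IsOpen (A.vball x) := Metric.isOpen_ball

theorem mem_vball_self (x : A.Vertex) : (x.2 : Z) ∈ A.vball x :=
  Metric.mem_ball_self (by positivity)

end HyperbolicFilling

namespace PolyDoubling

variable {Z : Type*} [MetricSpace Z] [MeasurableSpace Z] {μ : Measure Z} {C Q : ℝ}

theorem vball_ne_zero (h : PolyDoubling μ C Q) (A : HyperbolicFilling Z) (x : A.Vertex) :
    μ (A.vball x) ≠ 0 :=
  (h.pos _ _ (by positivity)).ne'

theorem vball_ne_top (h : PolyDoubling μ C Q) (A : HyperbolicFilling Z) (x : A.Vertex) :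
    μ (A.vball x) ≠ ∞ :=
  (h.lt_top _ _).ne

/-- Comparison of the measures of balls of nearby points at different scales. -/
theorem exists_ball_le (h : PolyDoubling μ C Q) : ∃ K : ℝ≥0, ∀ (ξ η : Z) (k j : ℤ), k - 1 ≤ j →
    dist ξ η ≤ 16 * 2 ^ (-k) → μ (Metric.ball ξ (16 * 2 ^ (-k))) ≤
      K * 2 ^ (((j : ℝ) - k) * Q) * μ (Metric.ball η (2 ^ (-j))) := by
  -- The ball around `ξ` lies in the ball of radius `32 * 2^(-k)` around `η`, whose radius is `32 *
  -- 2^(j-k)` times `2^(-j)`; `k - 1 ≤ j` keeps this dilation factor above 1.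
  refine ⟨(C * 32 ^ Q).toNNReal, fun ξ η k j hkj hd => ?_⟩
  have hz : (32 : ℝ) * 2 ^ (-k) = 32 * 2 ^ (j - k) * 2 ^ (-j) := by
    rw [mul_assoc, ← zpow_add₀ (by norm_num)]
    congr 2
    ring
  have h1 : (1 : ℝ) ≤ 32 * 2 ^ (j - k) := by
    have : (2 : ℝ) ^ (-1 : ℤ) ≤ 2 ^ (j - k) := zpow_le_zpow_right₀ (by norm_num) (by omega)
    norm_num at this ⊢
    linarith
  have h2 := h.ball_le η (2 ^ (-j)) (32 * 2 ^ (j - k)) (by positivity) h1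
  rw [← hz, Real.mul_rpow (by norm_num) (by positivity), ← mul_assoc,
    ENNReal.ofReal_mul' (by positivity)] at h2
  refine (measure_mono fun θ hθ => ?_).trans (h2.trans (le_of_eq ?_))
  · have h3 : dist θ ξ < 16 * 2 ^ (-k) := hθ
    have h4 := dist_triangle θ ξ η
    rw [Metric.mem_ball]
    linarith
  · congr 1
    have : ENNReal.ofReal (((2 : ℝ) ^ (j - k)) ^ Q) = 2 ^ (((j : ℝ) - k) * Q) := by
      rw [← Real.rpow_intCast, ← Real.rpow_mul (by norm_num),
        ← ENNReal.ofReal_rpow_of_pos (by norm_num)]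
      simp
    rw [this]
    rfl

variable [BorelSpace Z]

/-- Packing: the balls of radius `2^(-k)/4` around net points are disjoint, those near `ζ` lie in
one ball `B` of radius comparable to `2^(-k)`, and by doubling each carries a fixed proportion of `μ
B`. -/
theorem exists_card_le (h : PolyDoubling μ C Q) (A : HyperbolicFilling Z) (R : ℝ) :
    ∃ N : ℕ, ∀ (k : ℤ) (ζ : Z) (S : Finset (A.net k)),
    (∀ x ∈ S, dist ζ x < R * 2 ^ (-k)) → S.card ≤ N := by
  set K : ℝ≥0∞ := ENNReal.ofReal (C * (4 * (2 * |R| + 1)) ^ Q) with hK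
  obtain ⟨N, hN⟩ := ENNReal.exists_nat_gt (r := K) ENNReal.ofReal_ne_top
  refine ⟨N, fun k ζ S hS => ?_⟩
  have h2 : (0 : ℝ) < 2 ^ (-k) := by positivity
  have hR : R ≤ |R| := le_abs_self R
  have hR0 : 0 ≤ |R| := abs_nonneg R
  set B := Metric.ball ζ ((|R| + 1) * 2 ^ (-k)) with hB
  have hBpos : 0 < μ B := h.pos _ _ (by positivity)
  have hBfin : μ B ≠ ∞ := (h.lt_top _ _).ne
  have hle : ∀ x ∈ S, μ B ≤ K * μ (Metric.ball (x : Z) (1 / 4 * 2 ^ (-k))) := by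
    intro x hx
    refine le_trans (measure_mono ?_) (h.ball_le _ _ (4 * (2 * |R| + 1)) (by positivity)
      (by linarith))
    intro η hη
    have h1 := hS x hx
    have h3 : dist η ζ < (|R| + 1) * 2 ^ (-k) := hη
    have h4 := dist_triangle η ζ (x : Z)
    rw [Metric.mem_ball]
    nlinarith
  have hdisj : (S : Set (A.net k)).PairwiseDisjoint
      fun x => Metric.ball (x : Z) (1 / 4 * 2 ^ (-k)) := by
    intro x _ y _ hxy
    refine Metric.ball_disjoint_ball ?_
    have := A.le_dist_of_ne hxy
    rw [zpow_sub_one₀ (by norm_num)] at this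
    linarith
  have hsub : (⋃ x ∈ S, Metric.ball (x : Z) (1 / 4 * 2 ^ (-k))) ⊆ B := by
    refine Set.iUnion₂_subset fun x hx η hη => ?_
    have h1 := hS x hx
    have h3 : dist η x < 1 / 4 * 2 ^ (-k) := hη
    have h4 := dist_triangle η (x : Z) ζ
    rw [dist_comm (x : Z) ζ] at h4
    rw [hB, Metric.mem_ball]
    nlinarith
  have hsum : (S.card : ℝ≥0∞) * μ B ≤ K * μ B := by
    calc (S.card : ℝ≥0∞) * μ B = ∑ x ∈ S, μ B := by simp
      _ ≤ ∑ x ∈ S, K * μ (Metric.ball (x : Z) (1 / 4 * 2 ^ (-k))) := Finset.sum_le_sum hle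
      _ = K * μ (⋃ x ∈ S, Metric.ball (x : Z) (1 / 4 * 2 ^ (-k))) := by
        rw [← Finset.mul_sum, measure_biUnion_finset hdisj fun x _ => measurableSet_ball]
      _ ≤ K * μ B := by gcongr
  have := (ENNReal.mul_le_mul_iff_left hBpos.ne' hBfin).1 hsum
  exact_mod_cast this.trans hN.le

theorem exists_tsum_le (h : PolyDoubling μ C Q) (A : HyperbolicFilling Z) (R : ℝ) :
    ∃ N : ℕ, ∀ (k : ℤ) (ζ : Z) (a : A.net k → ℝ≥0∞) (M : ℝ≥0∞),
    (∀ x, a x ≠ 0 → dist ζ x < R * 2 ^ (-k)) → (∀ x, a x ≤ M) → ∑' x, a x ≤ N * M := by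
  classical
  obtain ⟨N, hN⟩ := h.exists_card_le A R
  refine ⟨N, fun k ζ a M ha hM => ?_⟩
  rw [ENNReal.tsum_eq_iSup_sum]
  refine iSup_le fun S => ?_
  rw [← Finset.sum_filter_ne_zero]
  calc ∑ x ∈ S with a x ≠ 0, a x ≤ ∑ x ∈ S with a x ≠ 0, M := Finset.sum_le_sum fun x _ => hM x
    _ = ((S.filter fun x => a x ≠ 0).card : ℝ≥0∞) * M := by simp
    _ ≤ N * M := by
      gcongr
      exact hN k ζ _ fun x hx => ha x (Finset.mem_filter.1 hx).2

theorem finite_near (h : PolyDoubling μ C Q) (A : HyperbolicFilling Z) (k : ℤ) (ζ : Z) (R : ℝ) :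
    {x : A.net k | dist ζ x < R * 2 ^ (-k)}.Finite := by
  by_contra hinf
  obtain ⟨N, hN⟩ := h.exists_card_le A R
  obtain ⟨S, hS, hcard⟩ := Set.Infinite.exists_subset_card_eq hinf (N + 1)
  have := hN k ζ S fun x hx => hS hx
  omega

theorem countable_net (h : PolyDoubling μ C Q) (A : HyperbolicFilling Z) (k : ℤ) :
    Countable (A.net k) := by
  rcases isEmpty_or_nonempty Z with hZ | ⟨⟨ζ⟩⟩
  · infer_instance
  have : (Set.univ : Set (A.net k)) = ⋃ n : ℕ, {x : A.net k | dist ζ x < n * 2 ^ (-k)} := by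
    refine (Set.eq_univ_of_forall fun x => Set.mem_iUnion.2 ?_).symm
    obtain ⟨n, hn⟩ := exists_nat_gt (dist ζ (x : Z) / 2 ^ (-k))
    exact ⟨n, by rwa [div_lt_iff₀ (by positivity)] at hn⟩
  rw [← Set.countable_univ_iff, this]
  exact Set.countable_iUnion fun n => (h.finite_near A k ζ n).countable

/-- Needed for Lebesgue differentiation, which is stated for second countable spaces. -/
theorem separableSpace (h : PolyDoubling μ C Q) (A : HyperbolicFilling Z) :
    TopologicalSpace.SeparableSpace Z := by
  refine ⟨⋃ k, A.net k, Set.countable_iUnion fun k => ?_, ?_⟩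
  · have := h.countable_net A k
    exact Set.to_countable _
  · refine Metric.dense_iff.2 fun ζ r hr => ?_
    obtain ⟨n, hn⟩ := exists_pow_lt_of_lt_one hr (by norm_num : (1 / 2 : ℝ) < 1)
    obtain ⟨x, hx⟩ := A.exists_mem_vball n ζ
    refine ⟨x, ?_, Set.mem_iUnion.2 ⟨n, x.2⟩⟩
    have hx' : dist ζ x < 2 ^ (-(n : ℤ)) := hx
    rw [Metric.mem_ball, dist_comm]
    refine hx'.trans ?_
    rwa [zpow_neg, zpow_natCast, ← inv_pow, ← one_div]

end PolyDoubling

/-! ### Averaging operators on the sequence spaces -/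

namespace HyperbolicFilling

variable {Z : Type*} [MetricSpace Z] (A : HyperbolicFilling Z)

/-- On every level at most `N` vertices are within distance `32 * 2^(-k)` of a given point. -/
def OverlapBound (N : ℕ) : Prop :=
  ∀ (k : ℤ) (ζ : Z) (a : A.net k → ℝ≥0∞) (M : ℝ≥0∞),
    (∀ x, a x ≠ 0 → dist ζ x < 32 * 2 ^ (-k)) → (∀ x, a x ≤ M) → ∑' x, a x ≤ N * M

variable {A}

theorem le_levelSum {w : A.Vertex → ℝ≥0∞} {k : ℤ} {x : A.net k} {ζ : Z}
    (h : ζ ∈ A.vball ⟨k, x⟩) : w ⟨k, x⟩ ≤ A.levelSum w k ζ := by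
  have := ENNReal.le_tsum (f := fun x : A.net k =>
    (A.vball ⟨k, x⟩).indicator (fun _ => w ⟨k, x⟩) ζ) x
  simpa [h, levelSum] using this

theorem OverlapBound.levelSum_le {N : ℕ} (hN : A.OverlapBound N) {w : A.Vertex → ℝ≥0∞} {k : ℤ}
    {ζ : Z} {M : ℝ≥0∞} (hM : ∀ x, ζ ∈ A.vball ⟨k, x⟩ → w ⟨k, x⟩ ≤ M) :
    A.levelSum w k ζ ≤ N * M := by
  refine hN k ζ _ M (fun x hx => ?_) fun x => ?_
  · have h1 : ζ ∈ A.vball ⟨k, x⟩ := Set.mem_of_indicator_ne_zero hx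
    have h2 : dist ζ x < 2 ^ (-k) := h1
    have h3 : (0 : ℝ) < 2 ^ (-k) := by positivity
    linarith
  · by_cases hx : ζ ∈ A.vball ⟨k, x⟩
    · simpa [hx] using hM x hx
    · simp [hx]

/-- At most `N` terms are non-zero at a point, so the sum is comparable with its largest term and
powers can be moved inside. -/
theorem OverlapBound.levelSum_rpow_le {N : ℕ} (hN : A.OverlapBound N) (w : A.Vertex → ℝ≥0∞)
    {r : ℝ} (hr : 0 < r) (k : ℤ) (ζ : Z) :
    A.levelSum w k ζ ^ r ≤ (N : ℝ≥0∞) ^ r * A.levelSum (fun x => w x ^ r) k ζ := by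
  have h := hN.levelSum_le (w := w) (k := k) (ζ := ζ)
    (M := A.levelSum (fun x => w x ^ r) k ζ ^ r⁻¹) fun x hx => by
      rw [ENNReal.le_rpow_inv_iff hr]
      exact le_levelSum (w := fun x => w x ^ r) hx
  have h2 := ENNReal.rpow_le_rpow h hr.le
  rwa [ENNReal.mul_rpow_of_nonneg _ _ hr.le, ← ENNReal.rpow_mul, inv_mul_cancel₀ hr.ne',
    ENNReal.rpow_one] at h2

theorem OverlapBound.levelSum_rpow_ge {N : ℕ} (hN : A.OverlapBound N) (w : A.Vertex → ℝ≥0∞)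
    {r : ℝ} (hr : 0 < r) (k : ℤ) (ζ : Z) :
    A.levelSum (fun x => w x ^ r) k ζ ≤ N * A.levelSum w k ζ ^ r :=
  hN.levelSum_le fun x hx => by
    gcongr
    exact le_levelSum hx

theorem lintegral_levelSum [MeasurableSpace Z] [BorelSpace Z] (w : A.Vertex → ℝ≥0∞) (k : ℤ)
    [Countable (A.net k)] (ν : Measure Z) :
    ∫⁻ ζ, A.levelSum w k ζ ∂ν = ∑' x : A.net k, w ⟨k, x⟩ * ν (A.vball ⟨k, x⟩) := by
  unfold levelSum
  rw [lintegral_tsum fun x =>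
    (measurable_const.indicator (A.isOpen_vball ⟨k, x⟩).measurableSet).aemeasurable]
  refine tsum_congr fun x => ?_
  rw [lintegral_indicator_const (A.isOpen_vball ⟨k, x⟩).measurableSet]

variable (A) in
/-- `μ(B(x))⁻¹ ∫ g dμ` over the ball `8 B(x)`. -/
noncomputable def ballMean [MeasurableSpace Z] (μ : Measure Z) (g : Z → ℝ≥0∞) (x : A.Vertex) :
    ℝ≥0∞ :=
  (μ (A.vball x))⁻¹ * ∫⁻ ζ in Metric.ball (x.2 : Z) (8 * 2 ^ (-x.1)), g ζ ∂μ

end HyperbolicFilling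

/-! ### `L^p` bounds for averages of one level over the balls of another -/

namespace PolyDoubling

open HyperbolicFilling

variable {Z : Type*} [MetricSpace Z] [MeasurableSpace Z] {μ : Measure Z} {C Q : ℝ}

theorem exists_ball_eight_le (h : PolyDoubling μ C Q) (A : HyperbolicFilling Z) :
    ∃ K : ℝ≥0, ∀ x : A.Vertex,
      μ (Metric.ball (x.2 : Z) (8 * 2 ^ (-x.1))) ≤ K * μ (A.vball x) := by
  obtain ⟨K, hK⟩ := h.exists_ball_le
  refine ⟨K, fun x => ?_⟩
  have := hK x.2 x.2 x.1 x.1 (by lia) (by rw [dist_self]; positivity)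
  rw [sub_self, zero_mul, ENNReal.rpow_zero, mul_one] at this
  refine (measure_mono (Metric.ball_subset_ball ?_)).trans this
  gcongr
  norm_num

variable [BorelSpace Z]

theorem exists_overlapBound (h : PolyDoubling μ C Q) (A : HyperbolicFilling Z) :
    ∃ N, A.OverlapBound N := h.exists_tsum_le A 32

theorem eLpNorm_top_levelSum_ballMean_le (h : PolyDoubling μ C Q) (A : HyperbolicFilling Z) :
    ∃ K : ℝ≥0, ∀ (g : Z → ℝ≥0∞) (k : ℤ),
      eLpNorm (A.levelSum (A.ballMean μ g) k) ∞ μ ≤ K * eLpNorm g ∞ μ := by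
  obtain ⟨N, hN⟩ := h.exists_overlapBound A
  obtain ⟨K, hK⟩ := h.exists_ball_eight_le A
  refine ⟨N * K, fun g k => ?_⟩
  have h1 : ∀ x, A.ballMean μ g x ≤ K * eLpNorm g ∞ μ := by
    intro x
    calc A.ballMean μ g x ≤ (μ (A.vball x))⁻¹ *
          ∫⁻ ζ in Metric.ball (x.2 : Z) (8 * 2 ^ (-x.1)), eLpNorm g ∞ μ ∂μ := by
          unfold ballMean
          gcongr 1
          refine lintegral_mono_ae (ae_restrict_of_ae ?_)
          simpa using ae_le_eLpNormEssSup (f := g) (μ := μ)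
      _ ≤ (μ (A.vball x))⁻¹ * (eLpNorm g ∞ μ * (K * μ (A.vball x))) := by
          rw [setLIntegral_const]
          gcongr
          exact hK x
      _ = K * eLpNorm g ∞ μ * ((μ (A.vball x))⁻¹ * μ (A.vball x)) := by ring
      _ = _ := by
          rw [ENNReal.inv_mul_cancel (h.vball_ne_zero A x) (h.vball_ne_top A x), mul_one]
  rw [eLpNorm_exponent_top]
  refine eLpNormEssSup_le_of_ae_enorm_bound (ae_of_all _ fun ζ => ?_)
  rw [enorm_eq_self]
  refine (hN.levelSum_le fun x _ => h1 ⟨k, x⟩).trans (le_of_eq ?_)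
  push_cast
  ring

/-- The `L^p` norm of a level sum in terms of the discrete norm, for `p < ∞`. -/
theorem eLpNorm_levelSum_le (h : PolyDoubling μ C Q) {A : HyperbolicFilling Z} {N : ℕ}
    (hN : A.OverlapBound N) {p : ℝ≥0∞} (hp0 : p ≠ 0) (hp : p ≠ ∞) (w : A.Vertex → ℝ≥0∞) (k : ℤ) :
    eLpNorm (A.levelSum w k) p μ ≤
      N * (∑' x : A.net k, w ⟨k, x⟩ ^ p.toReal * μ (A.vball ⟨k, x⟩)) ^ (1 / p.toReal) := by
  have := h.countable_net A k
  have hp' := ENNReal.toReal_pos hp0 hp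
  rw [eLpNorm_eq_lintegral_rpow_enorm_toReal hp0 hp, ← lintegral_levelSum (fun x => w x ^ p.toReal)]
  calc _ ≤ (∫⁻ ζ, (N : ℝ≥0∞) ^ p.toReal * A.levelSum (fun x => w x ^ p.toReal) k ζ ∂μ) ^
        (1 / p.toReal) := by
        gcongr with ζ
        exact hN.levelSum_rpow_le w hp' k ζ
    _ = _ := by
        rw [lintegral_const_mul _ (A.measurable_levelSum _ k),
          ENNReal.mul_rpow_of_nonneg _ _ (by positivity), ← ENNReal.rpow_mul,
          mul_one_div_cancel hp'.ne', ENNReal.rpow_one]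

/-- Together with `eLpNorm_levelSum_le` this replaces the `L^p` norm of a level sum by a weighted
`ℓ^p` norm over the vertices. -/
theorem tsum_le_eLpNorm_levelSum (h : PolyDoubling μ C Q) {A : HyperbolicFilling Z} {N : ℕ}
    (hN : A.OverlapBound N) {p : ℝ≥0∞} (hp0 : p ≠ 0) (hp : p ≠ ∞) (w : A.Vertex → ℝ≥0∞) (k : ℤ) :
    ∑' x : A.net k, w ⟨k, x⟩ ^ p.toReal * μ (A.vball ⟨k, x⟩) ≤
      N * eLpNorm (A.levelSum w k) p μ ^ p.toReal := by
  have := h.countable_net A k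
  have hp' := ENNReal.toReal_pos hp0 hp
  rw [eLpNorm_eq_lintegral_rpow_enorm_toReal hp0 hp, ← lintegral_levelSum (fun x => w x ^ p.toReal),
    ← ENNReal.rpow_mul, one_div_mul_cancel hp'.ne', ENNReal.rpow_one,
    ← lintegral_const_mul _ (((A.measurable_levelSum w k).enorm).pow_const _)]
  refine lintegral_mono fun ζ => ?_
  exact hN.levelSum_rpow_ge w hp' k ζ

/-- Hölder on each ball `8 B(x)` bounds the `p`-th power of the mean by a mean of `g^p`, and the
bounded overlap of the balls `8 B(x)` of one level adds these up. -/
theorem eLpNorm_levelSum_ballMean_le_of_one_le (h : PolyDoubling μ C Q) (A : HyperbolicFilling Z)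
    {p : ℝ≥0∞} (h1 : 1 ≤ p) (hp : p ≠ ∞) :
    ∃ K : ℝ≥0, ∀ (g : Z → ℝ≥0∞), Measurable g → ∀ k : ℤ,
      eLpNorm (A.levelSum (A.ballMean μ g) k) p μ ≤ K * eLpNorm g p μ := by
  obtain ⟨N, hN⟩ := h.exists_overlapBound A
  obtain ⟨K, hK⟩ := h.exists_ball_eight_le A
  have hp0 : p ≠ 0 := (zero_lt_one.trans_le h1).ne'
  have hp' := ENNReal.toReal_pos hp0 hp
  have hp1 : 1 ≤ p.toReal := by simpa using ENNReal.toReal_mono hp h1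
  set r := p.toReal with hr
  refine ⟨N * (N * K ^ (r - 1)) ^ (1 / r), fun g hg k => ?_⟩
  have := h.countable_net A k
  set B : A.net k → Set Z := fun x => Metric.ball (x : Z) (8 * 2 ^ (-k)) with hB
  have key : ∀ x : A.net k, A.ballMean μ g ⟨k, x⟩ ^ r * μ (A.vball ⟨k, x⟩) ≤
      K ^ (r - 1) * ∫⁻ ζ in B x, g ζ ^ r ∂μ := by
    intro x
    set m := μ (A.vball ⟨k, x⟩) with hm
    have hm0 : m ≠ 0 := h.vball_ne_zero A _
    have hmt : m ≠ ∞ := h.vball_ne_top A _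
    have hBm : μ (B x) ≤ K * m := hK ⟨k, x⟩
    have hol : (∫⁻ ζ in B x, g ζ ∂μ) ^ r ≤ (∫⁻ ζ in B x, g ζ ^ r ∂μ) * (K * m) ^ (r - 1) := by
      have h2 := eLpNorm_le_eLpNorm_mul_rpow_measure_univ (μ := μ.restrict (B x)) (f := g) h1
        hg.aestronglyMeasurable
      rw [eLpNorm_one_eq_lintegral_enorm, eLpNorm_eq_lintegral_rpow_enorm_toReal hp0 hp] at h2
      simp only [enorm_eq_self, Measure.restrict_apply_univ, ENNReal.toReal_one, ← hr] at h2
      have h3 := ENNReal.rpow_le_rpow h2 hp'.le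
      rw [ENNReal.mul_rpow_of_nonneg _ _ hp'.le, ← ENNReal.rpow_mul, ← ENNReal.rpow_mul,
        one_div_mul_cancel hp'.ne', ENNReal.rpow_one] at h3
      refine h3.trans ?_
      have : (1 / 1 - 1 / r) * r = r - 1 := by field_simp
      rw [this]
      gcongr
    calc A.ballMean μ g ⟨k, x⟩ ^ r * m = (m⁻¹ ^ r * m) * (∫⁻ ζ in B x, g ζ ∂μ) ^ r := by
          unfold ballMean
          rw [ENNReal.mul_rpow_of_nonneg _ _ hp'.le, mul_right_comm]
      _ ≤ (m⁻¹ ^ r * m) * ((∫⁻ ζ in B x, g ζ ^ r ∂μ) * (K * m) ^ (r - 1)) := by gcongr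
      _ = K ^ (r - 1) * (∫⁻ ζ in B x, g ζ ^ r ∂μ) * (m⁻¹ ^ r * (m * m ^ (r - 1))) := by
          rw [ENNReal.mul_rpow_of_nonneg _ _ (by linarith)]
          ring
      _ = _ := by
          have : m * m ^ (r - 1) = m ^ r := by
            nth_rw 1 [← ENNReal.rpow_one m]
            rw [← ENNReal.rpow_add _ _ hm0 hmt]
            congr 1
            ring
          rw [this, ← ENNReal.mul_rpow_of_nonneg _ _ hp'.le, ENNReal.inv_mul_cancel hm0 hmt,
            ENNReal.one_rpow, mul_one]
  have hsum : ∑' x : A.net k, ∫⁻ ζ in B x, g ζ ^ r ∂μ ≤ N * ∫⁻ ζ, g ζ ^ r ∂μ := by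
    have hBm : ∀ x, MeasurableSet (B x) := fun x => measurableSet_ball
    rw [tsum_congr fun x => (lintegral_indicator (hBm x) _).symm]
    rw [← lintegral_tsum fun x =>
      ((hg.pow_const r).indicator (hBm x)).aemeasurable,
      ← lintegral_const_mul _ (hg.pow_const r)]
    refine lintegral_mono fun ζ => hN k ζ _ _ (fun x hx => ?_) fun x => ?_
    · have h1 : ζ ∈ B x := Set.mem_of_indicator_ne_zero hx
      have h2 : dist ζ x < 8 * 2 ^ (-k) := h1
      have h3 : (0 : ℝ) < 2 ^ (-k) := by positivity
      linarith
    · exact Set.indicator_le_self _ _ _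
  refine (h.eLpNorm_levelSum_le hN hp0 hp _ k).trans ?_
  calc _ ≤ N * ((K : ℝ≥0∞) ^ (r - 1) * (N * ∫⁻ ζ, g ζ ^ r ∂μ)) ^ (1 / r) := by
        gcongr
        refine (ENNReal.tsum_le_tsum key).trans ?_
        rw [ENNReal.tsum_mul_left]
        gcongr
    _ = _ := by
        have hK' : (K : ℝ≥0∞) ^ (r - 1) = ((K ^ (r - 1) : ℝ≥0) : ℝ≥0∞) :=
          (ENNReal.coe_rpow_of_nonneg _ (by linarith)).symm
        rw [eLpNorm_eq_lintegral_rpow_enorm_toReal hp0 hp]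
        simp only [enorm_eq_self, ← hr]
        push_cast
        rw [ENNReal.coe_rpow_of_nonneg _ (by positivity : 0 ≤ 1 / r), ENNReal.coe_mul, ← hK',
          ENNReal.coe_natCast, mul_assoc, ← ENNReal.mul_rpow_of_nonneg _ _ (by positivity)]
        congr 2
        ring

end PolyDoubling

namespace PolyDoubling

open HyperbolicFilling

variable {Z : Type*} [MetricSpace Z] [MeasurableSpace Z] [BorelSpace Z] {μ : Measure Z} {C Q : ℝ}

/-- The averaged function is a sum over balls `B(y)` of size `2^(-j)`. Subadditivity of `t ↦ t^p`
separates these balls, and each contributes a factor `(μ(B(x))/μ(B(y)))^(1-p)`, which doubling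
bounds by a multiple of `2^((j-k)Q(1-p))`. The `p`-th root produces the exponent `Q(1/p - 1)`. -/
theorem eLpNorm_levelSum_ballMean_le_of_le_one (h : PolyDoubling μ C Q) (A : HyperbolicFilling Z)
    {p : ℝ≥0∞} (hp0 : p ≠ 0) (hp1 : p ≤ 1) :
    ∃ K : ℝ≥0, ∀ (w : A.Vertex → ℝ≥0∞) (k j : ℤ), k - 1 ≤ j →
      eLpNorm (A.levelSum (A.ballMean μ (A.levelSum w j)) k) p μ ≤
        K * 2 ^ (((j : ℝ) - k) * (Q * (1 / p.toReal - 1))) * eLpNorm (A.levelSum w j) p μ := by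
  obtain ⟨N, hN⟩ := h.exists_overlapBound A
  obtain ⟨K, hK⟩ := h.exists_ball_le
  have hp : p ≠ ∞ := (hp1.trans_lt ENNReal.one_lt_top).ne
  have hp' := ENNReal.toReal_pos hp0 hp
  have hp1' : p.toReal ≤ 1 := by simpa using ENNReal.toReal_mono ENNReal.one_ne_top hp1
  set r := p.toReal with hr
  refine ⟨N * (N * N * K ^ (1 - r)) ^ (1 / r), fun w k j hkj => ?_⟩
  have := h.countable_net A k
  have := h.countable_net A j
  set F : ℝ≥0∞ := K * 2 ^ (((j : ℝ) - k) * Q) with hF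
  have h2k : (0 : ℝ) < 2 ^ (-k) := by positivity
  have hjk : (2 : ℝ) ^ (-j) ≤ 2 * 2 ^ (-k) := by
    rw [← zpow_one_add₀ (by norm_num)]
    exact zpow_le_zpow_right₀ (by norm_num) (by lia)
  -- Only these `y` matter: if `B(y)` meets `8 B(x)`, the centres are closer than `8 * 2^(-k) +
  -- 2^(-j) ≤ 10 * 2^(-k)`.
  set near : A.net k → A.net j → Prop := fun x y => dist (y : Z) x < 16 * 2 ^ (-k) with hnear
  classical
  -- the discrete kernel estimate
  have key : ∀ x : A.net k, A.ballMean μ (A.levelSum w j) ⟨k, x⟩ ^ r * μ (A.vball ⟨k, x⟩) ≤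
      ∑' y : A.net j, if near x y then
        F ^ (1 - r) * (w ⟨j, y⟩ ^ r * μ (A.vball ⟨j, y⟩)) else 0 := by
    intro x
    set m := μ (A.vball ⟨k, x⟩) with hm
    have hm0 : m ≠ 0 := h.vball_ne_zero A _
    have hmt : m ≠ ∞ := h.vball_ne_top A _
    have h1 : A.ballMean μ (A.levelSum w j) ⟨k, x⟩ ≤
        ∑' y : A.net j, if near x y then m⁻¹ * (w ⟨j, y⟩ * μ (A.vball ⟨j, y⟩)) else 0 := by
      unfold ballMean
      rw [lintegral_levelSum, ← ENNReal.tsum_mul_left]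
      refine ENNReal.tsum_le_tsum fun y => ?_
      rw [Measure.restrict_apply (A.isOpen_vball _).measurableSet]
      split_ifs with hxy
      · gcongr
        exact Set.inter_subset_left
      · have : A.vball ⟨j, y⟩ ∩ Metric.ball (x : Z) (8 * 2 ^ (-k)) = ∅ := by
          refine Set.eq_empty_of_forall_notMem fun θ hθ => hxy ?_
          have h3 : dist θ y < 2 ^ (-j) := hθ.1
          have h4 : dist θ x < 8 * 2 ^ (-k) := hθ.2
          have h5 := dist_triangle_left (y : Z) x θ
          show dist (y : Z) x < _
          linarith
        rw [this]
        simp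
    have h2 := (ENNReal.rpow_le_rpow h1 hp'.le).trans (ENNReal.rpow_tsum_le_tsum_rpow _ hp' hp1')
    refine (mul_le_mul_left h2 m).trans ?_
    rw [← ENNReal.tsum_mul_right]
    refine ENNReal.tsum_le_tsum fun y => ?_
    split_ifs with hxy
    · set n := μ (A.vball ⟨j, y⟩) with hn
      have hn0 : n ≠ 0 := h.vball_ne_zero A _
      have hnt : n ≠ ∞ := h.vball_ne_top A _
      have hmn : m ≤ F * n := by
        refine le_trans (measure_mono (Metric.ball_subset_ball ?_))
          (hK x y k j hkj (by rw [dist_comm]; exact le_of_lt hxy))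
        show (2 : ℝ) ^ (-k) ≤ _
        linarith
      have e1 : m⁻¹ ^ r * m = m ^ (1 - r) := by
        rw [ENNReal.inv_rpow, ← ENNReal.rpow_neg]
        nth_rw 2 [← ENNReal.rpow_one m]
        rw [← ENNReal.rpow_add _ _ hm0 hmt]
        congr 1
        ring
      have e2 : n ^ r * n ^ (1 - r) = n := by
        rw [← ENNReal.rpow_add _ _ hn0 hnt]
        simp
      calc (m⁻¹ * (w ⟨j, y⟩ * n)) ^ r * m = m ^ (1 - r) * (w ⟨j, y⟩ ^ r * n ^ r) := by
            rw [ENNReal.mul_rpow_of_nonneg _ _ hp'.le, ENNReal.mul_rpow_of_nonneg _ _ hp'.le, ← e1]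
            ring
        _ ≤ (F * n) ^ (1 - r) * (w ⟨j, y⟩ ^ r * n ^ r) := by
            gcongr
        _ = F ^ (1 - r) * (w ⟨j, y⟩ ^ r * (n ^ r * n ^ (1 - r))) := by
            rw [ENNReal.mul_rpow_of_nonneg _ _ (by linarith)]
            ring
        _ = _ := by rw [e2]
    · simp [hp']
  have hsum : ∑' x : A.net k, A.ballMean μ (A.levelSum w j) ⟨k, x⟩ ^ r * μ (A.vball ⟨k, x⟩) ≤
      F ^ (1 - r) * (N * (N * eLpNorm (A.levelSum w j) p μ ^ r)) := by
    refine (ENNReal.tsum_le_tsum key).trans ?_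
    -- With the sum over `x` taken first, each `y` is near at most `N` vertices `x`.
    rw [ENNReal.tsum_comm]
    calc _ ≤ ∑' y : A.net j, N * (F ^ (1 - r) * (w ⟨j, y⟩ ^ r * μ (A.vball ⟨j, y⟩))) := by
          refine ENNReal.tsum_le_tsum fun y => hN k y _ _ (fun x hx => ?_) fun x => ?_
          · have h3 : near x y := by
              by_contra hcon
              exact hx (if_neg hcon)
            have h4 : dist (y : Z) x < 16 * 2 ^ (-k) := h3
            linarith
          · split_ifs
            · exact le_rfl
            · exact zero_le
      _ = F ^ (1 - r) * (N * ∑' y : A.net j, w ⟨j, y⟩ ^ r * μ (A.vball ⟨j, y⟩)) := by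
          rw [ENNReal.tsum_mul_left, ENNReal.tsum_mul_left]
          ring
      _ ≤ _ := by
          gcongr
          exact h.tsum_le_eLpNorm_levelSum hN hp0 hp w j
  refine (h.eLpNorm_levelSum_le hN hp0 hp _ k).trans ?_
  calc _ ≤ N * (F ^ (1 - r) * (N * (N * eLpNorm (A.levelSum w j) p μ ^ r))) ^ (1 / r) := by
        gcongr
    _ = N * ((N * N * K ^ (1 - r)) ^ (1 / r) * (2 ^ (((j : ℝ) - k) * Q * (1 - r))) ^ (1 / r) *
        (eLpNorm (A.levelSum w j) p μ ^ r) ^ (1 / r)) := by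
        have hr1 : 0 ≤ 1 / r := by positivity
        rw [hF, ENNReal.mul_rpow_of_nonneg _ _ (by linarith : 0 ≤ 1 - r), ← ENNReal.rpow_mul 2,
          ← ENNReal.mul_rpow_of_nonneg _ _ hr1, ← ENNReal.mul_rpow_of_nonneg _ _ hr1]
        congr 2
        ring
    _ = _ := by
        have hK' : (K : ℝ≥0∞) ^ (1 - r) = ((K ^ (1 - r) : ℝ≥0) : ℝ≥0∞) :=
          (ENNReal.coe_rpow_of_nonneg _ (by linarith)).symm
        rw [← ENNReal.rpow_mul, ← ENNReal.rpow_mul, mul_one_div_cancel hp'.ne', ENNReal.rpow_one,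
          hK']
        push_cast
        rw [ENNReal.coe_rpow_of_nonneg _ (by positivity : 0 ≤ 1 / r)]
        push_cast
        have : ((j : ℝ) - k) * Q * (1 - r) * (1 / r) = ((j : ℝ) - k) * (Q * (1 / r - 1)) := by
          field_simp
        rw [this]
        ring

/-- Averages over balls of size `2^(-k)` of functions that are constant at the smaller scale
`2^(-j)` lose at most a factor `2^((j-k)σ)` with `σ < s`. -/
theorem exists_eLpNorm_levelSum_ballMean_le (h : PolyDoubling μ C Q) (A : HyperbolicFilling Z)
    {s : ℝ} {p : ℝ≥0∞} (hs : 0 < s) (hp : ENNReal.ofReal (Q / (Q + s)) < p) :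
    ∃ σ < s, ∃ K : ℝ≥0, ∀ (w : A.Vertex → ℝ≥0∞) (k j : ℤ), k - 1 ≤ j →
      eLpNorm (A.levelSum (A.ballMean μ (A.levelSum w j)) k) p μ ≤
        K * 2 ^ (((j : ℝ) - k) * σ) * eLpNorm (A.levelSum w j) p μ := by
  have hQ := h.Q_pos
  rcases eq_or_ne p ∞ with rfl | hpt
  · obtain ⟨K, hK⟩ := h.eLpNorm_top_levelSum_ballMean_le A
    exact ⟨0, hs, K, fun w k j _ => by simpa using hK (A.levelSum w j) k⟩
  rcases le_total 1 p with h1 | h1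
  · obtain ⟨K, hK⟩ := h.eLpNorm_levelSum_ballMean_le_of_one_le A h1 hpt
    exact ⟨0, hs, K, fun w k j _ => by
      simpa using hK (A.levelSum w j) (A.measurable_levelSum w j) k⟩
  · have hp0 : p ≠ 0 := (zero_le.trans_lt hp).ne'
    obtain ⟨K, hK⟩ := h.eLpNorm_levelSum_ballMean_le_of_le_one A hp0 h1
    refine ⟨_, ?_, K, hK⟩
    -- `Q(1/p - 1) < s` is the lower bound on `p` rearranged.
    have h2 : Q / (Q + s) < p.toReal := (ENNReal.ofReal_lt_iff_lt_toReal (by positivity) hpt).1 hp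
    have h3 : 0 < p.toReal := ENNReal.toReal_pos hp0 hpt
    rw [div_lt_iff₀ (by positivity)] at h2
    rw [one_div, mul_sub, mul_one, sub_lt_iff_lt_add, ← div_eq_mul_inv, div_lt_iff₀ h3]
    linarith

end PolyDoubling

/-! ### Sums over all finer scales and their averages -/

namespace HyperbolicFilling

variable {Z : Type*} [MetricSpace Z]

/-- The function `∑_{j ≥ k - 1} ∑_{x ∈ X_j} w(x) χ_{B(x)}`. -/
noncomputable def tailSum (A : HyperbolicFilling Z) (w : A.Vertex → ℝ≥0∞) (k : ℤ) (ζ : Z) :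
    ℝ≥0∞ :=
  ∑' m : ℕ, A.levelSum w (k - 1 + m) ζ

/-- The average over `8 B(x)` of the contributions of all scales at most that of `B(x)`. -/
noncomputable def tailMean [MeasurableSpace Z] (A : HyperbolicFilling Z) (μ : Measure Z)
    (w : A.Vertex → ℝ≥0∞)
    (x : A.Vertex) : ℝ≥0∞ :=
  A.ballMean μ (A.tailSum w x.1) x

theorem measurable_tailSum [MeasurableSpace Z] [BorelSpace Z] (A : HyperbolicFilling Z)
    (w : A.Vertex → ℝ≥0∞)
    (k : ℤ) : Measurable (A.tailSum w k) :=
  Measurable.tsum fun _ => A.measurable_levelSum w _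

theorem levelSum_tailMean [MeasurableSpace Z] [BorelSpace Z] (A : HyperbolicFilling Z)
    (μ : Measure Z)
    (w : A.Vertex → ℝ≥0∞) (k : ℤ) (ζ : Z) :
    A.levelSum (A.tailMean μ w) k ζ =
      ∑' m : ℕ, A.levelSum (A.ballMean μ (A.levelSum w (k - 1 + m))) k ζ := by
  simp only [levelSum]
  rw [ENNReal.tsum_comm]
  refine tsum_congr fun x => ?_
  by_cases hx : ζ ∈ A.vball ⟨k, x⟩
  · simp only [hx, Set.indicator_of_mem]
    unfold tailMean tailSum ballMean
    rw [lintegral_tsum fun m => (A.measurable_levelSum w _).aemeasurable, ENNReal.tsum_mul_left]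
  · simp [hx]

end HyperbolicFilling

namespace PolyDoubling

open HyperbolicFilling

variable {Z : Type*} [MetricSpace Z] [MeasurableSpace Z] [BorelSpace Z] {μ : Measure Z} {C Q : ℝ}

/-- The operator `w ↦ tailMean w` is bounded on `I^s_{p,q}(X)`. -/
theorem exists_seqNorm_tailMean_le (h : PolyDoubling μ C Q) (A : HyperbolicFilling Z)
    {s : ℝ} {p q : ℝ≥0∞} (hs : 0 < s) (hp : ENNReal.ofReal (Q / (Q + s)) < p) (hq : 0 < q) :
    ∃ K : ℝ≥0, ∀ w : A.Vertex → ℝ≥0∞,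
      A.seqNorm μ s p q (A.tailMean μ w) ≤ K * A.seqNorm μ s p q w := by
  obtain ⟨σ, hσ, K, hK⟩ := h.exists_eLpNorm_levelSum_ballMean_le A hs hp
  have hp0 : 0 < p := zero_le.trans_lt hp
  -- A single exponent serves the `r`-triangle inequality in both `L^p` and `ℓ^q`; the 1 in the
  -- minimum keeps it finite when `p` and `q` are infinite.
  obtain ⟨r, hr, hrlt⟩ : ∃ r : ℝ, 0 < r ∧ ENNReal.ofReal r ≤ min 1 (min p q) := by
    have hpos : 0 < min 1 (min p q) := lt_min zero_lt_one (lt_min hp0 hq)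
    have hne : min 1 (min p q) ≠ ∞ := ((min_le_left _ _).trans_lt ENNReal.one_lt_top).ne
    exact ⟨(min 1 (min p q)).toReal, ENNReal.toReal_pos hpos.ne' hne,
      (ENNReal.ofReal_toReal hne).le⟩
  have hr1 : r ≤ 1 := by
    have := hrlt.trans (min_le_left _ _)
    rwa [ENNReal.ofReal_le_one] at this
  have hrp := hrlt.trans ((min_le_right _ _).trans (min_le_left _ _))
  have hrq := hrlt.trans ((min_le_right _ _).trans (min_le_right _ _))
  -- At level `j = k - 1 + m` weight and loss combine to `2^(ks) 2^((j-k)σ) = 2^(js)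
  -- 2^(-(m-1)(s-σ))`. The extra constant `2^(s-σ)` comes from starting one level below `k`.
  obtain ⟨K', hK'⟩ := eLpNorm_count_hardy hr hrq (sub_pos.2 hσ)
    (K * (2 : ℝ≥0) ^ (s - σ))
  refine ⟨K', fun w => hK' _ _ fun k => ?_⟩
  have hfun : A.levelSum (A.tailMean μ w) k =
      fun ζ => ∑' m : ℕ, A.levelSum (A.ballMean μ (A.levelSum w (k - 1 + m))) k ζ :=
    funext (A.levelSum_tailMean μ w k)
  rw [ENNReal.mul_rpow_of_nonneg _ _ hr.le, hfun]
  calc _ ≤ ((2 : ℝ≥0∞) ^ ((k : ℝ) * s)) ^ r * ∑' m : ℕ,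
        eLpNorm (A.levelSum (A.ballMean μ (A.levelSum w (k - 1 + m))) k) p μ ^ r := by
        gcongr
        exact eLpNorm_tsum_rpow_le hr hr1 hrp fun m => A.measurable_levelSum _ _
    _ ≤ _ := by
        rw [← ENNReal.tsum_mul_left]
        refine ENNReal.tsum_le_tsum fun m => ?_
        rw [← ENNReal.mul_rpow_of_nonneg _ _ hr.le]
        refine ENNReal.rpow_le_rpow ?_ hr.le
        calc _ ≤ (2 : ℝ≥0∞) ^ ((k : ℝ) * s) * (K * 2 ^ ((((k - 1 + m : ℤ) : ℝ) - k) * σ) *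
              eLpNorm (A.levelSum w (k - 1 + m)) p μ) := by
              gcongr
              exact hK w k _ (by lia)
          _ = K * (2 ^ ((k : ℝ) * s) * 2 ^ ((((k - 1 + m : ℤ) : ℝ) - k) * σ)) *
              eLpNorm (A.levelSum w (k - 1 + m)) p μ := by ring
          _ = K * (2 ^ (s - σ) * 2 ^ (-(m : ℝ) * (s - σ)) * 2 ^ (((k - 1 + m : ℤ) : ℝ) * s)) *
              eLpNorm (A.levelSum w (k - 1 + m)) p μ := by
              congr 2
              simp only [← ENNReal.rpow_add _ _ (two_ne_zero : (2 : ℝ≥0∞) ≠ 0) ENNReal.ofNat_ne_top]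
              congr 1
              push_cast
              ring
          _ = _ := by
              rw [ENNReal.coe_mul, ENNReal.coe_rpow_of_ne_zero (by norm_num)]
              push_cast
              ring

end PolyDoubling

/-! ### Gradients, the graph, and pointwise bounds -/

namespace HyperbolicFilling

variable {Z : Type*} [MetricSpace Z] {A : HyperbolicFilling Z}

theorem enorm_sub_le_gradNorm (u : A.Vertex → ℂ) {x y : A.Vertex} (hxy : A.graph.Adj x y) :
    ‖u y - u x‖ₑ ≤ A.gradNorm u x := by
  have h1 := ENNReal.le_tsum (f := fun y : A.graph.neighborSet x => ‖u y - u x‖ₑ ^ 2) ⟨y, hxy⟩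
  have h2 := ENNReal.rpow_le_rpow h1 (by norm_num : (0 : ℝ) ≤ 1 / 2)
  rw [← ENNReal.rpow_natCast, ← ENNReal.rpow_mul] at h2
  simpa [gradNorm] using h2

theorem gradNorm_le_tsum (u : A.Vertex → ℂ) (x : A.Vertex) :
    A.gradNorm u x ≤ ∑' y : A.graph.neighborSet x, ‖u y - u x‖ₑ := by
  refine (ENNReal.rpow_tsum_le_tsum_rpow _ (by norm_num) (by norm_num)).trans (le_of_eq ?_)
  refine tsum_congr fun y => ?_
  rw [← ENNReal.rpow_natCast, ← ENNReal.rpow_mul]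
  norm_num

theorem adj_of_mem {x y : A.Vertex} {ζ : Z} (hx : ζ ∈ A.vball x) (hy : ζ ∈ A.vball y)
    (hne : x ≠ y) (hl : |x.1 - y.1| ≤ 1) : A.graph.Adj x y :=
  ⟨hne, ⟨ζ, hx, hy⟩, hl⟩

/-- Balls through `ζ` on adjacent levels are joined by an edge, and every level has a ball through
`ζ`; so one can move one level at a time. -/
theorem reachable_of_mem {ζ : Z} (n : ℕ) : ∀ {x y : A.Vertex}, ζ ∈ A.vball x → ζ ∈ A.vball y →
    x.1 = y.1 + n → A.graph.Reachable x y := by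
  induction n with
  | zero =>
    intro x y hx hy hl
    by_cases hne : x = y
    · rw [hne]
    · exact (adj_of_mem hx hy hne (by simp [hl])).reachable
  | succ n ih =>
    intro x y hx hy hl
    obtain ⟨z, hz⟩ := A.exists_mem_vball (y.1 + n) ζ
    refine SimpleGraph.Reachable.trans (v := ⟨y.1 + n, z⟩) ?_ (ih hz hy rfl)
    refine (adj_of_mem hx hz (fun he => ?_) ?_).reachable
    · have := congrArg Sigma.fst he
      simp only at this
      lia
    · simp [hl]

theorem exists_common_vball (x y : A.Vertex) :
    ∃ z : A.Vertex, z.1 ≤ x.1 ∧ z.1 ≤ y.1 ∧ (x.2 : Z) ∈ A.vball z ∧ (y.2 : Z) ∈ A.vball z := by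
  obtain ⟨n, hn⟩ := pow_unbounded_of_one_lt (dist (x.2 : Z) y.2) (by norm_num : (1 : ℝ) < 2)
  -- At level at most `-n - 1` the half radius `2^(-k-1)` is at least `2^n`, which exceeds the
  -- distance of the two centres.
  set k : ℤ := min (min x.1 y.1) (-n - 1) with hk
  have hk1 : k ≤ x.1 := (min_le_left _ _).trans (min_le_left _ _)
  have hk2 : k ≤ y.1 := (min_le_left _ _).trans (min_le_right _ _)
  have hk3 : k ≤ -n - 1 := min_le_right _ _
  obtain ⟨z, hz⟩ := A.exists_dist_lt k (x.2 : Z)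
  have h1 : (2 : ℝ) ^ n ≤ 2 ^ (-k - 1) := by
    rw [← zpow_natCast]
    exact zpow_le_zpow_right₀ (by norm_num) (by lia)
  have h2 : (2 : ℝ) ^ (-k) = 2 * 2 ^ (-k - 1) := by
    rw [← zpow_one_add₀ (by norm_num)]
    congr 1
    ring
  have h3 : (0 : ℝ) < 2 ^ (-k - 1) := by positivity
  refine ⟨⟨k, z⟩, hk1, hk2, ?_, ?_⟩
  · show dist (x.2 : Z) z < 2 ^ (-k)
    linarith
  · show dist (y.2 : Z) z < 2 ^ (-k)
    have := dist_triangle_left (y.2 : Z) z x.2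
    linarith

/-- Paths over the centres of `x` and of `y` lead to a common vertex whose ball contains both
centres. -/
theorem reachable (x y : A.Vertex) : A.graph.Reachable x y := by
  obtain ⟨z, h1, h2, hx, hy⟩ := exists_common_vball x y
  have e1 : x.1 = z.1 + (x.1 - z.1).toNat := by lia
  have e2 : y.1 = z.1 + (y.1 - z.1).toNat := by lia
  exact (reachable_of_mem _ (A.mem_vball_self x) hx e1).trans
    (reachable_of_mem _ (A.mem_vball_self y) hy e2).symm

/-- Every bounded set is contained in the ball of some vertex. -/
theorem exists_subset_vball (ζ₀ : Z) {S : Set Z} (hS : Bornology.IsBounded S) :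
    ∃ x : A.Vertex, S ⊆ A.vball x := by
  obtain ⟨r, hr⟩ := hS.subset_ball ζ₀
  obtain ⟨n, hn⟩ := pow_unbounded_of_one_lt r (by norm_num : (1 : ℝ) < 2)
  obtain ⟨x, hx⟩ := A.exists_dist_lt (-n - 1) ζ₀
  refine ⟨⟨_, x⟩, fun ζ hζ => ?_⟩
  have h1 : dist ζ ζ₀ < r := hr hζ
  have h2 := dist_triangle ζ ζ₀ (x : Z)
  have h3 : (2 : ℝ) ^ (-(-(n : ℤ) - 1)) = 2 * 2 ^ n := by
    rw [neg_sub', neg_neg, sub_neg_eq_add, zpow_add_one₀ (by norm_num), zpow_natCast, mul_comm]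
  have h4 : (2 : ℝ) ^ (-(-(n : ℤ) - 1) - 1) = 2 ^ n := by
    rw [← zpow_natCast]
    congr 1
    ring
  rw [h4] at hx
  show dist ζ x < _
  rw [h3]
  linarith

theorem levelSum_le_tailSum (w : A.Vertex → ℝ≥0∞) {k j : ℤ} (hkj : k - 1 ≤ j) (ζ : Z) :
    A.levelSum w j ζ ≤ A.tailSum w k ζ := by
  obtain ⟨m, hm⟩ := Int.eq_ofNat_of_zero_le (sub_nonneg.2 hkj)
  have := ENNReal.le_tsum (f := fun m : ℕ => A.levelSum w (k - 1 + m) ζ) m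
  have hj : k - 1 + m = j := by lia
  rwa [hj] at this

theorem tailSum_anti (w : A.Vertex → ℝ≥0∞) {k j : ℤ} (hkj : k ≤ j) (ζ : Z) :
    A.tailSum w j ζ ≤ A.tailSum w k ζ := by
  obtain ⟨n, hn⟩ := Int.eq_ofNat_of_zero_le (sub_nonneg.2 hkj)
  have h := ENNReal.tsum_comp_le_tsum_of_injective (add_left_injective n)
    (fun m : ℕ => A.levelSum w (k - 1 + m) ζ)
  refine le_trans (le_of_eq (tsum_congr fun m => ?_)) h
  congr 1
  push_cast
  lia

theorem tendsto_tailSum {w : A.Vertex → ℝ≥0∞} {k : ℤ} {ζ : Z} (h : A.tailSum w k ζ ≠ ∞) :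
    Tendsto (fun n : ℤ => A.tailSum w n ζ) atTop (𝓝 0) := by
  have h1 := (ENNReal.tendsto_sum_nat_add (fun m : ℕ => A.levelSum w (k - 1 + m) ζ) h).comp
    ((tendsto_atTop_atTop.2 fun b => ⟨k + b, fun a ha => by lia⟩) :
      Tendsto (fun n : ℤ => (n - k).toNat) atTop atTop)
  refine h1.congr' ?_
  filter_upwards [eventually_ge_atTop k] with n hn
  refine tsum_congr fun m => ?_
  congr 1
  push_cast
  lia

/-- On the ball of `x` averages are controlled by `tailMean`. -/
theorem setLIntegral_vball_le [MeasurableSpace Z] (μ : Measure Z) (w : A.Vertex → ℝ≥0∞)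
    (x : A.Vertex) :
    (μ (A.vball x))⁻¹ * ∫⁻ ζ in A.vball x, A.tailSum w x.1 ζ ∂μ ≤ A.tailMean μ w x := by
  unfold tailMean ballMean
  gcongr
  have h2 : (0 : ℝ) < 2 ^ (-x.1) := by positivity
  have hsub : A.vball x ⊆ Metric.ball (x.2 : Z) (8 * 2 ^ (-x.1)) :=
    Metric.ball_subset_ball (by linarith)
  exact hsub

/-- Neighbours lie on levels at least `|x| - 1`, so their sum can be indexed like `tailSum` and
compared with it term by term. -/
theorem tsum_neighborSet (x : A.Vertex) (f : A.Vertex → ℝ≥0∞) :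
    ∑' y : A.graph.neighborSet x, f y = ∑' m : ℕ, ∑' y : A.net (x.1 - 1 + m),
      (A.graph.neighborSet x).indicator f ⟨_, y⟩ := by
  rw [tsum_subtype, ENNReal.tsum_sigma']
  have hinj : Function.Injective fun m : ℕ => x.1 - 1 + (m : ℤ) := fun a b hab => by
    simpa using hab
  refine (hinj.tsum_eq (f := fun n : ℤ => ∑' y : A.net n,
    (A.graph.neighborSet x).indicator f ⟨n, y⟩) fun n hn => ?_).symm
  rw [Function.mem_support, Ne, ENNReal.tsum_eq_zero, not_forall] at hn
  obtain ⟨y, hy⟩ := hn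
  have h0 : (⟨n, y⟩ : A.Vertex) ∈ A.graph.neighborSet x := Set.mem_of_indicator_ne_zero hy
  have h1 : A.graph.Adj x ⟨n, y⟩ := h0
  have h2 := abs_le.1 h1.2.2
  simp only at h2
  exact ⟨(n - (x.1 - 1)).toNat, by simp only; lia⟩

/-- The radius of a neighbour is at most twice that of `B(x)`, so the dilation 5 would do; this is
why `ballMean` integrates over an enlarged ball. -/
theorem vball_subset_of_adj {x y : A.Vertex} (h : A.graph.Adj x y) :
    A.vball y ⊆ Metric.ball (x.2 : Z) (8 * 2 ^ (-x.1)) := by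
  obtain ⟨-, ⟨θ, h1, h2⟩, h3⟩ := h
  intro ζ hζ
  have e1 : dist θ x.2 < 2 ^ (-x.1) := h1
  have e2 : dist θ y.2 < 2 ^ (-y.1) := h2
  have e3 : dist ζ y.2 < 2 ^ (-y.1) := hζ
  have e4 : (2 : ℝ) ^ (-y.1) ≤ 2 * 2 ^ (-x.1) := by
    rw [← zpow_one_add₀ (by norm_num)]
    have := (abs_le.1 h3).2
    exact zpow_le_zpow_right₀ (by norm_num) (by lia)
  have e5 := dist_triangle ζ (y.2 : Z) x.2
  have e6 := dist_triangle_left (y.2 : Z) x.2 θ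
  have e7 : (0 : ℝ) < 2 ^ (-x.1) := by positivity
  rw [Metric.mem_ball]
  linarith

end HyperbolicFilling

namespace PolyDoubling

open HyperbolicFilling

variable {Z : Type*} [MetricSpace Z] [MeasurableSpace Z] [BorelSpace Z] {μ : Measure Z} {C Q : ℝ}

theorem tailMean_eq (h : PolyDoubling μ C Q) {A : HyperbolicFilling Z} (w : A.Vertex → ℝ≥0∞)
    (x : A.Vertex) : A.tailMean μ w x = (μ (A.vball x))⁻¹ *
      ∑' m : ℕ, ∑' y : A.net (x.1 - 1 + m), w ⟨_, y⟩ *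
        μ (A.vball ⟨_, y⟩ ∩ Metric.ball (x.2 : Z) (8 * 2 ^ (-x.1))) := by
  unfold tailMean ballMean tailSum
  rw [lintegral_tsum fun m => (A.measurable_levelSum w _).aemeasurable]
  congr 1
  refine tsum_congr fun m => ?_
  have := h.countable_net A (x.1 - 1 + m)
  rw [lintegral_levelSum]
  refine tsum_congr fun y => ?_
  rw [Measure.restrict_apply (A.isOpen_vball _).measurableSet]

theorem le_tailMean (h : PolyDoubling μ C Q) {A : HyperbolicFilling Z} (w : A.Vertex → ℝ≥0∞)
    (x : A.Vertex) : w x ≤ A.tailMean μ w x := by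
  refine le_trans ?_ (setLIntegral_vball_le μ w x)
  calc w x = (μ (A.vball x))⁻¹ * ∫⁻ _ in A.vball x, w x ∂μ := by
        rw [setLIntegral_const, mul_left_comm,
          ENNReal.inv_mul_cancel (h.vball_ne_zero A x) (h.vball_ne_top A x), mul_one]
    _ ≤ _ := by
        gcongr 1
        refine setLIntegral_mono' (A.isOpen_vball x).measurableSet fun ζ hζ => ?_
        exact (le_levelSum (x := x.2) hζ).trans (levelSum_le_tailSum w (by lia) ζ)

/-- In `tailMean` the value at a neighbour `y` occurs with weight `μ(B(y))/μ(B(x))`, bounded below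
by doubling. The value at `x` itself is counted once per neighbour, at most `N` times on each of
three levels. -/
theorem exists_gradNorm_le_tailMean (h : PolyDoubling μ C Q) (A : HyperbolicFilling Z) :
    ∃ K : ℝ≥0, ∀ (u : A.Vertex → ℂ) (x : A.Vertex),
      A.gradNorm u x ≤ K * A.tailMean μ (fun y => ‖u y‖ₑ) x := by
  obtain ⟨N, hN⟩ := h.exists_overlapBound A
  obtain ⟨K, hK⟩ := h.exists_ball_le
  refine ⟨K * 2 ^ Q + 3 * N, fun u x => ?_⟩
  have hsum : ∑' y : A.graph.neighborSet x, ‖u y‖ₑ ≤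
      (K * 2 ^ Q : ℝ≥0) * A.tailMean μ (fun y => ‖u y‖ₑ) x := by
    rw [tsum_neighborSet x fun y => ‖u y‖ₑ, h.tailMean_eq, ← mul_assoc, ← ENNReal.tsum_mul_left]
    refine ENNReal.tsum_le_tsum fun m => ?_
    rw [← ENNReal.tsum_mul_left]
    refine ENNReal.tsum_le_tsum fun y => ?_
    by_cases hy : (⟨_, y⟩ : A.Vertex) ∈ A.graph.neighborSet x
    · have hadj : A.graph.Adj x ⟨_, y⟩ := hy
      rw [Set.indicator_of_mem hy, Set.inter_eq_left.2 (vball_subset_of_adj hadj)]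
      set n := μ (A.vball ⟨_, y⟩) with hn
      set a := μ (A.vball x) with ha
      have hl := abs_le.1 hadj.2.2
      simp only at hl
      have han : a ≤ (K * 2 ^ Q : ℝ≥0) * n := by
        have hyx : dist (x.2 : Z) y ≤ 16 * 2 ^ (-x.1) := by
          have h1 : dist (y : Z) x.2 < 8 * 2 ^ (-x.1) :=
            vball_subset_of_adj hadj (A.mem_vball_self ⟨_, y⟩)
          have h2 : (0 : ℝ) < 2 ^ (-x.1) := by positivity
          rw [dist_comm]
          linarith
        have h1 := hK x.2 y x.1 (x.1 - 1 + m) (by lia) hyx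
        refine (measure_mono (Metric.ball_subset_ball ?_)).trans (h1.trans ?_)
        · have h2 : (0 : ℝ) < 2 ^ (-x.1) := by positivity
          linarith
        · have h3 : ((x.1 - 1 + m : ℤ) : ℝ) - x.1 ≤ 1 := by
            rw [sub_le_iff_le_add']
            exact_mod_cast (by lia : x.1 - 1 + (m : ℤ) ≤ x.1 + 1)
          have h4 : (2 : ℝ≥0∞) ^ ((((x.1 - 1 + m : ℤ) : ℝ) - x.1) * Q) ≤ 2 ^ Q :=
            ENNReal.rpow_le_rpow_of_exponent_le (by norm_num) (by nlinarith [h.Q_pos])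
          rw [ENNReal.coe_mul, ENNReal.coe_rpow_of_ne_zero (by norm_num)]
          exact mul_le_mul_left (mul_le_mul_right h4 _) _
      calc ‖u ⟨_, y⟩‖ₑ = a⁻¹ * a * ‖u ⟨_, y⟩‖ₑ := by
            rw [ENNReal.inv_mul_cancel (h.vball_ne_zero A x) (h.vball_ne_top A x), one_mul]
        _ ≤ a⁻¹ * ((K * 2 ^ Q : ℝ≥0) * n) * ‖u ⟨_, y⟩‖ₑ := by gcongr
        _ = _ := by ring
    · rw [Set.indicator_of_notMem hy]
      exact zero_le
  have hdeg : ∑' _ : A.graph.neighborSet x, ‖u x‖ₑ ≤ (3 * N : ℝ≥0) * ‖u x‖ₑ := by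
    rw [tsum_neighborSet x fun _ => ‖u x‖ₑ, tsum_eq_sum (s := Finset.range 3)]
    · calc _ ≤ ∑ m ∈ Finset.range 3, (N : ℝ≥0∞) * ‖u x‖ₑ := by
            refine Finset.sum_le_sum fun m _ => hN _ (x.2 : Z) _ _ (fun y hy => ?_) fun y => ?_
            · have hmem : (⟨_, y⟩ : A.Vertex) ∈ A.graph.neighborSet x :=
                Set.mem_of_indicator_ne_zero hy
              have hadj : A.graph.Adj x ⟨_, y⟩ := hmem
              have h1 : dist (y : Z) x.2 < 8 * 2 ^ (-x.1) :=
                vball_subset_of_adj hadj (A.mem_vball_self ⟨_, y⟩)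
              have hl := abs_le.1 hadj.2.2
              simp only at hl
              have h4 : (2 : ℝ) ^ (-x.1) ≤ 2 * 2 ^ (-(x.1 - 1 + m)) := by
                rw [← zpow_one_add₀ (by norm_num)]
                exact zpow_le_zpow_right₀ (by norm_num) (by lia)
              have h5 : (0 : ℝ) < 2 ^ (-(x.1 - 1 + m)) := by positivity
              rw [dist_comm]
              linarith
            · exact Set.indicator_le_self _ _ _
        _ = _ := by
            simp only [Finset.sum_const, Finset.card_range, nsmul_eq_mul]
            push_cast
            ring
    · intro m hm
      rw [ENNReal.tsum_eq_zero]
      intro y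
      refine Set.indicator_of_notMem (fun hy => hm ?_) _
      have hadj : A.graph.Adj x ⟨_, y⟩ := hy
      have hl := abs_le.1 hadj.2.2
      simp only at hl
      rw [Finset.mem_range]
      lia
  calc A.gradNorm u x ≤ ∑' y : A.graph.neighborSet x, (‖u y‖ₑ + ‖u x‖ₑ) :=
        (gradNorm_le_tsum u x).trans (ENNReal.tsum_le_tsum fun y => enorm_sub_le)
    _ = ∑' y : A.graph.neighborSet x, ‖u y‖ₑ + ∑' _ : A.graph.neighborSet x, ‖u x‖ₑ :=
        ENNReal.tsum_add
    _ ≤ (K * 2 ^ Q : ℝ≥0) * A.tailMean μ (fun y => ‖u y‖ₑ) x +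
        (3 * N : ℝ≥0) * A.tailMean μ (fun y => ‖u y‖ₑ) x := by
        gcongr
        exact hdeg.trans (by gcongr; exact h.le_tailMean (fun y => ‖u y‖ₑ) x)
    _ = _ := by rw [← add_mul, ← ENNReal.coe_add]

/-- `I^s_{p,q}(X)` embeds in the space of sequences with gradient in `I^s_{p,q}(X)`. -/
theorem exists_seqNorm_gradNorm_le (h : PolyDoubling μ C Q) (A : HyperbolicFilling Z)
    {s : ℝ} {p q : ℝ≥0∞} (hs : 0 < s) (hp : ENNReal.ofReal (Q / (Q + s)) < p) (hq : 0 < q) :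
    ∃ K : ℝ≥0, ∀ u : A.Vertex → ℂ,
      A.seqNorm μ s p q (A.gradNorm u) ≤ K * A.seqNorm μ s p q (fun x => ‖u x‖ₑ) := by
  obtain ⟨K, hK⟩ := h.exists_gradNorm_le_tailMean A
  obtain ⟨K', hK'⟩ := h.exists_seqNorm_tailMean_le A hs hp hq
  refine ⟨K * K', fun u => (A.seqNorm_le_mul μ s p q K (hK u)).trans ?_⟩
  rw [ENNReal.coe_mul, mul_assoc]
  gcongr
  exact hK' _

/-- The single term `w(x) χ_{B(x)}` already has norm `c * w x`, and `c` is neither zero nor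
infinite. -/
theorem exists_apply_le_seqNorm (h : PolyDoubling μ C Q) (A : HyperbolicFilling Z)
    (s : ℝ) {p q : ℝ≥0∞} (hp : p ≠ 0) (hq : q ≠ 0) (x : A.Vertex) :
    ∃ K : ℝ≥0, ∀ w : A.Vertex → ℝ≥0∞, w x ≤ K * A.seqNorm μ s p q w := by
  set c : ℝ≥0∞ := 2 ^ ((x.1 : ℝ) * s) * μ (A.vball x) ^ (1 / p.toReal) with hc
  have hc0 : c ≠ 0 := mul_ne_zero
    (ENNReal.rpow_pos (by norm_num) ENNReal.ofNat_ne_top).ne'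
    (ENNReal.rpow_pos (pos_iff_ne_zero.2 (h.vball_ne_zero A x)) (h.vball_ne_top A x)).ne'
  have hct : c ≠ ∞ := ENNReal.mul_ne_top
    (ENNReal.rpow_ne_top_of_ne_zero (by norm_num) (by norm_num))
    (ENNReal.rpow_ne_top_of_ne_zero (h.vball_ne_zero A x) (h.vball_ne_top A x))
  refine ⟨c⁻¹.toNNReal, fun w => ?_⟩
  rw [ENNReal.coe_toNNReal (ENNReal.inv_ne_top.2 hc0)]
  have h1 : c * w x ≤ A.seqNorm μ s p q w := by
    refine le_trans ?_ (enorm_le_eLpNorm_count _ x.1 hq)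
    rw [enorm_eq_self, hc, mul_assoc]
    gcongr
    have h2 := eLpNorm_indicator_const' (μ := μ) (p := p) (c := w x)
      (A.isOpen_vball x).measurableSet (h.vball_ne_zero A x) hp
    rw [enorm_eq_self] at h2
    rw [mul_comm, ← h2]
    refine eLpNorm_mono_enorm fun ζ => ?_
    rw [enorm_eq_self, enorm_eq_self]
    exact Set.indicator_apply_le fun hζ => le_levelSum (x := x.2) hζ
  calc w x = c⁻¹ * (c * w x) := by rw [← mul_assoc, ENNReal.inv_mul_cancel hc0 hct, one_mul]
    _ ≤ _ := by gcongr

/-- Since the graph is connected, differences of values are controlled by the gradient. -/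
theorem exists_enorm_sub_le_seqNorm (h : PolyDoubling μ C Q) (A : HyperbolicFilling Z)
    (s : ℝ) {p q : ℝ≥0∞} (hp : p ≠ 0) (hq : q ≠ 0) (x y : A.Vertex) :
    ∃ K : ℝ≥0, ∀ u : A.Vertex → ℂ, ‖u x - u y‖ₑ ≤ K * A.seqNorm μ s p q (A.gradNorm u) := by
  have hr := SimpleGraph.reachable_iff_reflTransGen _ _ |>.1 (reachable y x)
  induction hr with
  | refl => exact ⟨0, fun u => by simp⟩
  | @tail a b _ hab ih =>
    obtain ⟨K, hK⟩ := ih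
    obtain ⟨K', hK'⟩ := h.exists_apply_le_seqNorm A s hp hq a
    refine ⟨K + K', fun u => ?_⟩
    calc ‖u b - u y‖ₑ = ‖(u a - u y) + (u b - u a)‖ₑ := by ring_nf
      _ ≤ ‖u a - u y‖ₑ + ‖u b - u a‖ₑ := enorm_add_le _ _
      _ ≤ K * A.seqNorm μ s p q (A.gradNorm u) + K' * A.seqNorm μ s p q (A.gradNorm u) :=
        add_le_add (hK u) ((enorm_sub_le_gradNorm u hab).trans (hK' _))
      _ = _ := by rw [← add_mul, ENNReal.coe_add]

/-- Makes it harmless to change a sequence at one vertex, as is done for the normalisation at `x₀`.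
-/
theorem seqNorm_single_lt_top (h : PolyDoubling μ C Q) {A : HyperbolicFilling Z}
    (s : ℝ) {p q : ℝ≥0∞} (hp : p ≠ 0) (hq : q ≠ 0) (x₀ : A.Vertex) (c : ℝ≥0∞) (hc : c ≠ ∞)
    [DecidableEq A.Vertex] :
    A.seqNorm μ s p q (Pi.single x₀ c) < ∞ := by
  have h1 : ∀ k, A.levelSum (Pi.single x₀ c) k =
      if k = x₀.1 then (A.vball x₀).indicator fun _ => c else 0 := by
    intro k
    funext ζ
    split_ifs with hk
    · subst hk
      unfold levelSum
      rw [tsum_eq_single x₀.2]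
      · simp
      · intro y hy
        obtain ⟨k₀, y₀⟩ := x₀
        have : (⟨k₀, y⟩ : A.Vertex) ≠ ⟨k₀, y₀⟩ := fun he => hy (by simpa using he)
        simp [this]
    · unfold levelSum
      rw [Pi.zero_apply, ENNReal.tsum_eq_zero]
      intro y
      have : (⟨k, y⟩ : A.Vertex) ≠ x₀ := fun he => hk (by rw [← he])
      simp [this]
  set M := (2 : ℝ≥0∞) ^ ((x₀.1 : ℝ) * s) * eLpNorm ((A.vball x₀).indicator fun _ => c) p μ with hM
  have h2 : (fun k : ℤ => (2 : ℝ≥0∞) ^ ((k : ℝ) * s) *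
      eLpNorm (A.levelSum (Pi.single x₀ c) k) p μ) = Set.indicator {x₀.1} fun _ => M := by
    funext k
    rw [h1 k]
    by_cases hk : k = x₀.1
    · subst hk
      simp [hM]
    · simp [hk]
  unfold seqNorm
  rw [h2, eLpNorm_indicator_const' (measurableSet_singleton _) (by simp) hq, enorm_eq_self, hM,
    eLpNorm_indicator_const' (A.isOpen_vball x₀).measurableSet (h.vball_ne_zero A x₀) hp,
    enorm_eq_self]
  refine ENNReal.mul_lt_top (ENNReal.mul_lt_top ?_ (ENNReal.mul_lt_top hc.lt_top ?_)) ?_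
  · exact (ENNReal.rpow_ne_top_of_ne_zero (by norm_num) (by norm_num)).lt_top
  · exact (ENNReal.rpow_ne_top_of_ne_zero (h.vball_ne_zero A x₀) (h.vball_ne_top A x₀)).lt_top
  · simp

/-- Fatou's lemma for `I^s_{p,q}(X)`. -/
theorem seqNorm_liminf_le (h : PolyDoubling μ C Q) {A : HyperbolicFilling Z}
    (s : ℝ) (p q : ℝ≥0∞) (w : ℕ → A.Vertex → ℝ≥0∞) :
    A.seqNorm μ s p q (fun x => liminf (fun n => w n x) atTop) ≤
      liminf (fun n => A.seqNorm μ s p q (w n)) atTop := by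
  unfold seqNorm
  refine le_trans ?_ (eLpNorm_liminf_le q fun n => measurable_of_countable _)
  refine eLpNorm_mono_enorm fun k => ?_
  rw [enorm_eq_self, enorm_eq_self]
  have hk : (2 : ℝ≥0∞) ^ ((k : ℝ) * s) ≠ ∞ :=
    ENNReal.rpow_ne_top_of_ne_zero (by norm_num) (by norm_num)
  rw [ENNReal.liminf_const_mul_of_ne_top hk]
  gcongr
  refine le_trans ?_ (eLpNorm_liminf_le p fun n => A.measurable_levelSum _ _)
  refine eLpNorm_mono_enorm fun ζ => ?_
  rw [enorm_eq_self, enorm_eq_self]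
  have := h.countable_net A k
  unfold levelSum
  refine le_trans (ENNReal.tsum_le_tsum fun x => ?_) (ENNReal.tsum_liminf_le _)
  by_cases hx : ζ ∈ A.vball ⟨k, x⟩ <;> simp [hx]

theorem countable_vertex (h : PolyDoubling μ C Q) (A : HyperbolicFilling Z) :
    Countable A.Vertex := by
  have := h.countable_net A
  infer_instance

/-- Fatou for the sum over neighbours; no finiteness of the degree is needed. -/
theorem gradNorm_le_liminf (h : PolyDoubling μ C Q) {A : HyperbolicFilling Z}
    {u : ℕ → A.Vertex → ℂ} {v : A.Vertex → ℂ}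
    (hu : ∀ x, Tendsto (fun n => u n x) atTop (𝓝 (v x))) (x : A.Vertex) :
    A.gradNorm v x ≤ liminf (fun n => A.gradNorm (u n) x) atTop := by
  have := h.countable_vertex A
  unfold gradNorm
  rw [← ENNReal.liminf_rpow _ (by norm_num)]
  gcongr
  refine le_trans (le_of_eq (tsum_congr fun y => ?_)) (ENNReal.tsum_liminf_le _)
  have h1 : Tendsto (fun n => ‖u n y - u n x‖ₑ ^ 2) atTop (𝓝 (‖v y - v x‖ₑ ^ 2)) :=
    (ENNReal.continuous_pow 2).tendsto _ |>.comp ((hu y).sub (hu x)).enorm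
  exact h1.liminf_eq.symm

end PolyDoubling

/-! ### Traces -/

theorem tendsto_atTop_int_of_nat {α : Type*} {l : Filter α} {F : ℤ → α} (n₀ : ℤ)
    (h : Tendsto (fun m : ℕ => F (n₀ + m)) atTop l) : Tendsto F atTop l := by
  have h1 : Tendsto (fun n : ℤ => (n - n₀).toNat) atTop atTop :=
    tendsto_atTop_atTop.2 fun b => ⟨n₀ + b, fun a ha => by lia⟩
  refine (h.comp h1).congr' ?_
  filter_upwards [eventually_ge_atTop n₀] with n hn
  simp only [Function.comp_apply]
  congr 1
  lia

namespace HyperbolicFilling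

/-- `tailSum` at `n + 1` begins with level `n`, which is where telescoping from `T n` begins. -/
theorem tsum_two_mul_levelSum {Z : Type*} [MetricSpace Z] {A : HyperbolicFilling Z}
    (w : A.Vertex → ℝ≥0∞) (n : ℤ) (ζ : Z) :
    ∑' m : ℕ, 2 * A.levelSum w (n + m) ζ = 2 * A.tailSum w (n + 1) ζ := by
  rw [ENNReal.tsum_mul_left]
  unfold tailSum
  simp only [add_sub_cancel_right]

end HyperbolicFilling

namespace PolyDoubling

open HyperbolicFilling

variable {Z : Type*} [MetricSpace Z] [MeasurableSpace Z] {μ : Measure Z} {C Q : ℝ}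
  {A : HyperbolicFilling Z}

theorem setLIntegral_tailSum_lt_top (h : PolyDoubling μ C Q) {w : A.Vertex → ℝ≥0∞} {x : A.Vertex}
    (hw : A.tailMean μ w x < ∞) : ∫⁻ ζ in A.vball x, A.tailSum w x.1 ζ ∂μ < ∞ := by
  refine lt_top_iff_ne_top.2 fun htop => ?_
  have h2 := (setLIntegral_vball_le μ w x).trans_lt hw
  rw [htop, ENNReal.mul_top (ENNReal.inv_ne_zero.2 (h.vball_ne_top A x))] at h2
  exact lt_irrefl _ h2

theorem enorm_sub_poisson_le (h : PolyDoubling μ C Q) {f : Z → ℂ} (hf : LocIntegrable μ f)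
    (x : A.Vertex) (c : ℂ) :
    ‖c - A.poisson μ f x‖ₑ ≤ (μ (A.vball x))⁻¹ * ∫⁻ ζ in A.vball x, ‖c - f ζ‖ₑ ∂μ := by
  have hc : IntegrableOn (fun _ => c) (A.vball x) μ := integrableOn_const (h.vball_ne_top A x)
  have h1 : c - A.poisson μ f x = ⨍ ζ in A.vball x, (c - f ζ) ∂μ := by
    have h2 := setAverage_const (h.vball_ne_zero A x) (h.vball_ne_top A x) c
    rw [setAverage_eq, integral_sub hc (hf _ Metric.isBounded_ball), smul_sub,
      ← setAverage_eq μ (fun _ => c), h2, poisson, setAverage_eq]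
  rw [h1, setAverage_eq, enorm_smul]
  gcongr
  · rw [Measure.real, Real.enorm_eq_ofReal (by positivity), ENNReal.ofReal_inv_of_pos
      (ENNReal.toReal_pos (h.vball_ne_zero A x) (h.vball_ne_top A x)),
      ENNReal.ofReal_toReal (h.vball_ne_top A x)]
  · exact enorm_integral_le_lintegral_enorm _

variable [BorelSpace Z]

theorem summable_T (h : PolyDoubling μ C Q) (Ψ : A.LipPartition) (n : ℤ) (u : A.Vertex → ℂ)
    (ζ : Z) : Summable fun x : A.net n => u ⟨n, x⟩ * (Ψ.ψ ⟨n, x⟩ ζ : ℂ) := by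
  refine summable_of_hasFiniteSupport ((h.finite_near A n ζ 1).subset fun x hx => ?_)
  have h1 : Ψ.ψ ⟨n, x⟩ ζ ≠ 0 := fun h0 => hx (by simp [h0])
  have h2 : dist ζ x < 2 ^ (-n) := Ψ.support_subset ⟨n, x⟩ h1
  simpa using h2

/-- `T_n u(ζ)` is a convex combination of the values of `u` at vertices whose ball contains `ζ`. -/
theorem enorm_T_sub_le (h : PolyDoubling μ C Q) (Ψ : A.LipPartition) {n : ℤ} {u : A.Vertex → ℂ}
    {ζ : Z} {c : ℂ} {M : ℝ≥0∞} (hM : ∀ y : A.net n, ζ ∈ A.vball ⟨n, y⟩ → ‖u ⟨n, y⟩ - c‖ₑ ≤ M) :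
    ‖Ψ.T n u ζ - c‖ₑ ≤ M := by
  have h1 : HasSum (fun x : A.net n => c * (Ψ.ψ ⟨n, x⟩ ζ : ℂ)) c := by
    have := (Complex.hasSum_ofReal.2 (Ψ.hasSum_one n ζ)).mul_left c
    simpa using this
  have h2 : Ψ.T n u ζ - c = ∑' x : A.net n, (u ⟨n, x⟩ - c) * (Ψ.ψ ⟨n, x⟩ ζ : ℂ) := by
    unfold LipPartition.T
    nth_rw 1 [← h1.tsum_eq]
    rw [← (h.summable_T Ψ n u ζ).tsum_sub h1.summable]
    simp only [sub_mul]
  rw [h2]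
  calc _ ≤ ∑' x : A.net n, ‖(u ⟨n, x⟩ - c) * (Ψ.ψ ⟨n, x⟩ ζ : ℂ)‖ₑ := enorm_tsum_le_tsum_enorm
    _ ≤ ∑' x : A.net n, M * ENNReal.ofReal (Ψ.ψ ⟨n, x⟩ ζ) := by
        refine ENNReal.tsum_le_tsum fun x => ?_
        have h3 : ‖(Ψ.ψ ⟨n, x⟩ ζ : ℂ)‖ₑ = ENNReal.ofReal (Ψ.ψ ⟨n, x⟩ ζ) := by
          rw [← ofReal_norm, Complex.norm_real, Real.norm_of_nonneg (Ψ.nonneg _ _)]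
        rw [enorm_mul, h3]
        by_cases hx : Ψ.ψ ⟨n, x⟩ ζ = 0
        · simp [hx]
        · gcongr
          exact hM x (Ψ.support_subset ⟨n, x⟩ hx)
    _ = M := by
        rw [ENNReal.tsum_mul_left, ← ENNReal.ofReal_tsum_of_nonneg (fun x => Ψ.nonneg _ _)
          (Ψ.hasSum_one n ζ).summable, (Ψ.hasSum_one n ζ).tsum_eq, ENNReal.ofReal_one, mul_one]

/-- All vertices of level `m` that contribute to `T m` at `ζ` are equal or adjacent to `x`, since
their balls contain `ζ`; each difference is thus at most `gradNorm u x`. -/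
theorem enorm_T_sub_apply_le (h : PolyDoubling μ C Q) (Ψ : A.LipPartition) (u : A.Vertex → ℂ)
    {ζ : Z} {n m : ℤ} {x : A.net n} (hx : ζ ∈ A.vball ⟨n, x⟩) (hm : |n - m| ≤ 1) :
    ‖Ψ.T m u ζ - u ⟨n, x⟩‖ₑ ≤ A.levelSum (A.gradNorm u) n ζ := by
  refine h.enorm_T_sub_le Ψ fun y hy => ?_
  by_cases hne : (⟨n, x⟩ : A.Vertex) = ⟨m, y⟩
  · rw [hne]
    simp
  · exact (enorm_sub_le_gradNorm u (adj_of_mem hx hy hne hm)).trans (le_levelSum hx)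

theorem edist_T_succ_le (h : PolyDoubling μ C Q) (Ψ : A.LipPartition) (u : A.Vertex → ℂ)
    (ζ : Z) (n : ℤ) :
    edist (Ψ.T n u ζ) (Ψ.T (n + 1) u ζ) ≤ 2 * A.levelSum (A.gradNorm u) n ζ := by
  obtain ⟨x, hx⟩ := A.exists_mem_vball n ζ
  refine (edist_triangle_right _ _ (u ⟨n, x⟩)).trans ?_
  rw [two_mul, edist_eq_enorm_sub, edist_eq_enorm_sub]
  exact add_le_add (h.enorm_T_sub_apply_le Ψ u hx (by simp))
    (h.enorm_T_sub_apply_le Ψ u hx (by simp))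

theorem edist_T_add_succ_le (h : PolyDoubling μ C Q) (Ψ : A.LipPartition) (u : A.Vertex → ℂ)
    (ζ : Z) (n : ℤ) (m : ℕ) :
    edist (Ψ.T (n + m) u ζ) (Ψ.T (n + m.succ) u ζ) ≤
      2 * A.levelSum (A.gradNorm u) (n + m) ζ := by
  have := h.edist_T_succ_le Ψ u ζ (n + m)
  rw [add_assoc] at this
  exact_mod_cast this

theorem exists_tendsto_T (h : PolyDoubling μ C Q) (Ψ : A.LipPartition) {u : A.Vertex → ℂ}
    {ζ : Z} {k : ℤ} (hfin : A.tailSum (A.gradNorm u) k ζ ≠ ∞) :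
    ∃ a, Tendsto (fun n : ℤ => Ψ.T n u ζ) atTop (𝓝 a) := by
  have h1 : CauchySeq fun m : ℕ => Ψ.T (k + m) u ζ := by
    refine cauchySeq_of_edist_le_of_tsum_ne_top _ (h.edist_T_add_succ_le Ψ u ζ k) ?_
    rw [tsum_two_mul_levelSum]
    exact ENNReal.mul_ne_top ENNReal.ofNat_ne_top
      (ne_top_of_le_ne_top hfin (tailSum_anti _ (by lia) ζ))
  obtain ⟨a, ha⟩ := cauchySeq_tendsto_of_complete h1
  exact ⟨a, tendsto_atTop_int_of_nat k ha⟩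

theorem enorm_T_sub_lim_le (h : PolyDoubling μ C Q) (Ψ : A.LipPartition) {u : A.Vertex → ℂ}
    {ζ : Z} {a : ℂ} (ha : Tendsto (fun n : ℤ => Ψ.T n u ζ) atTop (𝓝 a)) (n : ℤ) :
    ‖Ψ.T n u ζ - a‖ₑ ≤ 2 * A.tailSum (A.gradNorm u) (n + 1) ζ := by
  have h1 : Tendsto (fun m : ℕ => Ψ.T (n + m) u ζ) atTop (𝓝 a) :=
    ha.comp (tendsto_atTop_add_const_left _ _ tendsto_natCast_atTop_atTop)
  have h2 := edist_le_tsum_of_edist_le_of_tendsto₀ _ (h.edist_T_add_succ_le Ψ u ζ n) h1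
  rw [tsum_two_mul_levelSum, edist_eq_enorm_sub] at h2
  simpa using h2

/-- One step from `u x` to `T |x| u ζ`, then telescoping through the finer levels with constant 2.
Integrating this bound over `B(x)` yields the comparison of `u` with the Poisson extension of its
trace. -/
theorem enorm_apply_sub_lim_le (h : PolyDoubling μ C Q) (Ψ : A.LipPartition) {u : A.Vertex → ℂ}
    {ζ : Z} {a : ℂ} (ha : Tendsto (fun n : ℤ => Ψ.T n u ζ) atTop (𝓝 a)) {x : A.Vertex}
    (hx : ζ ∈ A.vball x) : ‖u x - a‖ₑ ≤ 3 * A.tailSum (A.gradNorm u) x.1 ζ := by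
  have h1 := h.enorm_T_sub_apply_le Ψ u (n := x.1) (m := x.1) (x := x.2) hx (by simp)
  rw [← edist_eq_enorm_sub] at h1 ⊢
  have h2 := h.enorm_T_sub_lim_le Ψ ha x.1
  rw [← edist_eq_enorm_sub] at h2
  calc edist (u x) a ≤ edist (Ψ.T x.1 u ζ) (u x) + edist (Ψ.T x.1 u ζ) a :=
        edist_triangle_left _ _ _
    _ ≤ A.tailSum (A.gradNorm u) x.1 ζ + 2 * A.tailSum (A.gradNorm u) x.1 ζ := by
        gcongr
        · exact h1.trans (levelSum_le_tailSum _ (by lia) ζ)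
        · exact h2.trans (by gcongr; exact tailSum_anti _ (by lia) ζ)
    _ = _ := by ring

theorem measurable_T (h : PolyDoubling μ C Q) (Ψ : A.LipPartition) (n : ℤ) (u : A.Vertex → ℂ) :
    Measurable (Ψ.T n u) := by
  have := h.countable_net A n
  obtain ⟨L, hL⟩ := Ψ.lipschitz
  refine measurable_of_tendsto_metrizable' (atTop : Filter (Finset (A.net n)))
    (f := fun S ζ => ∑ x ∈ S, u ⟨n, x⟩ * (Ψ.ψ ⟨n, x⟩ ζ : ℂ)) (fun S => ?_)
    (tendsto_pi_nhds.2 fun ζ => (h.summable_T Ψ n u ζ).hasSum)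
  refine Finset.measurable_sum _ fun x _ => ?_
  exact (Complex.measurable_ofReal.comp (hL ⟨n, x⟩).continuous.measurable).const_mul _

/-- Finite means make the tail sum integrable on every ball `B(x)`; there are countably many
vertices and the balls of each level cover `Z`. -/
theorem ae_tailSum_lt_top (h : PolyDoubling μ C Q) {w : A.Vertex → ℝ≥0∞}
    (hw : ∀ x, A.tailMean μ w x < ∞) : ∀ᵐ ζ ∂μ, ∀ k, A.tailSum w k ζ < ∞ := by
  have := h.countable_vertex A
  have h1 : ∀ x : A.Vertex, ∀ᵐ ζ ∂μ, ζ ∈ A.vball x → A.tailSum w x.1 ζ < ∞ := by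
    intro x
    rw [← ae_restrict_iff' (A.isOpen_vball x).measurableSet]
    exact ae_lt_top (A.measurable_tailSum w x.1) (h.setLIntegral_tailSum_lt_top (hw x)).ne
  filter_upwards [ae_all_iff.2 h1] with ζ hζ k
  obtain ⟨x, hx⟩ := A.exists_mem_vball k ζ
  exact hζ ⟨k, x⟩ hx

/-- Existence of traces. -/
theorem exists_isTrace (h : PolyDoubling μ C Q) (Ψ : A.LipPartition) {u : A.Vertex → ℂ}
    (hu : ∀ x, A.tailMean μ (A.gradNorm u) x < ∞) : ∃ f, Ψ.IsTrace μ u f := by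
  have hae := h.ae_tailSum_lt_top hu
  classical
  -- The value 0 where no limit exists is irrelevant, as this happens on a null set only.
  set f : Z → ℂ := fun ζ => if hζ : ∃ a, Tendsto (fun n : ℤ => Ψ.T n u ζ) atTop (𝓝 a) then
    hζ.choose else 0 with hf
  have hlim : ∀ᵐ ζ ∂μ, Tendsto (fun n : ℤ => Ψ.T n u ζ) atTop (𝓝 (f ζ)) := by
    filter_upwards [hae] with ζ hζ
    have h1 := h.exists_tendsto_T Ψ (hζ 0).ne
    simp only [hf, dif_pos h1]
    exact h1.choose_spec
  have hmeas : AEMeasurable f μ :=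
    aemeasurable_of_tendsto_metrizable_ae atTop (fun n => (h.measurable_T Ψ n u).aemeasurable) hlim
  refine ⟨f, fun S hS => ?_, fun S hS => ?_, hlim⟩
  · rcases S.eq_empty_or_nonempty with rfl | ⟨ζ₀, -⟩
    · simp
    obtain ⟨x, hx⟩ := exists_subset_vball (A := A) ζ₀ hS
    refine IntegrableOn.mono_set ⟨hmeas.aestronglyMeasurable.restrict, ?_⟩ hx
    calc ∫⁻ ζ in A.vball x, ‖f ζ‖ₑ ∂μ ≤
          ∫⁻ ζ in A.vball x, (‖u x‖ₑ + 3 * A.tailSum (A.gradNorm u) x.1 ζ) ∂μ := by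
          refine setLIntegral_mono_ae' (A.isOpen_vball x).measurableSet ?_
          filter_upwards [hlim] with ζ hζ hζx
          have h1 := h.enorm_apply_sub_lim_le Ψ hζ hζx
          calc ‖f ζ‖ₑ = ‖u x - (u x - f ζ)‖ₑ := by rw [sub_sub_cancel]
            _ ≤ _ := enorm_sub_le.trans (by gcongr)
      _ < ∞ := by
          rw [lintegral_add_left measurable_const, setLIntegral_const,
            lintegral_const_mul _ (A.measurable_tailSum _ _)]
          exact ENNReal.add_lt_top.2 ⟨ENNReal.mul_lt_top enorm_lt_top (h.lt_top _ _),
            ENNReal.mul_lt_top ENNReal.ofNat_lt_top (h.setLIntegral_tailSum_lt_top (hu x))⟩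
  · rcases S.eq_empty_or_nonempty with rfl | ⟨ζ₀, -⟩
    · simp
    obtain ⟨x, hx⟩ := exists_subset_vball (A := A) ζ₀ hS
    -- Dominated convergence: the tails decrease to 0 almost everywhere and the one at level `|x|`
    -- is integrable on `B(x)`.
    have h0 : Tendsto (fun n : ℤ => ∫⁻ ζ in A.vball x, 2 * A.tailSum (A.gradNorm u) (n + 1) ζ ∂μ)
        atTop (𝓝 (∫⁻ _ in A.vball x, 0 ∂μ)) := by
      refine tendsto_lintegral_filter_of_dominated_convergence
        (fun ζ => 2 * A.tailSum (A.gradNorm u) x.1 ζ)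
        (.of_forall fun n => (A.measurable_tailSum _ _).const_mul _) ?_ ?_ ?_
      · filter_upwards [eventually_ge_atTop x.1] with n hn
        refine ae_of_all _ fun ζ => ?_
        gcongr
        exact tailSum_anti _ (by lia) ζ
      · rw [lintegral_const_mul _ (A.measurable_tailSum _ _)]
        exact (ENNReal.mul_lt_top ENNReal.ofNat_lt_top
          (h.setLIntegral_tailSum_lt_top (hu x))).ne
      · filter_upwards [ae_restrict_of_ae hae] with ζ hζ
        have h1 := (tendsto_tailSum (hζ 0).ne).comp (tendsto_atTop_add_const_right atTop 1
          tendsto_id)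
        have h2 := ENNReal.Tendsto.const_mul (a := 2) h1 (.inr ENNReal.ofNat_ne_top)
        simpa using h2
    rw [lintegral_zero] at h0
    refine tendsto_of_tendsto_of_tendsto_of_le_of_le tendsto_const_nhds h0
      (fun n => zero_le) fun n => ?_
    refine (lintegral_mono_set hx).trans (lintegral_mono_ae (ae_restrict_of_ae ?_))
    filter_upwards [hlim] with ζ hζ
    exact h.enorm_T_sub_lim_le Ψ hζ n

/-- `u - P(Tr u)` is controlled by the gradient of `u`. -/
theorem enorm_sub_poisson_trace_le (h : PolyDoubling μ C Q) (Ψ : A.LipPartition)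
    {u : A.Vertex → ℂ} {f : Z → ℂ} (hf : Ψ.IsTrace μ u f) (x : A.Vertex) :
    ‖u x - A.poisson μ f x‖ₑ ≤ (3 : ℝ≥0) * A.tailMean μ (A.gradNorm u) x := by
  refine (h.enorm_sub_poisson_le hf.1 x (u x)).trans ?_
  calc _ ≤ (μ (A.vball x))⁻¹ * ∫⁻ ζ in A.vball x, 3 * A.tailSum (A.gradNorm u) x.1 ζ ∂μ := by
        gcongr 1
        refine setLIntegral_mono_ae' (A.isOpen_vball x).measurableSet ?_
        filter_upwards [hf.2.2] with ζ hζ hζx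
        exact h.enorm_apply_sub_lim_le Ψ hζ hζx
    _ = 3 * ((μ (A.vball x))⁻¹ * ∫⁻ ζ in A.vball x, A.tailSum (A.gradNorm u) x.1 ζ ∂μ) := by
        rw [lintegral_const_mul _ (A.measurable_tailSum _ _), mul_left_comm]
    _ ≤ _ := by
        push_cast
        gcongr
        exact setLIntegral_vball_le μ _ x

/-- Being a convex combination, `T n u ζ` is bounded by the tail of the series `∑ levelSum |u| j ζ`,
which converges almost everywhere. -/
theorem ae_tendsto_T_zero (h : PolyDoubling μ C Q) (Ψ : A.LipPartition) {u : A.Vertex → ℂ}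
    (hu : ∀ x, A.tailMean μ (fun x => ‖u x‖ₑ) x < ∞) :
    ∀ᵐ ζ ∂μ, Tendsto (fun n : ℤ => Ψ.T n u ζ) atTop (𝓝 0) := by
  filter_upwards [h.ae_tailSum_lt_top hu] with ζ hζ
  rw [tendsto_iff_edist_tendsto_0]
  refine tendsto_of_tendsto_of_tendsto_of_le_of_le tendsto_const_nhds
    (tendsto_tailSum (hζ 0).ne) (fun n => zero_le) fun n => ?_
  rw [edist_eq_enorm_sub]
  refine h.enorm_T_sub_le Ψ fun y hy => ?_
  rw [sub_zero]
  exact (le_levelSum (w := fun x => ‖u x‖ₑ) hy).trans (levelSum_le_tailSum _ (by lia) ζ)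

/-- `T n (Pf) ζ` is a convex combination of means of `f` over balls `B(y)` containing `ζ`. Such a
ball fills a fixed proportion of the closed ball of radius `2 * 2^(-n)` around `ζ`, so every point
where the mean oscillation `⨍ ‖f - f ζ‖` tends to 0 will do. -/
theorem ae_tendsto_T_poisson (h : PolyDoubling μ C Q) (Ψ : A.LipPartition) {f : Z → ℂ}
    (hf : LocIntegrable μ f) :
    ∀ᵐ ζ ∂μ, Tendsto (fun n : ℤ => Ψ.T n (A.poisson μ f) ζ) atTop (𝓝 (f ζ)) := by
  have hsep := h.separableSpace A
  have := UniformSpace.secondCountable_of_separable Z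
  have hloc : IsLocallyFiniteMeasure μ :=
    ⟨fun ζ => ⟨_, Metric.ball_mem_nhds ζ one_pos, h.lt_top ζ 1⟩⟩
  obtain ⟨K, hK⟩ := h.exists_ball_le
  -- This notion compares closed balls of radii `2ε` and `ε`; passing to open balls in between costs
  -- the dilation 4.
  have hdoub : IsUnifLocDoublingMeasure μ := by
    refine ⟨(C * 4 ^ Q).toNNReal, ?_⟩
    filter_upwards [self_mem_nhdsWithin] with ε hε ζ
    have hε : 0 < ε := hε
    refine (measure_mono (t := Metric.ball ζ (4 * ε))
      (Metric.closedBall_subset_ball (by linarith))).trans ?_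
    refine (h.ball_le ζ ε 4 hε (by norm_num)).trans ?_
    exact mul_le_mul_right (measure_mono Metric.ball_subset_closedBall) _
  have hfl : LocallyIntegrable f μ := fun ζ =>
    ⟨_, Metric.ball_mem_nhds ζ one_pos, hf _ Metric.isBounded_ball⟩
  filter_upwards [IsUnifLocDoublingMeasure.ae_tendsto_average_norm_sub μ hfl 1] with ζ hζ
  have hδ : Tendsto (fun n : ℤ => (2 : ℝ) * 2 ^ (-n)) atTop (𝓝[>] 0) := by
    refine tendsto_nhdsWithin_iff.2 ⟨?_, .of_forall fun n => by
      simp only [Set.mem_Ioi]; positivity⟩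
    refine tendsto_atTop_int_of_nat 0 ?_
    have := (tendsto_pow_atTop_nhds_zero_of_lt_one (by norm_num : (0 : ℝ) ≤ 1 / 2)
      (by norm_num)).const_mul 2
    simpa [one_div, inv_pow] using this
  have h1 := hζ (fun _ : ℤ => ζ) _ hδ (.of_forall fun n => by
    simp only [one_mul]
    exact Metric.mem_closedBall_self (by positivity))
  have h2 : Tendsto (fun n : ℤ => (K : ℝ≥0∞) * ENNReal.ofReal
      (⨍ y in Metric.closedBall ζ (2 * 2 ^ (-n)), ‖f y - f ζ‖ ∂μ)) atTop (𝓝 0) := by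
    have := ENNReal.Tendsto.const_mul (a := K) (ENNReal.tendsto_ofReal h1)
      (.inr ENNReal.coe_ne_top)
    simpa using this
  rw [tendsto_iff_edist_tendsto_0]
  refine tendsto_of_tendsto_of_tendsto_of_le_of_le tendsto_const_nhds h2
    (fun n => zero_le) fun n => ?_
  rw [edist_eq_enorm_sub]
  refine h.enorm_T_sub_le Ψ fun y hy => ?_
  have hy' : dist ζ y < 2 ^ (-n) := hy
  have hn : (0 : ℝ) < 2 ^ (-n) := by positivity
  set D := Metric.closedBall ζ (2 * 2 ^ (-n)) with hD
  have hDt : μ D ≠ ∞ := ne_top_of_le_ne_top (h.lt_top ζ (3 * 2 ^ (-n))).ne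
    (measure_mono (Metric.closedBall_subset_ball (by linarith)))
  have hD0 : μ D ≠ 0 := ((h.pos ζ (2 * 2 ^ (-n)) (by positivity)).trans_le
    (measure_mono Metric.ball_subset_closedBall)).ne'
  have hsub : A.vball ⟨n, y⟩ ⊆ D := fun θ hθ => by
    have h3 : dist θ y < 2 ^ (-n) := hθ
    have h4 := dist_triangle_right θ ζ (y : Z)
    rw [hD, Metric.mem_closedBall]
    linarith
  have hDle : μ D ≤ K * μ (A.vball ⟨n, y⟩) := by
    have h3 := hK ζ y n n (by lia) (by linarith)
    rw [sub_self, zero_mul, ENNReal.rpow_zero, mul_one] at h3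
    exact (measure_mono (Metric.closedBall_subset_ball (by linarith))).trans h3
  have hinv : (μ (A.vball ⟨n, y⟩))⁻¹ ≤ K * (μ D)⁻¹ := by
    rw [ENNReal.inv_le_iff_le_mul (fun _ => h.vball_ne_zero A _)
        (fun h0 => absurd h0 (h.vball_ne_top A _))]
    calc 1 = μ D * (μ D)⁻¹ := (ENNReal.mul_inv_cancel hD0 hDt).symm
      _ ≤ K * μ (A.vball ⟨n, y⟩) * (μ D)⁻¹ := by gcongr
      _ = _ := by ring
  have hav : ENNReal.ofReal (⨍ y in D, ‖f y - f ζ‖ ∂μ) =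
      (μ D)⁻¹ * ∫⁻ y in D, ‖f ζ - f y‖ₑ ∂μ := by
    have hint : Integrable (fun y => f y - f ζ) (μ.restrict D) :=
      (hf _ Metric.isBounded_closedBall).sub (integrableOn_const hDt)
    rw [setAverage_eq, smul_eq_mul, ENNReal.ofReal_mul (by positivity),
      ofReal_integral_norm_eq_lintegral_enorm hint, Measure.real,
      ENNReal.ofReal_inv_of_pos (ENNReal.toReal_pos hD0 hDt), ENNReal.ofReal_toReal hDt]
    simp only [← edist_eq_enorm_sub, edist_comm (f ζ)]
  rw [hav, ← edist_eq_enorm_sub, edist_comm, edist_eq_enorm_sub]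
  calc _ ≤ (μ (A.vball ⟨n, y⟩))⁻¹ * ∫⁻ θ in A.vball ⟨n, y⟩, ‖f ζ - f θ‖ₑ ∂μ :=
        h.enorm_sub_poisson_le hf _ _
    _ ≤ (K * (μ D)⁻¹) * ∫⁻ θ in D, ‖f ζ - f θ‖ₑ ∂μ := by gcongr
    _ = _ := by ring

end PolyDoubling

/-! ### Quotients of quasi-normed spaces -/

section Quotients

variable {V W : Type*} [AddCommGroup V] [Module ℂ V] [AddCommGroup W] [Module ℂ W]

theorem quotNorm_le {N : V → ℝ} (h0 : ∀ v, 0 ≤ N v) (U : Submodule ℂ V) {a : V ⧸ U} {v : V}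
    (hv : U.mkQ v = a) : quotNorm N U a ≤ N v :=
  ciInf_le (f := fun v : {v : V // U.mkQ v = a} => N v) ⟨0, by rintro _ ⟨v, rfl⟩; exact h0 _⟩
      ⟨v, hv⟩

theorem le_quotNorm {N : V → ℝ} (U : Submodule ℂ V) {a : V ⧸ U} {c : ℝ}
    (h : ∀ v, U.mkQ v = a → c ≤ N v) : c ≤ quotNorm N U a := by
  obtain ⟨v, hv⟩ := U.mkQ_surjective a
  have : Nonempty {v : V // U.mkQ v = a} := ⟨⟨v, hv⟩⟩
  exact le_ciInf fun v => h v.1 v.2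

theorem quotNorm_nonneg {N : V → ℝ} (h0 : ∀ v, 0 ≤ N v) (U : Submodule ℂ V) (a : V ⧸ U) :
    0 ≤ quotNorm N U a := le_quotNorm U fun v _ => h0 v

theorem quotNorm_mkQ_of_invariant {N : V → ℝ} (U : Submodule ℂ V) (h0 : ∀ v, 0 ≤ N v)
    (h : ∀ v w, v - w ∈ U → N v = N w) (v : V) : quotNorm N U (U.mkQ v) = N v := by
  refine le_antisymm (quotNorm_le h0 U rfl) (le_quotNorm U fun w hw => ?_)
  exact (h v w ((Submodule.Quotient.eq U).1 hw.symm)).le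

theorem exists_lt_of_quotNorm_lt {N : V → ℝ} (U : Submodule ℂ V) {a : V ⧸ U} {c : ℝ}
    (h : quotNorm N U a < c) : ∃ v, U.mkQ v = a ∧ N v < c := by
  by_contra! hcon
  exact absurd h (not_lt.2 (le_quotNorm U hcon))

/-- Definiteness is an assumption: it reflects closedness of `U`, and here it is carried over from
the function side by `eq_zero_of_equivNorms`. -/
theorem isQuasiNorm_quotNorm {N : V → ℝ} (U : Submodule ℂ V) (h0 : ∀ v, 0 ≤ N v)
    (hsmul : ∀ (c : ℂ) v, N (c • v) = ‖c‖ * N v) {K : ℝ} (hK : 0 ≤ K)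
    (hadd : ∀ v w, N (v + w) ≤ K * (N v + N w)) (hdef : ∀ a, quotNorm N U a = 0 → a = 0) :
    IsQuasiNorm (quotNorm N U) := by
  have hN0 : N 0 = 0 := by simpa using hsmul 0 0
  have hle : ∀ (c : ℂ) a, quotNorm N U (c • a) ≤ ‖c‖ * quotNorm N U a := by
    intro c a
    rcases eq_or_ne c 0 with rfl | hc
    · rw [zero_smul, norm_zero, zero_mul]
      exact (quotNorm_le h0 U (map_zero _)).trans hN0.le
    · have hc' : 0 < ‖c‖ := norm_pos_iff.2 hc
      rw [← div_le_iff₀' hc']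
      refine le_quotNorm U fun v hv => ?_
      rw [div_le_iff₀' hc', ← hsmul]
      exact quotNorm_le h0 U (by rw [map_smul, hv])
  refine ⟨quotNorm_nonneg h0 U, fun a => ⟨hdef a, ?_⟩, fun c a => ?_, K, fun a b => ?_⟩
  · rintro rfl
    exact le_antisymm ((quotNorm_le h0 U (map_zero _)).trans hN0.le) (quotNorm_nonneg h0 U _)
  · refine le_antisymm (hle c a) ?_
    rcases eq_or_ne c 0 with rfl | hc
    · rw [norm_zero, zero_mul]
      exact quotNorm_nonneg h0 U _
    · have h1 := hle c⁻¹ (c • a)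
      rw [smul_smul, inv_mul_cancel₀ hc, one_smul, norm_inv] at h1
      rwa [← div_eq_inv_mul, le_div_iff₀' (norm_pos_iff.2 hc)] at h1
  · refine le_of_forall_pos_lt_add fun ε hε => ?_
    have hε' : 0 < ε / (2 * (K + 1)) := by positivity
    obtain ⟨v, hv, hv'⟩ := exists_lt_of_quotNorm_lt U (lt_add_of_pos_right (quotNorm N U a) hε')
    obtain ⟨w, hw, hw'⟩ := exists_lt_of_quotNorm_lt U (lt_add_of_pos_right (quotNorm N U b) hε')
    calc quotNorm N U (a + b) ≤ N (v + w) := quotNorm_le h0 U (by rw [map_add, hv, hw])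
      _ ≤ K * (N v + N w) := hadd v w
      _ ≤ K * (quotNorm N U a + ε / (2 * (K + 1)) + (quotNorm N U b + ε / (2 * (K + 1)))) := by
          gcongr
      _ = K * (quotNorm N U a + quotNorm N U b) + K / (K + 1) * ε := by
          field_simp
          ring
      _ < _ := by
          have : K / (K + 1) < 1 := (div_lt_one (by positivity)).2 (by linarith)
          nlinarith

/-- A linear map inducing an isomorphism of quotients. -/
theorem exists_quotient_equiv (U : Submodule ℂ V) (Y : Submodule ℂ W) (P : W →ₗ[ℂ] V)
    (hker : ∀ f, P f ∈ U ↔ f ∈ Y) (hsurj : ∀ v, ∃ f, v - P f ∈ U) :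
    ∃ Φ : (V ⧸ U) ≃ₗ[ℂ] (W ⧸ Y), ∀ v f, v - P f ∈ U → Φ (U.mkQ v) = Y.mkQ f := by
  have hk : Y = LinearMap.ker (U.mkQ ∘ₗ P) := by
    ext f
    simp [← hker]
  have hs : Function.Surjective (U.mkQ ∘ₗ P) := by
    intro a
    obtain ⟨v, rfl⟩ := U.mkQ_surjective a
    obtain ⟨f, hf⟩ := hsurj v
    exact ⟨f, ((Submodule.Quotient.eq U).2 hf).symm⟩
  refine ⟨((Submodule.quotEquivOfEq _ _ hk).trans
    ((U.mkQ ∘ₗ P).quotKerEquivOfSurjective hs)).symm, fun v f hvf => ?_⟩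
  rw [LinearEquiv.symm_apply_eq]
  exact (Submodule.Quotient.eq U).2 hvf

/-- In the application `P` is a normalised Poisson extension and `v - P f ∈ U` says that `f`
represents the trace of `v`. Bounding `N' f` by every representative `v` bounds it by their infimum;
`P f` is one representative, which gives the other direction. -/
theorem equivNorms_quotNorm {U : Submodule ℂ V} {Y : Submodule ℂ W} {P : W →ₗ[ℂ] V}
    (hsurj : ∀ v, ∃ f, v - P f ∈ U) {Φ : (V ⧸ U) ≃ₗ[ℂ] (W ⧸ Y)}
    (hΦ : ∀ v f, v - P f ∈ U → Φ (U.mkQ v) = Y.mkQ f) {N : V → ℝ} {N' : W → ℝ}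
    (h0 : ∀ v, 0 ≤ N v) (h0' : ∀ f, 0 ≤ N' f) (hinv : ∀ f g, f - g ∈ Y → N' f = N' g)
    {c c' : ℝ} (hc : ∀ v f, v - P f ∈ U → N' f ≤ c * N v) (hc' : ∀ f, N (P f) ≤ c' * N' f) :
    EquivNorms Φ (quotNorm N U) (quotNorm N' Y) := by
  have hM1 : c ≤ max 1 (max c c') := (le_max_left _ _).trans (le_max_right _ _)
  have hM2 : c' ≤ max 1 (max c c') := (le_max_right _ _).trans (le_max_right _ _)
  have hM : 0 < max 1 (max c c') := lt_max_of_lt_left one_pos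
  refine ⟨max 1 (max c c'), hM, fun a => ?_⟩
  obtain ⟨v, rfl⟩ := U.mkQ_surjective a
  obtain ⟨f, hf⟩ := hsurj v
  rw [hΦ v f hf, quotNorm_mkQ_of_invariant Y h0' hinv]
  constructor
  · rw [← div_le_iff₀' hM]
    refine le_quotNorm U fun w hw => ?_
    rw [div_le_iff₀' hM]
    have hwf : w - P f ∈ U := by
      have h1 := U.add_mem ((Submodule.Quotient.eq U).1 hw) hf
      rwa [sub_add_sub_cancel] at h1
    exact (hc w f hwf).trans (mul_le_mul_of_nonneg_right hM1 (h0 w))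
  · refine (quotNorm_le h0 U ((Submodule.Quotient.eq U).2 hf).symm).trans ((hc' f).trans ?_)
    exact mul_le_mul_of_nonneg_right hM2 (h0' f)

theorem eq_zero_of_equivNorms {Φ : V ≃ₗ[ℂ] W} {N : V → ℝ} {N' : W → ℝ} (hΦ : EquivNorms Φ N N')
    (h0' : ∀ f, 0 ≤ N' f) (hdef : ∀ f, N' f = 0 → f = 0) (v : V) (hv : N v = 0) : v = 0 := by
  obtain ⟨c, -, hc⟩ := hΦ
  have h1 := (hc v).1
  rw [hv, mul_zero] at h1
  simpa using hdef _ (le_antisymm h1 (h0' _))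

/-- Completeness passes to the quotient. -/
theorem quotient_complete {U : Submodule ℂ V} {Y : Submodule ℂ W} {P : W →ₗ[ℂ] V}
    (hsurj : ∀ v, ∃ f, v - P f ∈ U) {N : V → ℝ} {N' : W → ℝ}
    (h0' : ∀ f, 0 ≤ N' f) (hinv : ∀ f g, f - g ∈ Y → N' f = N' g)
    {c c' : ℝ} (hc : ∀ v f, v - P f ∈ U → N' f ≤ c * N v) (hc' : ∀ f, N (P f) ≤ c' * N' f)
    (h0 : ∀ v, 0 ≤ N v)
    (hV : ∀ a : ℕ → V, (∀ ε > 0, ∃ M, ∀ m ≥ M, ∀ n ≥ M, N (a m - a n) < ε) →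
      ∃ v, ∀ ε > 0, ∃ M, ∀ n ≥ M, N (a n - v) < ε)
    (b : ℕ → W ⧸ Y) (hb : ∀ ε > 0, ∃ M, ∀ m ≥ M, ∀ n ≥ M, quotNorm N' Y (b m - b n) < ε) :
    ∃ w, ∀ ε > 0, ∃ M, ∀ n ≥ M, quotNorm N' Y (b n - w) < ε := by
  choose f hf using fun n => Y.mkQ_surjective (b n)
  have hM1 : c ≤ max 1 (max c c') := (le_max_left _ _).trans (le_max_right _ _)
  have hM2 : c' ≤ max 1 (max c c') := (le_max_right _ _).trans (le_max_right _ _)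
  have hM : 0 < max 1 (max c c') := lt_max_of_lt_left one_pos
  set M := max 1 (max c c')
  -- `P` is a bounded linear lift, so a Cauchy sequence of classes has Cauchy images in `V`.
  obtain ⟨v, hv⟩ := hV (fun n => P (f n)) fun ε hε => by
    obtain ⟨n₀, hn₀⟩ := hb (ε / M) (by positivity)
    refine ⟨n₀, fun m hm n hn => ?_⟩
    have h1 := hn₀ m hm n hn
    rw [← hf m, ← hf n, ← map_sub, quotNorm_mkQ_of_invariant Y h0' hinv, lt_div_iff₀' hM] at h1
    rw [← map_sub]
    exact ((hc' _).trans (mul_le_mul_of_nonneg_right hM2 (h0' _))).trans_lt h1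
  obtain ⟨g, hg⟩ := hsurj v
  refine ⟨Y.mkQ g, fun ε hε => ?_⟩
  obtain ⟨n₀, hn₀⟩ := hv (ε / M) (by positivity)
  refine ⟨n₀, fun n hn => ?_⟩
  rw [← hf n, ← map_sub, quotNorm_mkQ_of_invariant Y h0' hinv]
  have h1 := hn₀ n hn
  rw [lt_div_iff₀' hM] at h1
  refine ((hc (P (f n) - v) _ ?_).trans (mul_le_mul_of_nonneg_right hM1 (h0 _))).trans_lt h1
  rw [map_sub, sub_sub_sub_cancel_left, ← neg_sub]
  exact U.neg_mem hg

end Quotients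

/-! ### Besov functions and their Poisson extensions -/

namespace HyperbolicFilling

variable {Z : Type*} [MetricSpace Z] [MeasurableSpace Z] [BorelSpace Z] {A : HyperbolicFilling Z}

theorem exists_seqNorm_le_add (A : HyperbolicFilling Z) (μ : Measure Z) (s : ℝ) (p q : ℝ≥0∞)
    (c : ℝ≥0) : ∃ K : ℝ≥0, ∀ v w w' : A.Vertex → ℝ≥0∞, (∀ x, v x ≤ c * (w x + w' x)) →
      A.seqNorm μ s p q v ≤ K * (A.seqNorm μ s p q w + A.seqNorm μ s p q w') := by
  refine ⟨c * ((ENNReal.LpAddConst p).toNNReal * (ENNReal.LpAddConst q).toNNReal),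
    fun v w w' h => (A.seqNorm_le_mul μ s p q c h).trans ?_⟩
  rw [ENNReal.coe_mul, ENNReal.coe_mul, ENNReal.coe_toNNReal (ENNReal.LpAddConst_lt_top p).ne,
    ENNReal.coe_toNNReal (ENNReal.LpAddConst_lt_top q).ne, mul_assoc, mul_assoc]
  gcongr
  exact A.seqNorm_add_le μ s p q w w'

/-- The linear map `f ↦ Pf - Pf(x₀)` from the Besov space to `D̊`. -/
noncomputable def poissonSub (A : HyperbolicFilling Z) (μ : Measure Z) (s : ℝ) (p q : ℝ≥0∞)
    (x₀ : A.Vertex) : A.besov μ s p q →ₗ[ℂ] A.D₀ μ s p q x₀ where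
  toFun f := ⟨fun x => A.poisson μ f.1 x + -A.poisson μ f.1 x₀, by
    refine ⟨?_, add_neg_cancel _⟩
    rw [gradNorm_add_const]
    exact f.2.2⟩
  map_add' f g := by
    refine Subtype.ext (funext fun x => ?_)
    simp only [Submodule.coe_add, A.poisson_add μ f.2.1 g.2.1, Pi.add_apply]
    ring
  map_smul' c f := by
    refine Subtype.ext (funext fun x => ?_)
    simp only [Submodule.coe_smul, A.poisson_smul, Pi.smul_apply, RingHom.id_apply, smul_eq_mul]
    ring

theorem normD_poissonSub {μ : Measure Z} {s : ℝ} {p q : ℝ≥0∞} (x₀ : A.Vertex)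
    (f : A.besov μ s p q) :
    A.normD μ s p q x₀ (A.poissonSub μ s p q x₀ f) = A.besovNorm μ s p q f :=
  congrArg (fun w => (A.seqNorm μ s p q w).toReal) (A.gradNorm_add_const _ _)

theorem normD_nonneg {μ : Measure Z} {s : ℝ} {p q : ℝ≥0∞} {x₀ : A.Vertex}
    (u : A.D₀ μ s p q x₀) : 0 ≤ A.normD μ s p q x₀ u := ENNReal.toReal_nonneg

theorem besovNorm_nonneg {μ : Measure Z} {s : ℝ} {p q : ℝ≥0∞}
    (f : A.besov μ s p q) : 0 ≤ A.besovNorm μ s p q f := ENNReal.toReal_nonneg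

theorem seqNorm_enorm_mul {μ : Measure Z} {s : ℝ} {p q : ℝ≥0∞} (c : ℂ) (w : A.Vertex → ℝ≥0∞) :
    A.seqNorm μ s p q (fun x => ‖c‖ₑ * w x) = ‖c‖ₑ * A.seqNorm μ s p q w := by
  refine le_antisymm (A.seqNorm_le_mul μ s p q ‖c‖₊ fun x => le_rfl) ?_
  rcases eq_or_ne c 0 with rfl | hc
  · simp
  have h1 := A.seqNorm_le_mul μ s p q (w := w) (w' := fun x => ‖c‖ₑ * w x) ‖c⁻¹‖₊ fun x => by
    rw [← enorm_eq_nnnorm, ← mul_assoc, ← enorm_mul, inv_mul_cancel₀ hc]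
    simp
  calc ‖c‖ₑ * A.seqNorm μ s p q w ≤ ‖c‖ₑ * (‖c⁻¹‖ₑ * _) := by gcongr; exact h1
    _ = _ := by rw [← mul_assoc, ← enorm_mul, mul_inv_cancel₀ hc]; simp

theorem normD_smul {μ : Measure Z} {s : ℝ} {p q : ℝ≥0∞} {x₀ : A.Vertex} (c : ℂ)
    (u : A.D₀ μ s p q x₀) : A.normD μ s p q x₀ (c • u) = ‖c‖ * A.normD μ s p q x₀ u := by
  unfold normD
  have h1 : A.gradNorm (c • u).1 = fun x => ‖c‖ₑ * A.gradNorm u.1 x :=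
    funext fun x => A.gradNorm_smul c u.1 x
  rw [h1, seqNorm_enorm_mul, ENNReal.toReal_mul, toReal_enorm]

theorem besovNorm_smul {μ : Measure Z} {s : ℝ} {p q : ℝ≥0∞} (c : ℂ)
    (f : A.besov μ s p q) : A.besovNorm μ s p q (c • f) = ‖c‖ * A.besovNorm μ s p q f := by
  unfold besovNorm
  have h1 : A.gradNorm (A.poisson μ (c • f).1) =
      fun x => ‖c‖ₑ * A.gradNorm (A.poisson μ f.1) x := by
    funext x
    rw [← A.gradNorm_smul c, ← A.poisson_smul]
    rfl
  rw [h1, seqNorm_enorm_mul, ENNReal.toReal_mul, toReal_enorm]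

theorem exists_normD_add_le (A : HyperbolicFilling Z) (μ : Measure Z) (s : ℝ) (p q : ℝ≥0∞)
    (x₀ : A.Vertex) : ∃ K : ℝ, 0 ≤ K ∧ ∀ u v : A.D₀ μ s p q x₀,
      A.normD μ s p q x₀ (u + v) ≤ K * (A.normD μ s p q x₀ u + A.normD μ s p q x₀ v) := by
  obtain ⟨K, hK⟩ := A.exists_seqNorm_le_add μ s p q 2
  refine ⟨K, K.2, fun u v => ?_⟩
  have h1 := hK _ _ _ (A.gradNorm_add_le u.1 v.1)
  have h2 := ENNReal.toReal_mono (ENNReal.mul_ne_top ENNReal.coe_ne_top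
    (ENNReal.add_ne_top.2 ⟨u.2.1.ne, v.2.1.ne⟩)) h1
  rwa [ENNReal.toReal_mul, ENNReal.toReal_add u.2.1.ne v.2.1.ne] at h2

theorem exists_besovNorm_add_le (A : HyperbolicFilling Z) (μ : Measure Z) (s : ℝ) (p q : ℝ≥0∞)
    (x₀ : A.Vertex) : ∃ K : ℝ, 0 ≤ K ∧ ∀ f g : A.besov μ s p q,
      A.besovNorm μ s p q (f + g) ≤ K * (A.besovNorm μ s p q f + A.besovNorm μ s p q g) := by
  obtain ⟨K, hK, h⟩ := A.exists_normD_add_le μ s p q x₀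
  refine ⟨K, hK, fun f g => ?_⟩
  simp only [← normD_poissonSub x₀, map_add]
  exact h _ _

end HyperbolicFilling

namespace PolyDoubling

open HyperbolicFilling

variable {Z : Type*} [MetricSpace Z] [MeasurableSpace Z] {μ : Measure Z} {C Q : ℝ}
  {A : HyperbolicFilling Z} {s : ℝ} {p q : ℝ≥0∞}

theorem locIntegrable_const (h : PolyDoubling μ C Q) (c : ℂ) :
    LocIntegrable μ (fun _ : Z => c) := by
  intro S hS
  rcases S.eq_empty_or_nonempty with rfl | ⟨ξ, -⟩
  · simp
  · obtain ⟨r, hr⟩ := hS.subset_ball ξ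
    exact integrableOn_const ((measure_mono hr).trans_lt (h.lt_top ξ r)).ne

theorem poisson_const (h : PolyDoubling μ C Q) (c : ℂ) :
    A.poisson μ (fun _ => c) = fun _ => c := by
  funext x
  exact setAverage_const (h.vball_ne_zero A x) (h.vball_ne_top A x) c

variable [BorelSpace Z]

theorem exists_tailMean_apply_le (h : PolyDoubling μ C Q) (hs : 0 < s)
    (hp : ENNReal.ofReal (Q / (Q + s)) < p) (hq : 0 < q) (x : A.Vertex) :
    ∃ K : ℝ≥0, ∀ w : A.Vertex → ℝ≥0∞, A.tailMean μ w x ≤ K * A.seqNorm μ s p q w := by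
  obtain ⟨K, hK⟩ := h.exists_seqNorm_tailMean_le A hs hp hq
  obtain ⟨K', hK'⟩ := h.exists_apply_le_seqNorm A s (zero_le.trans_lt hp).ne' hq.ne' x
  refine ⟨K' * K, fun w => (hK' _).trans ?_⟩
  rw [ENNReal.coe_mul, mul_assoc]
  gcongr
  exact hK w

theorem tailMean_lt_top (h : PolyDoubling μ C Q) (hs : 0 < s)
    (hp : ENNReal.ofReal (Q / (Q + s)) < p) (hq : 0 < q) {w : A.Vertex → ℝ≥0∞}
    (hw : A.seqNorm μ s p q w < ∞) (x : A.Vertex) : A.tailMean μ w x < ∞ := by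
  obtain ⟨K, hK⟩ := h.exists_tailMean_apply_le hs hp hq x
  exact (hK w).trans_lt (ENNReal.mul_lt_top ENNReal.coe_lt_top hw)

/-- `u - P(Tr u)` lies in `I^s_{p,q}(X)`, with a bound. -/
theorem exists_seqNorm_sub_poisson_le (h : PolyDoubling μ C Q) (Ψ : A.LipPartition) (hs : 0 < s)
    (hp : ENNReal.ofReal (Q / (Q + s)) < p) (hq : 0 < q) :
    ∃ K : ℝ≥0, ∀ (u : A.Vertex → ℂ) (f : Z → ℂ), Ψ.IsTrace μ u f →
      A.seqNorm μ s p q (fun x => ‖u x - A.poisson μ f x‖ₑ) ≤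
        K * A.seqNorm μ s p q (A.gradNorm u) := by
  obtain ⟨K, hK⟩ := h.exists_seqNorm_tailMean_le A hs hp hq
  refine ⟨3 * K, fun u f hf =>
    (A.seqNorm_le_mul μ s p q 3 (h.enorm_sub_poisson_trace_le Ψ hf)).trans ?_⟩
  rw [ENNReal.coe_mul, mul_assoc]
  gcongr
  exact hK _

/-- Perturbations in `I^s_{p,q}(X)` preserve finiteness of the gradient quasi-norm. Used to replace
`u` by `P(Tr u)` and to reset values at `x₀`. -/
theorem exists_seqNorm_gradNorm_le_add (h : PolyDoubling μ C Q) (A : HyperbolicFilling Z)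
    (hs : 0 < s) (hp : ENNReal.ofReal (Q / (Q + s)) < p) (hq : 0 < q) :
    ∃ K : ℝ≥0, ∀ u v : A.Vertex → ℂ, A.seqNorm μ s p q (A.gradNorm v) ≤
      K * (A.seqNorm μ s p q (A.gradNorm u) + A.seqNorm μ s p q fun x => ‖u x - v x‖ₑ) := by
  obtain ⟨K, hK⟩ := A.exists_seqNorm_le_add μ s p q 2
  obtain ⟨K', hK'⟩ := h.exists_seqNorm_gradNorm_le A hs hp hq
  refine ⟨K * (1 + K'), fun u v => ?_⟩
  have h1 := hK (A.gradNorm v) (A.gradNorm u) (A.gradNorm (v - u)) fun x => by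
    simpa using A.gradNorm_add_le u (v - u) x
  refine h1.trans ?_
  have h2 : (fun x => ‖(v - u) x‖ₑ) = fun x => ‖u x - v x‖ₑ := by
    funext x
    rw [Pi.sub_apply, ← edist_eq_enorm_sub, edist_comm, edist_eq_enorm_sub]
  have h3 := hK' (v - u)
  rw [h2] at h3
  rw [ENNReal.coe_mul, mul_assoc]
  gcongr
  rw [ENNReal.coe_add, ENNReal.coe_one, add_mul, one_mul, mul_add]
  exact add_le_add le_self_add (h3.trans le_add_self)

theorem seqNorm_gradNorm_lt_top_of_sub (h : PolyDoubling μ C Q) (hs : 0 < s)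
    (hp : ENNReal.ofReal (Q / (Q + s)) < p) (hq : 0 < q) {u v : A.Vertex → ℂ}
    (hu : A.seqNorm μ s p q (A.gradNorm u) < ∞)
    (huv : A.seqNorm μ s p q (fun x => ‖u x - v x‖ₑ) < ∞) :
    A.seqNorm μ s p q (A.gradNorm v) < ∞ := by
  obtain ⟨K, hK⟩ := h.exists_seqNorm_gradNorm_le_add A hs hp hq
  exact (hK u v).trans_lt (ENNReal.mul_lt_top ENNReal.coe_lt_top (ENNReal.add_lt_top.2 ⟨hu, huv⟩))

/-- The Besov quasi-norm of a trace is controlled by the gradient. -/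
theorem exists_seqNorm_gradNorm_poisson_le (h : PolyDoubling μ C Q) (Ψ : A.LipPartition)
    (hs : 0 < s) (hp : ENNReal.ofReal (Q / (Q + s)) < p) (hq : 0 < q) :
    ∃ K : ℝ≥0, ∀ (u : A.Vertex → ℂ) (f : Z → ℂ), Ψ.IsTrace μ u f →
      A.seqNorm μ s p q (A.gradNorm (A.poisson μ f)) ≤ K * A.seqNorm μ s p q (A.gradNorm u) := by
  obtain ⟨K, hK⟩ := h.exists_seqNorm_gradNorm_le_add A hs hp hq
  obtain ⟨K', hK'⟩ := h.exists_seqNorm_sub_poisson_le Ψ hs hp hq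
  refine ⟨K * (1 + K'), fun u f hf => (hK u _).trans ?_⟩
  rw [ENNReal.coe_mul, mul_assoc, ENNReal.coe_add, ENNReal.coe_one, add_mul, one_mul]
  gcongr
  exact hK' u f hf

theorem exists_isTrace_mem_besov (h : PolyDoubling μ C Q) (Ψ : A.LipPartition) (hs : 0 < s)
    (hp : ENNReal.ofReal (Q / (Q + s)) < p) (hq : 0 < q) {u : A.Vertex → ℂ}
    (hu : A.seqNorm μ s p q (A.gradNorm u) < ∞) :
    ∃ f ∈ A.besov μ s p q, Ψ.IsTrace μ u f := by
  obtain ⟨f, hf⟩ := h.exists_isTrace Ψ (h.tailMean_lt_top hs hp hq hu)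
  obtain ⟨K, hK⟩ := h.exists_seqNorm_gradNorm_poisson_le Ψ hs hp hq
  exact ⟨f, ⟨hf.1, (hK u f hf).trans_lt (ENNReal.mul_lt_top ENNReal.coe_lt_top hu)⟩, hf⟩

theorem seqNorm_sub_poisson_lt_top (h : PolyDoubling μ C Q) (Ψ : A.LipPartition) (hs : 0 < s)
    (hp : ENNReal.ofReal (Q / (Q + s)) < p) (hq : 0 < q) {u : A.Vertex → ℂ}
    (hu : A.seqNorm μ s p q (A.gradNorm u) < ∞) {f : Z → ℂ} (hf : Ψ.IsTrace μ u f) :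
    A.seqNorm μ s p q (fun x => ‖u x - A.poisson μ f x‖ₑ) < ∞ := by
  obtain ⟨K, hK⟩ := h.exists_seqNorm_sub_poisson_le Ψ hs hp hq
  exact (hK u f hf).trans_lt (ENNReal.mul_lt_top ENNReal.coe_lt_top hu)

/-- `T_n(Pf)` tends to `f` by differentiation, and to 0 because `Pf` lies in `I^s_{p,q}(X)`. -/
theorem ae_eq_zero_of_poisson (h : PolyDoubling μ C Q) (Ψ : A.LipPartition) (hs : 0 < s)
    (hp : ENNReal.ofReal (Q / (Q + s)) < p) (hq : 0 < q) {f : Z → ℂ} (hf : LocIntegrable μ f)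
    (hP : A.seqNorm μ s p q (fun x => ‖A.poisson μ f x‖ₑ) < ∞) : f =ᵐ[μ] 0 := by
  filter_upwards [h.ae_tendsto_T_poisson Ψ hf,
    h.ae_tendsto_T_zero Ψ (h.tailMean_lt_top hs hp hq hP)] with ζ h1 h2
  exact tendsto_nhds_unique h1 h2

theorem ae_eq_const_of_poisson (h : PolyDoubling μ C Q) (Ψ : A.LipPartition) (hs : 0 < s)
    (hp : ENNReal.ofReal (Q / (Q + s)) < p) (hq : 0 < q) {f : Z → ℂ} (hf : LocIntegrable μ f)
    {c : ℂ} (hP : A.seqNorm μ s p q (fun x => ‖A.poisson μ f x - c‖ₑ) < ∞) :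
    f =ᵐ[μ] fun _ => c := by
  have hg : LocIntegrable μ (f + fun _ => -c) := fun S hS =>
    (hf S hS).add (h.locIntegrable_const (-c) S hS)
  have h1 := h.ae_eq_zero_of_poisson Ψ hs hp hq hg (by
    rw [A.poisson_add μ hf (h.locIntegrable_const (-c)), h.poisson_const]
    simpa [sub_eq_add_neg] using hP)
  filter_upwards [h1] with ζ hζ
  simpa [add_neg_eq_zero] using hζ

/-- If the trace vanishes, then `u` is its own difference `u - P(Tr u)`. -/
theorem ae_eq_zero_iff_of_isTrace (h : PolyDoubling μ C Q) (Ψ : A.LipPartition) (hs : 0 < s)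
    (hp : ENNReal.ofReal (Q / (Q + s)) < p) (hq : 0 < q) {u : A.Vertex → ℂ}
    (hu : A.seqNorm μ s p q (A.gradNorm u) < ∞) {f : Z → ℂ} (hf : Ψ.IsTrace μ u f) :
    f =ᵐ[μ] 0 ↔ A.seqNorm μ s p q (fun x => ‖u x‖ₑ) < ∞ := by
  constructor
  · intro h0
    have h1 := h.seqNorm_sub_poisson_lt_top Ψ hs hp hq hu hf
    have h2 : A.poisson μ (0 : Z → ℂ) = fun _ => 0 := h.poisson_const 0
    rw [A.poisson_congr μ h0, h2] at h1
    simpa using h1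
  · intro h0
    filter_upwards [hf.2.2, h.ae_tendsto_T_zero Ψ (h.tailMean_lt_top hs hp hq h0)] with ζ h1 h2
    exact tendsto_nhds_unique h1 h2

theorem I₀_le_D₀ (h : PolyDoubling μ C Q) (hs : 0 < s) (hp : ENNReal.ofReal (Q / (Q + s)) < p)
    (hq : 0 < q) (x₀ : A.Vertex) : A.I₀ μ s p q x₀ ≤ A.D₀ μ s p q x₀ := by
  rintro u ⟨hu, hu0⟩
  obtain ⟨K, hK⟩ := h.exists_seqNorm_gradNorm_le A hs hp hq
  exact ⟨(hK u).trans_lt (ENNReal.mul_lt_top ENNReal.coe_lt_top hu), hu0⟩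

theorem K₀_le_D₀ (h : PolyDoubling μ C Q) (hs : 0 < s) (hp : ENNReal.ofReal (Q / (Q + s)) < p)
    (hq : 0 < q) (x₀ : A.Vertex) : A.K₀ μ s p q x₀ ≤ A.D₀ μ s p q x₀ := by
  rintro u ⟨⟨c, hu⟩, hu0⟩
  obtain ⟨K, hK⟩ := h.exists_seqNorm_gradNorm_le A hs hp hq
  have h1 := (hK fun x => u x - c).trans_lt (ENNReal.mul_lt_top ENNReal.coe_lt_top hu)
  simp only [sub_eq_add_neg, gradNorm_add_const] at h1
  exact ⟨h1, hu0⟩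

/-- `D̊` is complete. -/
theorem D₀_complete (h : PolyDoubling μ C Q) (hp0 : p ≠ 0) (hq0 : q ≠ 0) (x₀ : A.Vertex)
    (u : ℕ → A.D₀ μ s p q x₀)
    (hu : ∀ ε > 0, ∃ M, ∀ m ≥ M, ∀ n ≥ M, A.normD μ s p q x₀ (u m - u n) < ε) :
    ∃ v, ∀ ε > 0, ∃ M, ∀ n ≥ M, A.normD μ s p q x₀ (u n - v) < ε := by
  -- All sequences vanish at `x₀`, so the bound on differences along a path to `x₀` controls the
  -- value at `x`.
  have hcauchy : ∀ x, CauchySeq fun n => (u n).1 x := by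
    intro x
    obtain ⟨K, hK⟩ := h.exists_enorm_sub_le_seqNorm A s hp0 hq0 x x₀
    refine Metric.cauchySeq_iff.2 fun ε hε => ?_
    obtain ⟨M, hM⟩ := hu (ε / (K + 1)) (by positivity)
    refine ⟨M, fun m hm n hn => ?_⟩
    have h1 := hK (u m - u n).1
    rw [(u m - u n).2.2, sub_zero] at h1
    have h2 := ENNReal.toReal_mono (ENNReal.mul_ne_top ENNReal.coe_ne_top (u m - u n).2.1.ne) h1
    rw [toReal_enorm, ENNReal.toReal_mul, ENNReal.coe_toReal] at h2
    have h3 := hM m hm n hn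
    rw [lt_div_iff₀ (by positivity)] at h3
    rw [dist_eq_norm]
    have h4 : 0 ≤ A.normD μ s p q x₀ (u m - u n) := normD_nonneg _
    calc ‖(u m).1 x - (u n).1 x‖ ≤ K * A.normD μ s p q x₀ (u m - u n) := h2
      _ ≤ A.normD μ s p q x₀ (u m - u n) * (K + 1) := by nlinarith
      _ < ε := h3
  choose v hv using fun x => cauchySeq_tendsto_of_complete (hcauchy x)
  -- The Cauchy bound for `u n - u m` survives `m → ∞` by Fatou, for the gradient and then for the
  -- sequence quasi-norm.
  have hbound : ∀ ε > 0, ∃ M, ∀ n ≥ M,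
      A.seqNorm μ s p q (A.gradNorm ((u n).1 - v)) ≤ ENNReal.ofReal ε := by
    intro ε hε
    obtain ⟨M, hM⟩ := hu ε hε
    refine ⟨M, fun n hn => ?_⟩
    have h1 : A.seqNorm μ s p q (A.gradNorm ((u n).1 - v)) ≤ A.seqNorm μ s p q
        fun x => liminf (fun m => A.gradNorm (u n - u m).1 x) atTop := by
      have := A.seqNorm_le_mul μ s p q (w := A.gradNorm ((u n).1 - v))
        (w' := fun x => liminf (fun m => A.gradNorm (u n - u m).1 x) atTop) 1 fun x => by
          rw [ENNReal.coe_one, one_mul]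
          exact h.gradNorm_le_liminf (fun y => (tendsto_const_nhds (x := (u n).1 y)).sub (hv y)) x
      simpa using this
    refine h1.trans ((h.seqNorm_liminf_le s p q _).trans ?_)
    refine liminf_le_of_frequently_le' (Eventually.frequently ?_)
    filter_upwards [eventually_ge_atTop M] with m hm
    rw [← ENNReal.ofReal_toReal (u n - u m).2.1.ne]
    exact ENNReal.ofReal_le_ofReal (hM n hn m hm).le
  have hv0 : v x₀ = 0 :=
    tendsto_nhds_unique (hv x₀) (by simp only [(u _).2.2]; exact tendsto_const_nhds)
  have hvD : A.seqNorm μ s p q (A.gradNorm v) < ∞ := by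
    obtain ⟨M, hM⟩ := hbound 1 one_pos
    refine A.seqNorm_add_lt_top μ s p q 2 (w := A.gradNorm (u M).1)
      (w' := A.gradNorm ((-1 : ℂ) • ((u M).1 - v))) (fun x => ?_) (u M).2.1 ?_
    · simpa using A.gradNorm_add_le (u M).1 ((-1 : ℂ) • ((u M).1 - v)) x
    · have h1 : A.gradNorm ((-1 : ℂ) • ((u M).1 - v)) = A.gradNorm ((u M).1 - v) := by
        funext x
        rw [gradNorm_smul]
        simp
      rw [h1]
      exact (hM M le_rfl).trans_lt ENNReal.ofReal_lt_top
  refine ⟨⟨v, hvD, hv0⟩, fun ε hε => ?_⟩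
  obtain ⟨M, hM⟩ := hbound (ε / 2) (by positivity)
  refine ⟨M, fun n hn => ?_⟩
  have h1 := ENNReal.toReal_mono ENNReal.ofReal_ne_top (hM n hn)
  rw [ENNReal.toReal_ofReal (by positivity)] at h1
  exact lt_of_le_of_lt h1 (by linarith)

end PolyDoubling

/-! ### The trace isomorphisms -/

namespace HyperbolicFilling

theorem norm_poisson_le {Z : Type*} [MetricSpace Z] [MeasurableSpace Z] {μ : Measure Z}
    {A : HyperbolicFilling Z} (f : Z → ℂ) (x : A.Vertex) :
    ‖A.poisson μ f x‖ ≤ (μ.real (A.vball x))⁻¹ * ∫ ζ in A.vball x, ‖f ζ‖ ∂μ := by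
  rw [poisson, setAverage_eq, norm_smul, Real.norm_of_nonneg (by positivity)]
  gcongr
  exact norm_integral_le_integral_norm _

end HyperbolicFilling

namespace PolyDoubling

open HyperbolicFilling

variable {Z : Type*} [MetricSpace Z] [MeasurableSpace Z] [BorelSpace Z] {μ : Measure Z} {C Q : ℝ}
  {A : HyperbolicFilling Z} {s : ℝ} {p q : ℝ≥0∞}

/-- If `u - Pf - c` lies in `I^s_{p,q}(X)`, then the trace of `u` is `f + c`. -/
theorem ae_sub_eq_const_of_isTrace (h : PolyDoubling μ C Q) (Ψ : A.LipPartition) (hs : 0 < s)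
    (hp : ENNReal.ofReal (Q / (Q + s)) < p) (hq : 0 < q) {u : A.Vertex → ℂ}
    (hu : A.seqNorm μ s p q (A.gradNorm u) < ∞) {f g : A.besov μ s p q}
    (hg : Ψ.IsTrace μ u g.1) {c : ℂ}
    (hc : A.seqNorm μ s p q (fun x => ‖u x - A.poisson μ f.1 x - c‖ₑ) < ∞) :
    (g - f).1 =ᵐ[μ] fun _ => c := by
  have hneg : LocIntegrable μ ((-1 : ℂ) • f.1) := ((-1 : ℂ) • f).2.1
  refine h.ae_eq_const_of_poisson (A := A) Ψ hs hp hq (g - f).2.1 ?_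
  have h1 := h.seqNorm_sub_poisson_lt_top Ψ hs hp hq hu hg
  -- `P(g - f) - c` is `(u - Pf - c) - (u - Pg)`, and both terms lie in `I^s_{p,q}(X)`.
  refine A.seqNorm_add_lt_top μ s p q 1 (fun x => ?_) hc h1
  have h2 : (g - f).1 = g.1 + (-1 : ℂ) • f.1 := by
    rw [neg_one_smul, ← sub_eq_add_neg]
    rfl
  rw [h2, A.poisson_add μ g.2.1 hneg, A.poisson_smul, ENNReal.coe_one, one_mul]
  refine le_trans (le_of_eq (congrArg _ ?_)) enorm_sub_le
  simp only [Pi.add_apply, Pi.smul_apply, smul_eq_mul]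
  ring

theorem seqNorm_single_mul (h : PolyDoubling μ C Q) (s : ℝ) (hp : p ≠ 0) (hq : q ≠ 0)
    (x₀ : A.Vertex) : ∃ K : ℝ≥0, ∀ u v : A.Vertex → ℂ, (∀ x ≠ x₀, u x = v x) →
      A.seqNorm μ s p q (fun x => ‖u x - v x‖ₑ) ≤ K * ‖u x₀ - v x₀‖ₑ := by
  classical
  have hfin := h.seqNorm_single_lt_top (A := A) s hp hq x₀ 1 ENNReal.one_ne_top
  refine ⟨(A.seqNorm μ s p q (Pi.single x₀ 1)).toNNReal, fun u v huv => ?_⟩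
  rw [ENNReal.coe_toNNReal hfin.ne, mul_comm]
  refine A.seqNorm_le_mul μ s p q ‖u x₀ - v x₀‖₊ fun x => ?_
  rcases eq_or_ne x x₀ with rfl | hx
  · simp [← enorm_eq_nnnorm]
  · simp [huv x hx]

open Classical in
/-- The linear map sending `f` to its Poisson extension with the value at `x₀` replaced by `0`. -/
noncomputable def poissonVanish (h : PolyDoubling μ C Q) (hs : 0 < s)
    (hp : ENNReal.ofReal (Q / (Q + s)) < p) (hq : 0 < q) (x₀ : A.Vertex) :
    A.besov μ s p q →ₗ[ℂ] A.D₀ μ s p q x₀ where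
  toFun f := ⟨fun x => if x = x₀ then 0 else A.poisson μ f.1 x, by
    refine ⟨?_, if_pos rfl⟩
    obtain ⟨K, hK⟩ := h.seqNorm_single_mul (q := q) s (zero_le.trans_lt hp).ne' hq.ne' x₀
    refine h.seqNorm_gradNorm_lt_top_of_sub hs hp hq f.2.2 ((hK _ _ fun x hx => ?_).trans_lt
      (ENNReal.mul_lt_top ENNReal.coe_lt_top enorm_lt_top))
    rw [if_neg hx]⟩
  map_add' f g := by
    refine Subtype.ext (funext fun x => ?_)
    simp only [Submodule.coe_add, A.poisson_add μ f.2.1 g.2.1, Pi.add_apply]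
    split_ifs <;> simp
  map_smul' c f := by
    refine Subtype.ext (funext fun x => ?_)
    simp only [Submodule.coe_smul, A.poisson_smul, Pi.smul_apply, RingHom.id_apply, smul_eq_mul]
    split_ifs <;> simp

theorem poissonVanish_apply_of_ne (h : PolyDoubling μ C Q) (hs : 0 < s)
    (hp : ENNReal.ofReal (Q / (Q + s)) < p) (hq : 0 < q) {x₀ x : A.Vertex} (hx : x ≠ x₀)
    (f : A.besov μ s p q) :
    (h.poissonVanish hs hp hq x₀ f).1 x = A.poisson μ f.1 x := if_neg hx

theorem seqNorm_poisson_sub_poissonVanish_lt_top (h : PolyDoubling μ C Q) (hs : 0 < s)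
    (hp : ENNReal.ofReal (Q / (Q + s)) < p) (hq : 0 < q) (x₀ : A.Vertex) (f : A.besov μ s p q) :
    A.seqNorm μ s p q
      (fun x => ‖A.poisson μ f.1 x - (h.poissonVanish hs hp hq x₀ f).1 x‖ₑ) < ∞ := by
  obtain ⟨K, hK⟩ := h.seqNorm_single_mul (q := q) s (zero_le.trans_lt hp).ne' hq.ne' x₀
  exact (hK _ _ fun x hx => (h.poissonVanish_apply_of_ne hs hp hq hx f).symm).trans_lt
    (ENNReal.mul_lt_top ENNReal.coe_lt_top enorm_lt_top)

theorem sub_poissonVanish_mem_iff (h : PolyDoubling μ C Q) (hs : 0 < s)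
    (hp : ENNReal.ofReal (Q / (Q + s)) < p) (hq : 0 < q) (x₀ : A.Vertex)
    (u : A.D₀ μ s p q x₀) (f : A.besov μ s p q) :
    u - h.poissonVanish hs hp hq x₀ f ∈ (A.I₀ μ s p q x₀).submoduleOf (A.D₀ μ s p q x₀) ↔
      A.seqNorm μ s p q (fun x => ‖u.1 x - A.poisson μ f.1 x‖ₑ) < ∞ := by
  have h1 := h.seqNorm_poisson_sub_poissonVanish_lt_top hs hp hq x₀ f
  constructor
  · rintro ⟨h2, -⟩
    refine A.seqNorm_add_lt_top μ s p q 1 (fun x => ?_) h2 h1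
    rw [ENNReal.coe_one, one_mul]
    refine le_trans (le_of_eq (congrArg _ ?_)) enorm_sub_le
    show _ = (u.1 x - (h.poissonVanish hs hp hq x₀ f).1 x) - _
    ring
  · intro h2
    refine ⟨A.seqNorm_add_lt_top μ s p q 1 (fun x => ?_) h2 h1,
      (u - h.poissonVanish hs hp hq x₀ f).2.2⟩
    rw [ENNReal.coe_one, one_mul]
    refine le_trans (le_of_eq (congrArg _ ?_)) (enorm_add_le _ _)
    show u.1 x - (h.poissonVanish hs hp hq x₀ f).1 x = _
    ring

theorem sub_poissonSub_mem_iff (x₀ : A.Vertex) (u : A.D₀ μ s p q x₀) (f : A.besov μ s p q) :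
    u - A.poissonSub μ s p q x₀ f ∈ (A.K₀ μ s p q x₀).submoduleOf (A.D₀ μ s p q x₀) ↔
      ∃ c, A.seqNorm μ s p q (fun x => ‖u.1 x - A.poisson μ f.1 x - c‖ₑ) < ∞ := by
  have hval : ∀ x, (u - A.poissonSub μ s p q x₀ f).1 x =
      u.1 x - A.poisson μ f.1 x + A.poisson μ f.1 x₀ := fun x => by
    show u.1 x - (A.poisson μ f.1 x + -A.poisson μ f.1 x₀) = _
    ring
  constructor
  · rintro ⟨⟨c, hc⟩, -⟩
    refine ⟨c - A.poisson μ f.1 x₀, ?_⟩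
    convert hc using 4 with x
    have := hval x
    simp only [Submodule.subtype_apply]
    rw [this]
    ring
  · rintro ⟨c, hc⟩
    refine ⟨⟨c + A.poisson μ f.1 x₀, ?_⟩, (u - A.poissonSub μ s p q x₀ f).2.2⟩
    convert hc using 4 with x
    have := hval x
    simp only [Submodule.subtype_apply]
    rw [this]
    ring

/-- `‖f‖_{L¹(B(x₀))}` for the trace `f` of `u ∈ D̊`. -/
theorem exists_integral_trace_le (h : PolyDoubling μ C Q) (Ψ : A.LipPartition) (hs : 0 < s)
    (hp : ENNReal.ofReal (Q / (Q + s)) < p) (hq : 0 < q) (x₀ : A.Vertex) :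
    ∃ K : ℝ, 0 ≤ K ∧ ∀ (u : A.D₀ μ s p q x₀) (f : Z → ℂ), Ψ.IsTrace μ u.1 f →
      ∫ ζ in A.vball x₀, ‖f ζ‖ ∂μ ≤ K * A.normD μ s p q x₀ u := by
  obtain ⟨K, hK⟩ := h.exists_tailMean_apply_le hs hp hq x₀
  set m := μ (A.vball x₀) with hm
  have hm0 : m ≠ 0 := h.vball_ne_zero A x₀
  have hmt : m ≠ ∞ := h.vball_ne_top A x₀
  refine ⟨3 * (m.toReal * K), by positivity, fun u f hf => ?_⟩
  have h1 : ∫⁻ ζ in A.vball x₀, ‖f ζ‖ₑ ∂μ ≤ 3 * (m * K) * A.seqNorm μ s p q (A.gradNorm u.1) := by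
    calc _ ≤ ∫⁻ ζ in A.vball x₀, 3 * A.tailSum (A.gradNorm u.1) x₀.1 ζ ∂μ := by
          refine setLIntegral_mono_ae' (A.isOpen_vball x₀).measurableSet ?_
          filter_upwards [hf.2.2] with ζ hζ hζx
          have h1 := h.enorm_apply_sub_lim_le Ψ hζ hζx
          -- Since `u(x₀) = 0`, the bound on `u(x₀) - f` is a bound on `f` itself.
          rwa [u.2.2, zero_sub, enorm_neg] at h1
      _ = 3 * (m * (m⁻¹ * ∫⁻ ζ in A.vball x₀, A.tailSum (A.gradNorm u.1) x₀.1 ζ ∂μ)) := by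
          rw [lintegral_const_mul _ (A.measurable_tailSum _ _), ← mul_assoc m,
            ENNReal.mul_inv_cancel hm0 hmt, one_mul]
      _ ≤ 3 * (m * (K * A.seqNorm μ s p q (A.gradNorm u.1))) := by
          gcongr 2
          exact (setLIntegral_vball_le μ _ x₀).trans (hK _)
      _ = _ := by ring
  have hint : IntegrableOn f (A.vball x₀) μ := hf.1 _ Metric.isBounded_ball
  rw [integral_norm_eq_lintegral_enorm hint.1]
  refine (ENNReal.toReal_mono ?_ h1).trans (le_of_eq ?_)
  · exact ENNReal.mul_ne_top (ENNReal.mul_ne_top ENNReal.ofNat_ne_top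
      (ENNReal.mul_ne_top hmt ENNReal.coe_ne_top)) u.2.1.ne
  · simp [normD, ENNReal.toReal_mul]

theorem exists_normD_poissonVanish_le (h : PolyDoubling μ C Q) (hs : 0 < s)
    (hp : ENNReal.ofReal (Q / (Q + s)) < p) (hq : 0 < q) (x₀ : A.Vertex) :
    ∃ K : ℝ, ∀ f : A.besov μ s p q, A.normD μ s p q x₀ (h.poissonVanish hs hp hq x₀ f) ≤
      K * (A.besovNorm μ s p q f + ∫ ζ in A.vball x₀, ‖f.1 ζ‖ ∂μ) := by
  obtain ⟨K, hK⟩ := h.exists_seqNorm_gradNorm_le_add A hs hp hq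
  obtain ⟨K', hK'⟩ := h.seqNorm_single_mul (q := q) s (zero_le.trans_lt hp).ne' hq.ne' x₀
  set m := μ.real (A.vball x₀) with hm
  refine ⟨K * (1 + K' * m⁻¹), fun f => ?_⟩
  have h1 := (hK (A.poisson μ f.1) (h.poissonVanish hs hp hq x₀ f).1).trans
    (mul_le_mul_right (add_le_add_right (hK' _ _ fun x hx =>
      (h.poissonVanish_apply_of_ne hs hp hq hx f).symm) _) _)
  have h0 : (h.poissonVanish hs hp hq x₀ f).1 x₀ = 0 := (h.poissonVanish hs hp hq x₀ f).2.2
  rw [h0, sub_zero] at h1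
  have hfin : (K' : ℝ≥0∞) * ‖A.poisson μ f.1 x₀‖ₑ ≠ ∞ :=
    ENNReal.mul_ne_top ENNReal.coe_ne_top enorm_ne_top
  have h2 := ENNReal.toReal_mono (ENNReal.mul_ne_top ENNReal.coe_ne_top
    (ENNReal.add_ne_top.2 ⟨f.2.2.ne, hfin⟩)) h1
  rw [ENNReal.toReal_mul, ENNReal.toReal_add f.2.2.ne hfin, ENNReal.toReal_mul, toReal_enorm] at h2
  have h3 := norm_poisson_le (μ := μ) f.1 x₀
  have h4 : 0 ≤ A.besovNorm μ s p q f := besovNorm_nonneg f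
  have h5 : 0 ≤ ∫ ζ in A.vball x₀, ‖f.1 ζ‖ ∂μ := integral_nonneg fun _ => norm_nonneg _
  have h6 : 0 ≤ m⁻¹ := by positivity
  refine LE.le.trans h2 ?_
  simp only [ENNReal.coe_toReal]
  rw [mul_assoc]
  gcongr
  calc _ ≤ A.besovNorm μ s p q f + K' * (m⁻¹ * ∫ ζ in A.vball x₀, ‖f.1 ζ‖ ∂μ) := by
        gcongr
        exact le_rfl
    _ ≤ _ := by
        have h7 : 0 ≤ (K' : ℝ) * m⁻¹ := by positivity
        nlinarith [mul_nonneg h7 h4]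

theorem exists_besovNorm_le (h : PolyDoubling μ C Q) (Ψ : A.LipPartition) (hs : 0 < s)
    (hp : ENNReal.ofReal (Q / (Q + s)) < p) (hq : 0 < q) (x₀ : A.Vertex) :
    ∃ K : ℝ, 0 ≤ K ∧ ∀ (u : A.D₀ μ s p q x₀) (f : A.besov μ s p q), Ψ.IsTrace μ u.1 f.1 →
      A.besovNorm μ s p q f ≤ K * A.normD μ s p q x₀ u := by
  obtain ⟨K, hK⟩ := h.exists_seqNorm_gradNorm_poisson_le Ψ hs hp hq
  refine ⟨K, K.2, fun u f hf => ?_⟩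
  have h1 := ENNReal.toReal_mono (ENNReal.mul_ne_top ENNReal.coe_ne_top u.2.1.ne) (hK u.1 f.1 hf)
  rwa [ENNReal.toReal_mul, ENNReal.coe_toReal] at h1

/-- A vanishing gradient makes `Pf` constant on the connected graph, and `f` minus that constant
then has Poisson extension zero. -/
theorem mem_besovConst_of_besovNorm_eq_zero (h : PolyDoubling μ C Q) (Ψ : A.LipPartition)
    (hs : 0 < s) (hp : ENNReal.ofReal (Q / (Q + s)) < p) (hq : 0 < q) (x₀ : A.Vertex)
    {f : A.besov μ s p q} (hf : A.besovNorm μ s p q f = 0) : f ∈ A.besovConst μ s p q := by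
  have h0 : A.seqNorm μ s p q (A.gradNorm (A.poisson μ f.1)) = 0 :=
    ((ENNReal.toReal_eq_zero_iff _).1 hf).resolve_right f.2.2.ne
  refine ⟨A.poisson μ f.1 x₀, h.ae_eq_const_of_poisson
      (A := A) (p := p) (q := q) Ψ hs hp hq f.2.1 ?_⟩
  have h1 : (fun x => ‖A.poisson μ f.1 x - A.poisson μ f.1 x₀‖ₑ) = fun _ => 0 := by
    funext x
    obtain ⟨K, hK⟩ := h.exists_enorm_sub_le_seqNorm A s (zero_le.trans_lt hp).ne' hq.ne' x x₀
    simpa [h0] using hK (A.poisson μ f.1)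
  rw [h1, seqNorm_zero]
  exact ENNReal.zero_lt_top

theorem poissonSub_mem_iff (h : PolyDoubling μ C Q) (Ψ : A.LipPartition) (hs : 0 < s)
    (hp : ENNReal.ofReal (Q / (Q + s)) < p) (hq : 0 < q) (x₀ : A.Vertex) (f : A.besov μ s p q) :
    A.poissonSub μ s p q x₀ f ∈ (A.K₀ μ s p q x₀).submoduleOf (A.D₀ μ s p q x₀) ↔
      f ∈ A.besovConst μ s p q := by
  have hval : ∀ x, (A.poissonSub μ s p q x₀ f).1 x = A.poisson μ f.1 x - A.poisson μ f.1 x₀ :=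
    fun x => (sub_eq_add_neg _ _).symm
  constructor
  · rintro ⟨⟨c, hc⟩, -⟩
    refine ⟨A.poisson μ f.1 x₀ + c, h.ae_eq_const_of_poisson (A := A) Ψ hs hp hq f.2.1 ?_⟩
    convert hc using 4 with x
    simp only [Submodule.subtype_apply]
    rw [hval x]
    ring
  · rintro ⟨c, hc⟩
    have hP : A.poisson μ f.1 = fun _ => c := by
      rw [A.poisson_congr μ hc, h.poisson_const]
    have h0 : A.poissonSub μ s p q x₀ f = 0 := by
      refine Subtype.ext (funext fun x => ?_)
      rw [hval x, hP]
      simp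
    rw [h0]
    exact Submodule.zero_mem _

theorem poissonVanish_mem_iff (h : PolyDoubling μ C Q) (Ψ : A.LipPartition) (hs : 0 < s)
    (hp : ENNReal.ofReal (Q / (Q + s)) < p) (hq : 0 < q) (x₀ : A.Vertex) (f : A.besov μ s p q) :
    h.poissonVanish hs hp hq x₀ f ∈ (A.I₀ μ s p q x₀).submoduleOf (A.D₀ μ s p q x₀) ↔
      f ∈ A.besovZero μ s p q := by
  have h1 := h.sub_poissonVanish_mem_iff hs hp hq x₀ 0 f
  rw [zero_sub, Submodule.neg_mem_iff] at h1
  have h2 : (fun x => ‖(0 : A.D₀ μ s p q x₀).1 x - A.poisson μ f.1 x‖ₑ) =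
      fun x => ‖A.poisson μ f.1 x‖ₑ := by
    funext x
    simp
  rw [h1, h2]
  constructor
  · intro h3
    exact h.ae_eq_zero_of_poisson (A := A) Ψ hs hp hq f.2.1 h3
  · intro h3
    have h4 : A.poisson μ f.1 = fun _ => 0 := by
      rw [A.poisson_congr μ (show f.1 =ᵐ[μ] fun _ => (0 : ℂ) from h3), h.poisson_const]
    rw [h4]
    simp [seqNorm_zero]

/-- The trace isomorphism for `D̊ / I̊`. -/
theorem exists_trace_equiv_I₀ (h : PolyDoubling μ C Q) (Ψ : A.LipPartition) (hs : 0 < s)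
    (hp : ENNReal.ofReal (Q / (Q + s)) < p) (hq : 0 < q) (x₀ : A.Vertex) :
    IsQuasiNorm (quotNorm (A.normD μ s p q x₀)
        ((A.I₀ μ s p q x₀).submoduleOf (A.D₀ μ s p q x₀))) ∧
      ∃ Φ : (A.D₀ μ s p q x₀ ⧸ (A.I₀ μ s p q x₀).submoduleOf (A.D₀ μ s p q x₀)) ≃ₗ[ℂ]
          (A.besov μ s p q ⧸ A.besovZero μ s p q),
        (∀ (u : A.D₀ μ s p q x₀) (f : A.besov μ s p q), Ψ.IsTrace μ u.1 f.1 →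
          Φ (((A.I₀ μ s p q x₀).submoduleOf (A.D₀ μ s p q x₀)).mkQ u) =
            (A.besovZero μ s p q).mkQ f) ∧
        EquivNorms Φ
          (quotNorm (A.normD μ s p q x₀) ((A.I₀ μ s p q x₀).submoduleOf (A.D₀ μ s p q x₀)))
          (quotNorm (fun f => A.besovNorm μ s p q f + ∫ ζ in A.vball x₀, ‖f.1 ζ‖ ∂μ)
            (A.besovZero μ s p q)) := by
  have hmem : ∀ (u : A.D₀ μ s p q x₀) (f : A.besov μ s p q), Ψ.IsTrace μ u.1 f.1 →
      u - h.poissonVanish hs hp hq x₀ f ∈ (A.I₀ μ s p q x₀).submoduleOf (A.D₀ μ s p q x₀) :=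
    fun u f hf => (h.sub_poissonVanish_mem_iff hs hp hq x₀ u f).2
      (h.seqNorm_sub_poisson_lt_top Ψ hs hp hq u.2.1 hf)
  have htr : ∀ u : A.D₀ μ s p q x₀, ∃ f : A.besov μ s p q, Ψ.IsTrace μ u.1 f.1 := by
    intro u
    obtain ⟨f, hfB, hf⟩ := h.exists_isTrace_mem_besov Ψ hs hp hq u.2.1
    exact ⟨⟨f, hfB⟩, hf⟩
  have hsurj : ∀ u : A.D₀ μ s p q x₀, ∃ f, u - h.poissonVanish hs hp hq x₀ f ∈
      (A.I₀ μ s p q x₀).submoduleOf (A.D₀ μ s p q x₀) := by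
    intro u
    obtain ⟨f, hf⟩ := htr u
    exact ⟨f, hmem u f hf⟩
  have h0' : ∀ f : A.besov μ s p q,
      0 ≤ A.besovNorm μ s p q f + ∫ ζ in A.vball x₀, ‖f.1 ζ‖ ∂μ := fun f =>
    add_nonneg (besovNorm_nonneg f) (integral_nonneg fun _ => norm_nonneg _)
  have hinv : ∀ f g : A.besov μ s p q, f - g ∈ A.besovZero μ s p q →
      A.besovNorm μ s p q f + ∫ ζ in A.vball x₀, ‖f.1 ζ‖ ∂μ =
        A.besovNorm μ s p q g + ∫ ζ in A.vball x₀, ‖g.1 ζ‖ ∂μ := by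
    intro f g (hfg : (f.1 - g.1 : Z → ℂ) =ᵐ[μ] 0)
    have hae : f.1 =ᵐ[μ] g.1 := by
      filter_upwards [hfg] with ζ hζ
      exact sub_eq_zero.1 hζ
    unfold besovNorm
    rw [A.poisson_congr μ hae]
    congr 1
    refine integral_congr_ae (ae_restrict_of_ae ?_)
    filter_upwards [hae] with ζ hζ
    rw [hζ]
  obtain ⟨Φ, hΦ⟩ := exists_quotient_equiv _ (A.besovZero μ s p q)
    (h.poissonVanish hs hp hq x₀) (h.poissonVanish_mem_iff Ψ hs hp hq x₀) hsurj
  obtain ⟨c', hc'⟩ := h.exists_normD_poissonVanish_le hs hp hq x₀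
  obtain ⟨c₁, hc₁0, hc₁⟩ := h.exists_besovNorm_le Ψ hs hp hq x₀
  obtain ⟨c₂, hc₂0, hc₂⟩ := h.exists_integral_trace_le Ψ hs hp hq x₀
  have hEq : EquivNorms Φ
      (quotNorm (A.normD μ s p q x₀) ((A.I₀ μ s p q x₀).submoduleOf (A.D₀ μ s p q x₀)))
      (quotNorm (fun f => A.besovNorm μ s p q f + ∫ ζ in A.vball x₀, ‖f.1 ζ‖ ∂μ)
        (A.besovZero μ s p q)) := by
    refine equivNorms_quotNorm hsurj hΦ normD_nonneg h0' hinv (c := c₁ + c₂) (fun u f huf => ?_) hc'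
    -- `huf` forces `f` to agree almost everywhere with the true trace `g`, for which the bounds are
    -- known.
    obtain ⟨g, hg⟩ := htr u
    have h1 := (h.sub_poissonVanish_mem_iff hs hp hq x₀ u f).1 huf
    have h2 : g - f ∈ A.besovZero μ s p q :=
      h.ae_sub_eq_const_of_isTrace Ψ hs hp hq u.2.1 hg (c := 0) (by simpa using h1)
    rw [← hinv g f h2, add_mul]
    exact add_le_add (hc₁ u g hg) (hc₂ u g.1 hg)
  obtain ⟨K, hK, hadd⟩ := A.exists_normD_add_le μ s p q x₀
  refine ⟨isQuasiNorm_quotNorm _ normD_nonneg normD_smul hK hadd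
    (eq_zero_of_equivNorms hEq (quotNorm_nonneg h0' _) fun a ha => ?_),
    Φ, fun u f hf => hΦ u f (hmem u f hf), hEq⟩
  obtain ⟨f, rfl⟩ := (A.besovZero μ s p q).mkQ_surjective a
  rw [quotNorm_mkQ_of_invariant _ h0' hinv] at ha
  -- Definiteness: a zero Besov quasi-norm makes `f` constant, and the integral over `B(x₀)` then
  -- makes the constant zero.
  have h1 : A.besovNorm μ s p q f = 0 :=
    le_antisymm (by
      have : 0 ≤ ∫ ζ in A.vball x₀, ‖f.1 ζ‖ ∂μ := integral_nonneg fun _ => norm_nonneg _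
      linarith) (besovNorm_nonneg f)
  rw [h1, zero_add] at ha
  obtain ⟨c, hc⟩ := h.mem_besovConst_of_besovNorm_eq_zero Ψ hs hp hq x₀ h1
  have h2 : ∫ ζ in A.vball x₀, ‖f.1 ζ‖ ∂μ = μ.real (A.vball x₀) * ‖c‖ := by
    rw [integral_congr_ae (g := fun _ => ‖c‖)]
    · simp
    · filter_upwards [ae_restrict_of_ae hc] with ζ hζ
      rw [hζ]
  have h3 : 0 < μ.real (A.vball x₀) :=
    ENNReal.toReal_pos (h.vball_ne_zero A x₀) (h.vball_ne_top A x₀)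
  have hc0 : c = 0 := by
    rw [h2] at ha
    simpa using (mul_eq_zero.1 ha).resolve_left h3.ne'
  subst hc0
  exact (Submodule.Quotient.mk_eq_zero _).2 (show f.1 =ᵐ[μ] 0 from hc)

/-- The trace isomorphism for `D̊ / K̊`, and completeness of the Besov space. -/
theorem exists_trace_equiv_K₀ (h : PolyDoubling μ C Q) (Ψ : A.LipPartition) (hs : 0 < s)
    (hp : ENNReal.ofReal (Q / (Q + s)) < p) (hq : 0 < q) (x₀ : A.Vertex) :
    (IsQuasiNorm (quotNorm (A.normD μ s p q x₀)
        ((A.K₀ μ s p q x₀).submoduleOf (A.D₀ μ s p q x₀))) ∧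
      ∃ Φ : (A.D₀ μ s p q x₀ ⧸ (A.K₀ μ s p q x₀).submoduleOf (A.D₀ μ s p q x₀)) ≃ₗ[ℂ]
          (A.besov μ s p q ⧸ A.besovConst μ s p q),
        (∀ (u : A.D₀ μ s p q x₀) (f : A.besov μ s p q), Ψ.IsTrace μ u.1 f.1 →
          Φ (((A.K₀ μ s p q x₀).submoduleOf (A.D₀ μ s p q x₀)).mkQ u) =
            (A.besovConst μ s p q).mkQ f) ∧
        EquivNorms Φ
          (quotNorm (A.normD μ s p q x₀) ((A.K₀ μ s p q x₀).submoduleOf (A.D₀ μ s p q x₀)))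
          (quotNorm (A.besovNorm μ s p q) (A.besovConst μ s p q))) ∧
    IsQuasiBanach (quotNorm (A.besovNorm μ s p q) (A.besovConst μ s p q)) := by
  have hmem : ∀ (u : A.D₀ μ s p q x₀) (f : A.besov μ s p q), Ψ.IsTrace μ u.1 f.1 →
      u - A.poissonSub μ s p q x₀ f ∈ (A.K₀ μ s p q x₀).submoduleOf (A.D₀ μ s p q x₀) :=
    fun u f hf => (sub_poissonSub_mem_iff x₀ u f).2
      ⟨0, by simpa using h.seqNorm_sub_poisson_lt_top Ψ hs hp hq u.2.1 hf⟩
  have htr : ∀ u : A.D₀ μ s p q x₀, ∃ f : A.besov μ s p q, Ψ.IsTrace μ u.1 f.1 := by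
    intro u
    obtain ⟨f, hfB, hf⟩ := h.exists_isTrace_mem_besov Ψ hs hp hq u.2.1
    exact ⟨⟨f, hfB⟩, hf⟩
  have hsurj : ∀ u : A.D₀ μ s p q x₀, ∃ f, u - A.poissonSub μ s p q x₀ f ∈
      (A.K₀ μ s p q x₀).submoduleOf (A.D₀ μ s p q x₀) := by
    intro u
    obtain ⟨f, hf⟩ := htr u
    exact ⟨f, hmem u f hf⟩
  have hinv := A.besovNorm_eq_of_sub_mem μ h.pos h.lt_top s p q
  obtain ⟨Φ, hΦ⟩ := exists_quotient_equiv _ (A.besovConst μ s p q)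
    (A.poissonSub μ s p q x₀) (h.poissonSub_mem_iff Ψ hs hp hq x₀) hsurj
  have hc' : ∀ f, A.normD μ s p q x₀ (A.poissonSub μ s p q x₀ f) ≤ 1 * A.besovNorm μ s p q f :=
    fun f => by rw [normD_poissonSub, one_mul]
  obtain ⟨c, hc0, hc⟩ := h.exists_besovNorm_le Ψ hs hp hq x₀
  have hcc : ∀ (u : A.D₀ μ s p q x₀) (f : A.besov μ s p q), u - A.poissonSub μ s p q x₀ f ∈
      (A.K₀ μ s p q x₀).submoduleOf (A.D₀ μ s p q x₀) →
      A.besovNorm μ s p q f ≤ c * A.normD μ s p q x₀ u := by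
    intro u f huf
    obtain ⟨g, hg⟩ := htr u
    obtain ⟨b, hb⟩ := (sub_poissonSub_mem_iff x₀ u f).1 huf
    have h2 : g - f ∈ A.besovConst μ s p q :=
      ⟨b, h.ae_sub_eq_const_of_isTrace Ψ hs hp hq u.2.1 hg hb⟩
    rw [← hinv g f h2]
    exact hc u g hg
  have hdef : ∀ a, quotNorm (A.besovNorm μ s p q) (A.besovConst μ s p q) a = 0 → a = 0 := by
    intro a ha
    obtain ⟨f, rfl⟩ := (A.besovConst μ s p q).mkQ_surjective a
    rw [quotNorm_mkQ_of_invariant _ besovNorm_nonneg hinv] at ha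
    exact (Submodule.Quotient.mk_eq_zero _).2
      (h.mem_besovConst_of_besovNorm_eq_zero Ψ hs hp hq x₀ ha)
  have hEq := equivNorms_quotNorm hsurj hΦ normD_nonneg besovNorm_nonneg hinv hcc hc'
  obtain ⟨K, hK, hadd⟩ := A.exists_normD_add_le μ s p q x₀
  obtain ⟨K', hK', hadd'⟩ := A.exists_besovNorm_add_le μ s p q x₀
  refine ⟨⟨isQuasiNorm_quotNorm _ normD_nonneg normD_smul hK hadd
    (eq_zero_of_equivNorms hEq (quotNorm_nonneg besovNorm_nonneg _) hdef),
    Φ, fun u f hf => hΦ u f (hmem u f hf), hEq⟩,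
    isQuasiNorm_quotNorm _ besovNorm_nonneg besovNorm_smul hK' hadd' hdef, ?_⟩
  exact quotient_complete hsurj besovNorm_nonneg hinv hcc hc' normD_nonneg
    (h.D₀_complete (zero_le.trans_lt hp).ne' hq.ne' x₀)

end PolyDoubling

/-! ### Reflexivity of `ℓ^p` sums -/

section LpReflexive

variable {𝕜 : Type*} [RCLike 𝕜] {α : Type*} {E : α → Type*} [∀ i, NormedAddCommGroup (E i)]
  [∀ i, NormedSpace 𝕜 (E i)] {p : ℝ≥0∞} [Fact (1 ≤ p)] [DecidableEq α]

/-- The part of a functional on an `ℓ^p` sum that sees only the `i`-th component. -/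
noncomputable def lp.dualComponent (φ : StrongDual 𝕜 (lp E p)) (i : α) : StrongDual 𝕜 (lp E p) :=
  (φ ∘L lp.singleContinuousLinearMap 𝕜 E p i) ∘L lp.evalCLM 𝕜 E p i

theorem lp.dualComponent_apply (φ : StrongDual 𝕜 (lp E p)) (i : α) (x : lp E p) :
    lp.dualComponent φ i x = φ (lp.single p i (x i)) :=
  rfl

theorem lp.sum_dualComponent_apply (φ : StrongDual 𝕜 (lp E p)) (S : Finset α) (x : lp E p) :
    (∑ i ∈ S, lp.dualComponent φ i) x = φ (∑ i ∈ S, lp.single p i (x i)) := by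
  rw [_root_.sum_apply, map_sum]
  exact Finset.sum_congr rfl fun i _ => lp.dualComponent_apply φ i x

theorem lp.norm_sum_single_le (hp : p ≠ ∞) (S : Finset α) (x : lp E p) :
    ‖∑ i ∈ S, lp.single p i (x i)‖ ≤ ‖x‖ := by
  have hp0 : 0 < p.toReal := ENNReal.toReal_pos (zero_lt_one.trans_le Fact.out).ne' hp
  rw [← Real.rpow_le_rpow_iff (norm_nonneg _) (norm_nonneg _) hp0, lp.norm_sum_single hp0]
  exact lp.sum_rpow_le_norm_rpow hp0 x S

theorem lp.norm_sum_dualComponent_le (hp : p ≠ ∞) (φ : StrongDual 𝕜 (lp E p)) (S : Finset α) :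
    ‖∑ i ∈ S, lp.dualComponent φ i‖ ≤ ‖φ‖ := by
  refine ContinuousLinearMap.opNorm_le_bound _ (norm_nonneg _) fun x => ?_
  rw [lp.sum_dualComponent_apply]
  exact (φ.le_opNorm _).trans (by gcongr; exact lp.norm_sum_single_le hp S x)

/-- For `1 < p < ∞` a functional on an `ℓ^p` sum is the sum of its components, in norm. -/
theorem lp.summable_dualComponent (hp1 : 1 < p) (hp : p ≠ ∞) (φ : StrongDual 𝕜 (lp E p)) :
    Summable fun i => lp.dualComponent φ i := by
  have hp0 : 0 < p.toReal := ENNReal.toReal_pos (zero_lt_one.trans hp1).ne' hp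
  have hp1' : 1 < p.toReal := by
    rw [← ENNReal.toReal_one]
    exact (ENNReal.toReal_lt_toReal ENNReal.one_ne_top hp).2 hp1
  rw [summable_iff_vanishing_norm]
  by_contra! hcon
  obtain ⟨ε, hε, hS⟩ := hcon
  -- Without summability there are disjoint blocks on each of which `φ` has norm at least `ε`.
  -- Near-maximisers of norm below 1 on `n` blocks, with phases turned so that the values of `φ` add
  -- up, form a vector of norm at most `n^(1/p)` on which `φ` is at least `nε/2`. For `p > 1` this
  -- is impossible for large `n`.
  have key : ∀ n : ℕ, ∃ (U : Finset α) (f : ∀ i, E i), ∑ i ∈ U, ‖f i‖ ^ p.toReal ≤ n ∧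
      n * (ε / 2) ≤ RCLike.re (φ (∑ i ∈ U, lp.single p i (f i))) := by
    intro n
    induction n with
    | zero => exact ⟨∅, 0, by simp, by simp⟩
    | succ n ih =>
      obtain ⟨U, f, hf1, hf2⟩ := ih
      obtain ⟨T, hTU, hT⟩ := hS U
      obtain ⟨x, hx1, hx2⟩ := ContinuousLinearMap.exists_lt_apply_of_lt_opNorm
        (∑ i ∈ T, lp.dualComponent φ i) ((half_lt_self hε).trans_le hT)
      rw [lp.sum_dualComponent_apply] at hx2
      obtain ⟨c, hc1, hc2⟩ := RCLike.exists_norm_eq_mul_self (φ (∑ i ∈ T, lp.single p i (x i)))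
      have hy : ∀ i ∈ T, (U.piecewise f fun i => c • x i) i = c • x i := fun i hi =>
        Finset.piecewise_eq_of_notMem _ _ _ (Finset.disjoint_left.1 hTU hi)
      have hyU : ∀ i ∈ U, (U.piecewise f fun i => c • x i) i = f i := fun i hi =>
        Finset.piecewise_eq_of_mem _ _ _ hi
      refine ⟨U ∪ T, U.piecewise f fun i => c • x i, ?_, ?_⟩
      · rw [Finset.sum_union hTU.symm, Finset.sum_congr rfl fun i hi => by rw [hyU i hi],
          Finset.sum_congr (s₁ := T) rfl fun i hi => by rw [hy i hi, norm_smul, hc1, one_mul]]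
        push_cast
        gcongr
        refine (lp.sum_rpow_le_norm_rpow hp0 x T).trans ?_
        exact Real.rpow_le_one (norm_nonneg _) hx1.le hp0.le
      · rw [Finset.sum_union hTU.symm, Finset.sum_congr rfl fun i hi => by rw [hyU i hi],
          Finset.sum_congr (s₁ := T) rfl fun i hi => by rw [hy i hi, lp.single_smul],
          ← Finset.smul_sum, map_add, map_smul, smul_eq_mul, ← hc2, map_add, RCLike.ofReal_re]
        push_cast
        linarith
  have hbound : ∀ n : ℕ, n * (ε / 2) ≤ ‖φ‖ * (n : ℝ) ^ (1 / p.toReal) := by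
    intro n
    obtain ⟨U, f, hf1, hf2⟩ := key n
    refine hf2.trans ((RCLike.re_le_norm _).trans ((φ.le_opNorm _).trans ?_))
    gcongr
    rw [one_div, Real.le_rpow_inv_iff_of_pos (norm_nonneg _) n.cast_nonneg hp0,
      lp.norm_sum_single hp0]
    exact hf1
  have hexp : 0 < 1 - 1 / p.toReal := by
    rw [sub_pos, div_lt_one hp0]
    exact hp1'
  have htop := ((tendsto_rpow_atTop hexp).comp tendsto_natCast_atTop_atTop).eventually_gt_atTop
    (‖φ‖ / (ε / 2))
  obtain ⟨n, hn, hn0⟩ := (htop.and (eventually_gt_atTop 0)).exists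
  have hn0' : (0 : ℝ) < n := by exact_mod_cast hn0
  rw [Function.comp_apply, div_lt_iff₀ (by positivity)] at hn
  have h1 : (n : ℝ) = (n : ℝ) ^ (1 - 1 / p.toReal) * (n : ℝ) ^ (1 / p.toReal) := by
    rw [← Real.rpow_add hn0', sub_add_cancel, Real.rpow_one]
  have h2 := hbound n
  have h3 := mul_lt_mul_of_pos_right hn (Real.rpow_pos_of_pos hn0' (1 / p.toReal))
  nlinarith

/-- The norm limit exists and is identified by evaluating at vectors, which for `p < ∞` are the sums
of their components. -/
theorem lp.hasSum_dualComponent (hp1 : 1 < p) (hp : p ≠ ∞) (φ : StrongDual 𝕜 (lp E p)) :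
    HasSum (fun i => lp.dualComponent φ i) φ := by
  obtain ⟨ψ, hψ⟩ := lp.summable_dualComponent hp1 hp φ
  convert hψ
  ext x
  refine ((lp.hasSum_single hp x).mapL φ).unique ?_
  simpa only [ContinuousLinearMap.apply_apply, lp.dualComponent_apply] using
    hψ.mapL (ContinuousLinearMap.apply 𝕜 𝕜 x)

/-- An `ℓ^p` sum of reflexive spaces is reflexive when `1 < p < ∞`. -/
theorem lp.surjective_inclusionInDoubleDual (hp1 : 1 < p) (hp : p ≠ ∞)
    (hE : ∀ i, Function.Surjective (NormedSpace.inclusionInDoubleDual 𝕜 (E i))) :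
    Function.Surjective (NormedSpace.inclusionInDoubleDual 𝕜 (lp E p)) := by
  have hp0 : 0 < p.toReal := ENNReal.toReal_pos (zero_lt_one.trans hp1).ne' hp
  intro Φ
  have hcomp : ∀ i, ∃ x : E i, ∀ φ : StrongDual 𝕜 (lp E p),
      Φ (lp.dualComponent φ i) = φ (lp.single p i x) := by
    intro i
    -- `Φ` restricted to functionals that factor through the `i`-th coordinate lies in the bidual of
    -- `E i`, so a vector of `E i` represents it.
    obtain ⟨x, hx⟩ := hE i (Φ ∘L (ContinuousLinearMap.compL 𝕜 (lp E p) (E i) 𝕜).flip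
      (lp.evalCLM 𝕜 E p i))
    refine ⟨x, fun φ => ?_⟩
    have h1 := congrArg (fun Ψ => Ψ (φ ∘L lp.singleContinuousLinearMap 𝕜 E p i)) hx
    simp only [NormedSpace.dual_def, ContinuousLinearMap.comp_apply,
      lp.singleContinuousLinearMap_apply] at h1
    exact h1.symm
  choose x hx using hcomp
  -- Norming functionals for the partial sums of the candidate vector bound them by `‖Φ‖`; this puts
  -- the vector into the `ℓ^p` sum.
  have hsum : ∀ S : Finset α, ‖∑ i ∈ S, lp.single p i (x i)‖ ≤ ‖Φ‖ := by
    intro S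
    obtain ⟨φ, hφ1, hφ2⟩ := exists_dual_vector'' 𝕜 (∑ i ∈ S, lp.single p i (x i))
    have h1 : Φ (∑ i ∈ S, lp.dualComponent φ i) = ‖∑ i ∈ S, lp.single p i (x i)‖ := by
      rw [map_sum, Finset.sum_congr rfl fun i _ => hx i φ, ← map_sum, hφ2]
    have h2 : ‖Φ (∑ i ∈ S, lp.dualComponent φ i)‖ ≤ ‖Φ‖ * 1 :=
      (Φ.le_opNorm _).trans (by
        gcongr
        exact (lp.norm_sum_dualComponent_le hp φ S).trans hφ1)
    rwa [h1, RCLike.norm_ofReal, abs_norm, mul_one] at h2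
  have hmem : Memℓp x p := memℓp_gen' (C := ‖Φ‖ ^ p.toReal) fun S => by
    rw [← lp.norm_sum_single hp0]
    gcongr
    exact hsum S
  refine ⟨⟨x, hmem⟩, ?_⟩
  ext φ
  rw [NormedSpace.dual_def]
  refine ((lp.hasSum_single hp ⟨x, hmem⟩).mapL φ).unique ?_
  refine ((lp.hasSum_dualComponent hp1 hp φ).mapL Φ).congr_fun ?_
  exact fun i => (hx i φ).symm

end LpReflexive

/-! ### Reflexivity passes to complete subspaces -/

/-- A Banach space that embeds into a reflexive space is reflexive. -/
theorem ContinuousLinearMap.surjective_inclusionInDoubleDual_of_antilipschitz {𝕜 E F : Type*}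
    [RCLike 𝕜] [NormedAddCommGroup E] [NormedSpace 𝕜 E] [CompleteSpace E] [NormedAddCommGroup F]
    [NormedSpace 𝕜 F] (T : E →L[𝕜] F) {K : ℝ≥0} (hT : AntilipschitzWith K T)
    (hF : Function.Surjective (NormedSpace.inclusionInDoubleDual 𝕜 F)) :
    Function.Surjective (NormedSpace.inclusionInDoubleDual 𝕜 E) := by
  intro Φ
  obtain ⟨y, hy⟩ := hF (Φ ∘L (ContinuousLinearMap.compL 𝕜 E F 𝕜).flip T)
  have hy' : ∀ ψ : StrongDual 𝕜 F, ψ y = Φ (ψ ∘L T) := fun ψ => by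
    simpa using congrArg (fun Ψ => Ψ ψ) hy
  have hclosed : IsClosed (T.range : Set F) := hT.isClosed_range T.uniformContinuous
  -- If `y` were outside the closed range, a functional on the quotient would be non-zero at `y`,
  -- although its pullback along `T` vanishes.
  have hmem : y ∈ T.range := by
    by_contra hcon
    have hne : T.range.mkQ y ≠ 0 := fun h0 => hcon ((Submodule.Quotient.mk_eq_zero _).1 h0)
    obtain ⟨ψ, hψ⟩ := SeparatingDual.exists_ne_zero (R := 𝕜) hne
    refine hψ ((hy' (ψ ∘L T.range.mkQL)).trans ?_)
    have h0 : (ψ ∘L T.range.mkQL) ∘L T = 0 := by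
      ext x
      have h1 : T.range.mkQ (T x) = 0 := (Submodule.Quotient.mk_eq_zero _).2 ⟨x, rfl⟩
      change ψ (T.range.mkQ (T x)) = 0
      rw [h1, map_zero]
    rw [h0, map_zero]
  obtain ⟨x, rfl⟩ := hmem
  refine ⟨x, ?_⟩
  ext φ
  rw [NormedSpace.dual_def]
  let e := LinearEquiv.ofInjective (T : E →ₗ[𝕜] F) hT.injective
  -- By Hahn–Banach every functional `φ` on `E` has the form `ψ ∘ T`, so testing against pullbacks
  -- is enough.
  obtain ⟨ψ, hψ, -⟩ := exists_extension_norm_eq T.range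
    (LinearMap.mkContinuous (φ.toLinearMap ∘ₗ e.symm.toLinearMap) (‖φ‖ * K) fun z => by
      obtain ⟨w, rfl⟩ := e.surjective z
      rw [LinearMap.comp_apply, LinearEquiv.coe_coe, e.symm_apply_apply, mul_assoc]
      refine (φ.le_opNorm w).trans ?_
      gcongr
      change ‖w‖ ≤ K * ‖T w‖
      simpa using hT.le_mul_dist w 0)
  have hφ : ψ ∘L T = φ := by
    ext w
    have h1 := hψ (e w)
    have h2 : ((e w : T.range) : F) = T w := rfl
    rw [h2] at h1
    rw [ContinuousLinearMap.comp_apply, h1]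
    simp
  have h3 := hy' ψ
  rw [hφ] at h3
  rw [← h3, ← hφ]
  rfl

/-- A complete norm is reflexive if it is equivalent to the norm of a subspace of a reflexive
space. -/
theorem IsQuasiBanach.isReflexiveBanach {V F : Type*} [AddCommGroup V] [Module ℂ V]
    [NormedAddCommGroup F] [NormedSpace ℂ F] {N : V → ℝ} (hN : IsQuasiBanach N)
    (hadd : ∀ v w, N (v + w) ≤ N v + N w) (T : V →ₗ[ℂ] F) {K : ℝ≥0} {K' : ℝ}
    (hT : ∀ v, N v ≤ K * ‖T v‖) (hT' : ∀ v, ‖T v‖ ≤ K' * N v)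
    (hF : Function.Surjective (NormedSpace.inclusionInDoubleDual ℂ F)) :
    IsReflexiveBanach N := by
  let _ : Norm V := ⟨N⟩
  have core : NormedSpace.Core ℂ V :=
    { norm_nonneg := hN.1.nonneg
      norm_smul := hN.1.smul
      norm_triangle := hadd
      norm_eq_zero_iff := hN.1.eq_zero_iff }
  let _ : NormedAddCommGroup V := NormedAddCommGroup.ofCore core
  let _ : NormedSpace ℂ V := NormedSpace.ofCore core
  have hcomplete : CompleteSpace V := by
    refine Metric.complete_of_cauchySeq_tendsto fun a ha => ?_
    obtain ⟨v, hv⟩ := hN.2 a fun ε hε => by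
      obtain ⟨M, hM⟩ := Metric.cauchySeq_iff.1 ha ε hε
      refine ⟨M, fun m hm n hn => ?_⟩
      have := hM m hm n hn
      rwa [dist_eq_norm] at this
    refine ⟨v, Metric.tendsto_atTop.2 fun ε hε => ?_⟩
    obtain ⟨M, hM⟩ := hv ε hε
    refine ⟨M, fun n hn => ?_⟩
    rw [dist_eq_norm]
    exact hM n hn
  refine ⟨V, _, _, LinearEquiv.refl ℂ V, fun _ => rfl, hcomplete, ?_⟩
  exact (T.mkContinuous K' hT').surjective_inclusionInDoubleDual_of_antilipschitz (K := K)
    (AddMonoidHomClass.antilipschitz_of_bound _ hT) hF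

/-! ### Linear maps into `ℓ^p` sums -/

section LpPi

variable {α : Type*} {E : α → Type*} [∀ i, NormedAddCommGroup (E i)] {p : ℝ≥0∞}

theorem enorm_rpow_eq_ofReal {G : Type*} [NormedAddCommGroup G] (x : G) {r : ℝ} (hr : 0 ≤ r) :
    ‖x‖ₑ ^ r = ENNReal.ofReal (‖x‖ ^ r) := by
  rw [← ofReal_norm, ENNReal.ofReal_rpow_of_nonneg (norm_nonneg _) hr]

theorem memℓp_of_tsum_enorm_ne_top (hp : 0 < p.toReal) {f : ∀ i, E i}
    (h : ∑' i, ‖f i‖ₑ ^ p.toReal ≠ ∞) : Memℓp f p := by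
  refine (memℓp_gen_iff hp).2 ?_
  simp only [fun i => enorm_rpow_eq_ofReal (f i) hp.le] at h
  exact (ENNReal.summable_toReal h).congr fun i => ENNReal.toReal_ofReal (by positivity)

theorem lp.enorm_eq_tsum (hp : 0 < p.toReal) [Fact (1 ≤ p)] (f : lp E p) :
    ‖f‖ₑ = (∑' i, ‖f i‖ₑ ^ p.toReal) ^ (1 / p.toReal) := by
  have h1 : ‖f‖ₑ ^ p.toReal = ∑' i, ‖f i‖ₑ ^ p.toReal := by
    simp only [fun i => enorm_rpow_eq_ofReal (f i) hp.le]
    rw [enorm_rpow_eq_ofReal f hp.le, lp.norm_rpow_eq_tsum hp,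
      ENNReal.ofReal_tsum_of_nonneg (fun i => by positivity) ((lp.memℓp f).summable hp)]
  rw [← h1, ← ENNReal.rpow_mul, mul_one_div_cancel hp.ne', ENNReal.rpow_one]

/-- The linear map into an `ℓ^p` sum with the given components. -/
noncomputable def lp.piMap {V : Type*} [AddCommGroup V] [Module ℂ V] [∀ i, NormedSpace ℂ (E i)]
    (L : ∀ i, V →ₗ[ℂ] E i) (h : ∀ v, Memℓp (fun i => L i v) p) : V →ₗ[ℂ] lp E p where
  toFun v := ⟨fun i => L i v, h v⟩
  map_add' v w := by
    ext i
    exact map_add (L i) v w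
  map_smul' c v := by
    ext i
    exact map_smul (L i) c v

theorem lp.enorm_piMap {V : Type*} [AddCommGroup V] [Module ℂ V] [∀ i, NormedSpace ℂ (E i)]
    (hp : 0 < p.toReal) [Fact (1 ≤ p)] (L : ∀ i, V →ₗ[ℂ] E i)
    (h : ∀ v, Memℓp (fun i => L i v) p) (v : V) :
    ‖lp.piMap L h v‖ₑ = (∑' i, ‖L i v‖ₑ ^ p.toReal) ^ (1 / p.toReal) :=
  lp.enorm_eq_tsum hp _

end LpPi

theorem surjective_inclusionInDoubleDual_complex :
    Function.Surjective (NormedSpace.inclusionInDoubleDual ℂ ℂ) := by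
  intro Φ
  refine ⟨Φ (ContinuousLinearMap.id ℂ ℂ), ?_⟩
  ext φ
  have h1 : φ = φ 1 • ContinuousLinearMap.id ℂ ℂ := by
    ext
    simp
  rw [NormedSpace.dual_def]
  conv_rhs => rw [h1, map_smul]
  conv_lhs => rw [h1]
  simp

/-! ### Reflexivity of the Besov space -/

namespace HyperbolicFilling

variable {Z : Type*} [MetricSpace Z] [MeasurableSpace Z] [BorelSpace Z] {A : HyperbolicFilling Z}
  {μ : Measure Z} {s : ℝ} {p q : ℝ≥0∞}

theorem seqNorm_add_le_of_one_le (hp : 1 ≤ p) (hq : 1 ≤ q) (w w' : A.Vertex → ℝ≥0∞) :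
    A.seqNorm μ s p q (fun x => w x + w' x) ≤ A.seqNorm μ s p q w + A.seqNorm μ s p q w' := by
  simpa [ENNReal.LpAddConst_of_one_le hp, ENNReal.LpAddConst_of_one_le hq] using
    A.seqNorm_add_le μ s p q w w'

end HyperbolicFilling

namespace PolyDoubling

open HyperbolicFilling

variable {Z : Type*} [MetricSpace Z] [MeasurableSpace Z] [BorelSpace Z] {μ : Measure Z} {C Q : ℝ}
  {A : HyperbolicFilling Z} {s : ℝ} {p q : ℝ≥0∞}

/-- For `p, q < ∞` the quasi-norm of `I^s_{p,q}(X)` is equivalent to a weighted mixed norm. -/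
theorem exists_seqNorm_equiv (h : PolyDoubling μ C Q) (A : HyperbolicFilling Z) (s : ℝ)
    (hp0 : p ≠ 0) (hp : p ≠ ∞) (hq0 : q ≠ 0) (hq : q ≠ ∞) :
    ∃ K : ℝ≥0, ∀ w : A.Vertex → ℝ≥0∞,
      A.seqNorm μ s p q w ≤ K * (∑' k : ℤ, ((2 : ℝ≥0∞) ^ ((k : ℝ) * s) * (∑' x : A.net k,
        (μ (A.vball ⟨k, x⟩) ^ (1 / p.toReal) * w ⟨k, x⟩) ^ p.toReal) ^ (1 / p.toReal)) ^ q.toReal)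
          ^ (1 / q.toReal) ∧
      (∑' k : ℤ, ((2 : ℝ≥0∞) ^ ((k : ℝ) * s) * (∑' x : A.net k,
        (μ (A.vball ⟨k, x⟩) ^ (1 / p.toReal) * w ⟨k, x⟩) ^ p.toReal) ^ (1 / p.toReal)) ^ q.toReal)
          ^ (1 / q.toReal) ≤ K * A.seqNorm μ s p q w := by
  obtain ⟨N, hN⟩ := h.exists_overlapBound A
  have hp' := ENNReal.toReal_pos hp0 hp
  have hq' := ENNReal.toReal_pos hq0 hq
  have hcount : ∀ f : ℤ → ℝ≥0∞,
      eLpNorm f q Measure.count = (∑' k, f k ^ q.toReal) ^ (1 / q.toReal) := fun f => by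
    rw [eLpNorm_eq_lintegral_rpow_enorm_toReal hq0 hq, lintegral_count]
    simp only [enorm_eq_self]
  have hw : ∀ (w : A.Vertex → ℝ≥0∞) (k : ℤ), ∑' x : A.net k,
      (μ (A.vball ⟨k, x⟩) ^ (1 / p.toReal) * w ⟨k, x⟩) ^ p.toReal =
        ∑' x : A.net k, w ⟨k, x⟩ ^ p.toReal * μ (A.vball ⟨k, x⟩) := fun w k => by
    refine tsum_congr fun x => ?_
    rw [ENNReal.mul_rpow_of_nonneg _ _ hp'.le, ← ENNReal.rpow_mul, one_div_mul_cancel hp'.ne',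
      ENNReal.rpow_one, mul_comm]
  have hc : ((N : ℝ≥0) : ℝ≥0∞) ^ (1 / p.toReal) = (((N : ℝ≥0) ^ (1 / p.toReal) : ℝ≥0) : ℝ≥0∞) :=
    (ENNReal.coe_rpow_of_nonneg _ (by positivity)).symm
  refine ⟨max N ((N : ℝ≥0) ^ (1 / p.toReal)), fun w => ?_⟩
  simp only [hw, ← hcount]
  constructor
  · refine eLpNorm_le_mul_eLpNorm_of_ae_le_mul' (ae_of_all _ fun k => ?_) q
    simp only [enorm_eq_self]
    rw [mul_left_comm]
    gcongr
    refine (h.eLpNorm_levelSum_le hN hp0 hp w k).trans ?_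
    gcongr
    exact_mod_cast le_max_left _ _
  · refine eLpNorm_le_mul_eLpNorm_of_ae_le_mul' (ae_of_all _ fun k => ?_) q
    simp only [enorm_eq_self]
    rw [mul_left_comm]
    gcongr
    refine (ENNReal.rpow_le_rpow (h.tsum_le_eLpNorm_levelSum hN hp0 hp w k)
      (by positivity)).trans ?_
    rw [ENNReal.mul_rpow_of_nonneg _ _ (by positivity), ← ENNReal.rpow_mul,
      mul_one_div_cancel hp'.ne', ENNReal.rpow_one]
    gcongr
    have h1 := hc.trans_le (ENNReal.coe_le_coe.2 (le_max_right (N : ℝ≥0) _))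
    simpa using h1

/-- A family of linear maps into reflexive spaces, indexed by the vertices and with norms in
`I^s_{p,q}(X)`, assembles to a linear map into one reflexive space. -/
theorem exists_linearMap_reflexive.{u, v, w} {Z : Type u} [MetricSpace Z] [MeasurableSpace Z]
    [BorelSpace Z] {μ : Measure Z} {A : HyperbolicFilling Z} (h : PolyDoubling μ C Q)
    (hp1 : 1 < p) (hp : p ≠ ∞)
    (hq1 : 1 < q) (hq : q ≠ ∞) {V : Type v} [AddCommGroup V] [Module ℂ V] {G : A.Vertex → Type w}
    [∀ x, NormedAddCommGroup (G x)] [∀ x, NormedSpace ℂ (G x)]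
    (hG : ∀ x, Function.Surjective (NormedSpace.inclusionInDoubleDual ℂ (G x)))
    (J : ∀ x, V →ₗ[ℂ] G x) (hJ : ∀ v, A.seqNorm μ s p q (fun x => ‖J x v‖ₑ) < ∞) :
    ∃ (F : Type (max u w)) (_ : NormedAddCommGroup F) (_ : NormedSpace ℂ F) (T : V →ₗ[ℂ] F)
        (K : ℝ≥0),
      Function.Surjective (NormedSpace.inclusionInDoubleDual ℂ F) ∧
      ∀ v, A.seqNorm μ s p q (fun x => ‖J x v‖ₑ) ≤ K * ‖T v‖ₑ ∧
        ‖T v‖ₑ ≤ K * A.seqNorm μ s p q (fun x => ‖J x v‖ₑ) := by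
  classical
  have hp0 : p ≠ 0 := (zero_lt_one.trans hp1).ne'
  have hq0 : q ≠ 0 := (zero_lt_one.trans hq1).ne'
  have hp' := ENNReal.toReal_pos hp0 hp
  have hq' := ENNReal.toReal_pos hq0 hq
  have : Fact (1 ≤ p) := ⟨hp1.le⟩
  have : Fact (1 ≤ q) := ⟨hq1.le⟩
  obtain ⟨K, hK⟩ := h.exists_seqNorm_equiv A s hp0 hp hq0 hq
  have henorm : ∀ {a : ℝ≥0∞}, a ≠ ∞ → ‖((a.toReal : ℝ) : ℂ)‖ₑ = a := fun {a} ha => by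
    rw [← ofReal_norm, Complex.norm_real, Real.norm_of_nonneg ENNReal.toReal_nonneg,
      ENNReal.ofReal_toReal ha]
  have ha : ∀ x, μ (A.vball x) ^ (1 / p.toReal) ≠ ∞ := fun x =>
    ENNReal.rpow_ne_top_of_nonneg (by positivity) (h.vball_ne_top A x)
  have hb0 : ∀ k : ℤ, (2 : ℝ≥0∞) ^ ((k : ℝ) * s) ≠ 0 := fun k =>
    (ENNReal.rpow_pos (by norm_num) ENNReal.ofNat_ne_top).ne'
  have hb : ∀ k : ℤ, (2 : ℝ≥0∞) ^ ((k : ℝ) * s) ≠ ∞ := fun k =>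
    ENNReal.rpow_ne_top_of_ne_zero (by norm_num) (by norm_num)
  have hsum : ∀ v, ∑' k : ℤ, ((2 : ℝ≥0∞) ^ ((k : ℝ) * s) * (∑' x : A.net k,
      (μ (A.vball ⟨k, x⟩) ^ (1 / p.toReal) * ‖J ⟨k, x⟩ v‖ₑ) ^ p.toReal) ^ (1 / p.toReal))
        ^ q.toReal ≠ ∞ := fun v => by
    have h1 := (hK fun x => ‖J x v‖ₑ).2.trans_lt (ENNReal.mul_lt_top ENNReal.coe_lt_top (hJ v))
    exact ((ENNReal.rpow_lt_top_iff_of_pos (by positivity)).1 h1).ne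
  -- The weights `μ(B(x))^(1/p)` and, below, `2^(ks)` are absorbed into the maps, so that unweighted
  -- `ℓ^p` and `ℓ^q` sums suffice.
  let L : ∀ (k : ℤ) (x : A.net k), V →ₗ[ℂ] G ⟨k, x⟩ := fun k x =>
    (((μ (A.vball ⟨k, x⟩) ^ (1 / p.toReal)).toReal : ℝ) : ℂ) • J ⟨k, x⟩
  have hL : ∀ k x v, ‖L k x v‖ₑ = μ (A.vball ⟨k, x⟩) ^ (1 / p.toReal) * ‖J ⟨k, x⟩ v‖ₑ :=
    fun k x v => by
      rw [LinearMap.smul_apply, enorm_smul, henorm (ha _)]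
  have hLmem : ∀ k v, Memℓp (fun x => L k x v) p := fun k v => by
    refine memℓp_of_tsum_enorm_ne_top hp' ?_
    simp only [hL]
    have h1 := ENNReal.ne_top_of_tsum_ne_top (hsum v) k
    rw [Ne, ENNReal.rpow_eq_top_iff_of_pos hq', ENNReal.mul_eq_top, not_or, not_and, not_and] at h1
    have h2 := h1.1 (hb0 k)
    rwa [ENNReal.rpow_eq_top_iff_of_pos (by positivity)] at h2
  let M : ∀ k : ℤ, V →ₗ[ℂ] lp (fun x : A.net k => G ⟨k, x⟩) p := fun k =>
    ((((2 : ℝ≥0∞) ^ ((k : ℝ) * s)).toReal : ℝ) : ℂ) • lp.piMap (L k) (hLmem k)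
  have hM : ∀ k v, ‖M k v‖ₑ = (2 : ℝ≥0∞) ^ ((k : ℝ) * s) * (∑' x : A.net k,
      (μ (A.vball ⟨k, x⟩) ^ (1 / p.toReal) * ‖J ⟨k, x⟩ v‖ₑ) ^ p.toReal) ^ (1 / p.toReal) :=
    fun k v => by
      rw [LinearMap.smul_apply, enorm_smul, henorm (hb k), lp.enorm_piMap hp']
      simp only [hL]
  have hMmem : ∀ v, Memℓp (fun k => M k v) q := fun v => by
    refine memℓp_of_tsum_enorm_ne_top hq' ?_
    simp only [hM]
    exact hsum v
  refine ⟨lp (fun k : ℤ => lp (fun x : A.net k => G ⟨k, x⟩) p) q, inferInstance, inferInstance,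
    lp.piMap M hMmem, K, ?_, fun v => ?_⟩
  · exact lp.surjective_inclusionInDoubleDual hq1 hq fun k =>
      lp.surjective_inclusionInDoubleDual hp1 hp fun x => hG _
  · rw [lp.enorm_piMap hq']
    simp only [hM]
    exact hK fun x => ‖J x v‖ₑ

/-- The Besov space modulo constants is a reflexive Banach space for `1 < p, q < ∞`. -/
theorem isReflexiveBanach_besov (h : PolyDoubling μ C Q) (hp1 : 1 < p) (hp : p ≠ ∞)
    (hq1 : 1 < q) (hq : q ≠ ∞)
    (hN : IsQuasiBanach (quotNorm (A.besovNorm μ s p q) (A.besovConst μ s p q))) :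
    IsReflexiveBanach (quotNorm (A.besovNorm μ s p q) (A.besovConst μ s p q)) := by
  classical
  have hquot := quotNorm_besov_mkQ A μ h.pos h.lt_top s p q
  have h2 : 0 < (2 : ℝ≥0∞).toReal := by norm_num
  have hgrad : ∀ (f : A.besov μ s p q) x, (∑' y : A.graph.neighborSet x,
      ‖A.poisson μ f.1 y - A.poisson μ f.1 x‖ₑ ^ (2 : ℝ≥0∞).toReal) ^ (1 / (2 : ℝ≥0∞).toReal) =
        A.gradNorm (A.poisson μ f.1) x := fun f x => by
    rw [gradNorm]
    simp
  let D : ∀ x (y : A.graph.neighborSet x), A.besov μ s p q →ₗ[ℂ] ℂ := fun x y =>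
    { toFun := fun f => A.poisson μ f.1 y - A.poisson μ f.1 x
      map_add' := fun f g => by
        simp only [Submodule.coe_add, A.poisson_add μ f.2.1 g.2.1, Pi.add_apply]
        ring
      map_smul' := fun c f => by
        simp only [Submodule.coe_smul, A.poisson_smul, Pi.smul_apply, RingHom.id_apply,
          smul_eq_mul]
        ring }
  have hD : ∀ x f, Memℓp (fun y => D x y f) 2 := fun x f => by
    refine memℓp_of_tsum_enorm_ne_top h2 ?_
    obtain ⟨K, hK⟩ := h.exists_apply_le_seqNorm A s (zero_lt_one.trans hp1).ne'
      (zero_lt_one.trans hq1).ne' x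
    have h1 := (hK _).trans_lt (ENNReal.mul_lt_top ENNReal.coe_lt_top f.2.2)
    rw [← hgrad] at h1
    exact ((ENNReal.rpow_lt_top_iff_of_pos (by positivity)).1 h1).ne
  -- The `ℓ²` norm of `J x f` is the gradient of `Pf` at `x`. As `J x` is linear, the gradient
  -- satisfies the triangle inequality with constant 1, where `gradNorm_add_le` has 2.
  let J : ∀ x, A.besov μ s p q →ₗ[ℂ] lp (fun _ : A.graph.neighborSet x => ℂ) 2 := fun x =>
    lp.piMap (D x) (hD x)
  have hJ : ∀ f, (fun x => ‖J x f‖ₑ) = A.gradNorm (A.poisson μ f.1) := fun f => by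
    funext x
    rw [lp.enorm_piMap h2, ← hgrad]
    rfl
  obtain ⟨F, _, _, T, K, hF, hT⟩ := h.exists_linearMap_reflexive hp1 hp hq1 hq (fun x =>
    lp.surjective_inclusionInDoubleDual (by norm_num) (by norm_num) fun _ =>
      surjective_inclusionInDoubleDual_complex) J fun f => by rw [hJ]; exact f.2.2
  have hT1 : ∀ f, A.besovNorm μ s p q f ≤ K * ‖T f‖ := fun f => by
    have h1 := (hT f).1
    rw [hJ] at h1
    simpa [besovNorm] using
      ENNReal.toReal_mono (ENNReal.mul_ne_top ENNReal.coe_ne_top enorm_ne_top) h1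
  have hT2 : ∀ f, ‖T f‖ ≤ K * A.besovNorm μ s p q f := fun f => by
    have h1 := (hT f).2
    rw [hJ] at h1
    simpa [besovNorm] using
      ENNReal.toReal_mono (ENNReal.mul_ne_top ENNReal.coe_ne_top f.2.2.ne) h1
  have hker : A.besovConst μ s p q ≤ LinearMap.ker T := fun f hf => by
    have h1 : A.besovNorm μ s p q f = 0 := by
      rw [← hquot f, show (A.besovConst μ s p q).mkQ f = 0 from
        (Submodule.Quotient.mk_eq_zero _).2 hf]
      exact (hN.1.eq_zero_iff 0).2 rfl
    have h3 := hT2 f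
    rw [h1, mul_zero] at h3
    exact norm_le_zero_iff.1 h3
  refine hN.isReflexiveBanach (K := K) (K' := K) ?_ ((A.besovConst μ s p q).liftQ T hker) ?_ ?_ hF
  · intro v w
    obtain ⟨f, rfl⟩ := (A.besovConst μ s p q).mkQ_surjective v
    obtain ⟨g, rfl⟩ := (A.besovConst μ s p q).mkQ_surjective w
    rw [← map_add, hquot, hquot, hquot]
    unfold besovNorm
    rw [← ENNReal.toReal_add f.2.2.ne g.2.2.ne]
    refine ENNReal.toReal_mono (ENNReal.add_ne_top.2 ⟨f.2.2.ne, g.2.2.ne⟩) ?_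
    refine le_trans ?_ (seqNorm_add_le_of_one_le hp1.le hq1.le _ _)
    have h1 := A.seqNorm_le_mul μ s p q (w := A.gradNorm (A.poisson μ (f + g).1))
      (w' := fun x => A.gradNorm (A.poisson μ f.1) x + A.gradNorm (A.poisson μ g.1) x) 1
      fun x => by
        rw [← hJ, ← hJ, ← hJ, ENNReal.coe_one, one_mul]
        change ‖J x (f + g)‖ₑ ≤ ‖J x f‖ₑ + ‖J x g‖ₑ
        rw [map_add]
        exact enorm_add_le _ _
    simpa using h1
  · intro v
    obtain ⟨f, rfl⟩ := (A.besovConst μ s p q).mkQ_surjective v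
    rw [hquot]
    exact hT1 f
  · intro v
    obtain ⟨f, rfl⟩ := (A.besovConst μ s p q).mkQ_surjective v
    rw [hquot]
    exact hT2 f

end PolyDoubling

/-! ### The theorem -/

theorem mainTheorem3 {Z : Type*} [MetricSpace Z] [MeasurableSpace Z] [BorelSpace Z]
    (μ : Measure Z)
    (hpos : ∀ (ξ : Z) (r : ℝ), 0 < r → 0 < μ (Metric.ball ξ r))
    (hfin : ∀ (ξ : Z) (r : ℝ), μ (Metric.ball ξ r) < ∞)
    (C Q : ℝ) (hQ : 0 < Q)
    (hdoubling : ∀ (ξ : Z) (r t : ℝ), 0 < r → 1 ≤ t →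
      μ (Metric.ball ξ (t * r)) ≤ ENNReal.ofReal (C * t ^ Q) * μ (Metric.ball ξ r))
    (A : HyperbolicFilling Z) (Ψ : A.LipPartition) (x₀ : A.Vertex)
    (s : ℝ) (p q : ℝ≥0∞) (hs : 0 < s) (hp : ENNReal.ofReal (Q / (Q + s)) < p) (hq : 0 < q) :
    -- (i) traces exist on `D̊`, and the trace vanishes exactly on `I̊`
    (A.I₀ μ s p q x₀ ≤ A.D₀ μ s p q x₀ ∧ A.K₀ μ s p q x₀ ≤ A.D₀ μ s p q x₀) ∧
    (∀ u ∈ A.D₀ μ s p q x₀,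
      (∃ f ∈ A.besov μ s p q, Ψ.IsTrace μ u f) ∧
      ∀ f : Z → ℂ, Ψ.IsTrace μ u f → (f =ᵐ[μ] 0 ↔ u ∈ A.I₀ μ s p q x₀)) ∧
    -- (ii) the quotient by `I̊` is the Besov space of a.e. classes, constants kept
    (IsQuasiNorm (quotNorm (A.normD μ s p q x₀)
        ((A.I₀ μ s p q x₀).submoduleOf (A.D₀ μ s p q x₀))) ∧
      ∃ Φ : (A.D₀ μ s p q x₀ ⧸ (A.I₀ μ s p q x₀).submoduleOf (A.D₀ μ s p q x₀)) ≃ₗ[ℂ]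
          (A.besov μ s p q ⧸ A.besovZero μ s p q),
        (∀ (u : A.D₀ μ s p q x₀) (f : A.besov μ s p q), Ψ.IsTrace μ u.1 f.1 →
          Φ (((A.I₀ μ s p q x₀).submoduleOf (A.D₀ μ s p q x₀)).mkQ u) =
            (A.besovZero μ s p q).mkQ f) ∧
        EquivNorms Φ
          (quotNorm (A.normD μ s p q x₀) ((A.I₀ μ s p q x₀).submoduleOf (A.D₀ μ s p q x₀)))
          (quotNorm (fun f => A.besovNorm μ s p q f + ∫ ζ in A.vball x₀, ‖f.1 ζ‖ ∂μ)
            (A.besovZero μ s p q))) ∧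
    -- the quotient by `K̊` is the Besov space modulo constants
    (IsQuasiNorm (quotNorm (A.normD μ s p q x₀)
        ((A.K₀ μ s p q x₀).submoduleOf (A.D₀ μ s p q x₀))) ∧
      ∃ Φ : (A.D₀ μ s p q x₀ ⧸ (A.K₀ μ s p q x₀).submoduleOf (A.D₀ μ s p q x₀)) ≃ₗ[ℂ]
          (A.besov μ s p q ⧸ A.besovConst μ s p q),
        (∀ (u : A.D₀ μ s p q x₀) (f : A.besov μ s p q), Ψ.IsTrace μ u.1 f.1 →
          Φ (((A.K₀ μ s p q x₀).submoduleOf (A.D₀ μ s p q x₀)).mkQ u) =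
            (A.besovConst μ s p q).mkQ f) ∧
        EquivNorms Φ
          (quotNorm (A.normD μ s p q x₀) ((A.K₀ μ s p q x₀).submoduleOf (A.D₀ μ s p q x₀)))
          (quotNorm (A.besovNorm μ s p q) (A.besovConst μ s p q))) ∧
    -- completeness and reflexivity of the Besov space modulo constants
    IsQuasiBanach (quotNorm (A.besovNorm μ s p q) (A.besovConst μ s p q)) ∧
    (1 < p → p < ∞ → 1 < q → q < ∞ →
      IsReflexiveBanach (quotNorm (A.besovNorm μ s p q) (A.besovConst μ s p q))) := by
  have h : PolyDoubling μ C Q := ⟨hQ, hpos, hfin, hdoubling⟩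
  refine ⟨⟨h.I₀_le_D₀ hs hp hq x₀, h.K₀_le_D₀ hs hp hq x₀⟩, fun u hu =>
    ⟨h.exists_isTrace_mem_besov Ψ hs hp hq hu.1, fun f hf => ?_⟩,
    h.exists_trace_equiv_I₀ Ψ hs hp hq x₀, ?_⟩
  · rw [h.ae_eq_zero_iff_of_isTrace Ψ hs hp hq hu.1 hf]
    exact ⟨fun hI => ⟨hI, hu.2⟩, fun hI => hI.1⟩
  · obtain ⟨hK, hB⟩ := h.exists_trace_equiv_K₀ Ψ hs hp hq x₀
    exact ⟨hK, hB, fun hp1 hp2 hq1 hq2 => h.isReflexiveBanach_besov hp1 hp2.ne hq1 hq2.ne hB⟩
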